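/- A non-negative random variable $Z$ is called regularly varying with index $\rho\in\mathbb R$ if $P(Z>x)>0$ for all large $x$ and $\lim_{x\to\infty}P(Z>sx)/P(Z>x)=s^{\rho}$ for every $s>0$. Throughout $0^0:=1$ and empty products are $1$. Theorem. Let $X_1,\dots,X_n$ be independent non-negative random variables, each regularly varying with index $-1$. Let $\alpha_1,\dots,\alpha_n,\beta_1,\dots,\beta_n\ge 0$ with $\max_i\alpha_i>0$ and $\max_i\beta_i>0$, and set $Y_0=\prod_{i=1}^n X_i^{\alpha_i}$, $Y_1=\prod_{i=1}^n X_i^{\beta_i}$. Then the linear program $$\sum_{i=1}^n\kappa_i\to\min!\quad\text{subject to}\quad \sum_{i=1}^n\alpha_i\kappa_i\ge 1,\quad \sum_{i=1}^n\beta_i\kappa_i\ge 1,\quad \kappa_i\ge 0\ (1\le i\le n)$$ has a solution $(\kappa_1,\dots,\kappa_n)$. If the solution is unique, then at most two of the $\kappa_i$ are strictly positive and $\min\{Y_0,Y_1\}$ is regularly varying with index $-\sum_{i=1}^n\kappa_i$. Moreover: (i) If the solution is unique and $\kappa_i,\kappa_j>0$ for some $i\ne j$, then $\alpha_i\beta_j-\alpha_j\beta_i\neq0$,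 $(\alpha_i-\alpha_j)(\beta_j-\beta_i)\ne 0$, and for all $s_0,s_1>0$ $$\lim_{x\to\infty}\frac{P(Y_0>s_0x,\,Y_1>s_1x)}{P(X_i>x^{\kappa_i})\,P(X_j>x^{\kappa_j})}=D\,s_0^{(\beta_i-\beta_j)/(\alpha_i\beta_j-\alpha_j\beta_i)}\,s_1^{(\alpha_j-\alpha_i)/(\alpha_i\beta_j-\alpha_j\beta_i)},$$ where $$D:=\frac{|\alpha_i\beta_j-\alpha_j\beta_i|}{(\alpha_i-\alpha_j)(\beta_j-\beta_i)}\,E\Big(\prod_{m\in\{1,\dots,n\}\setminus\{i,j\}}X_m^{(\alpha_m(\beta_j-\beta_i)+\beta_m(\alpha_i-\alpha_j))/(\alpha_i\beta_j-\alpha_j\beta_i)}\Big)$$ and the expectation is finite. (ii) If the solution is unique, $\kappa_i>0$ for exactly one $i$ and $\kappa_j=0$ for all $j\neq i$, then $\alpha_i,\beta_i>0$ and, with $J_i:=\{1,\dots,n\}\setminus\{i\}$, for all $s_0,s_1>0$ $$\lim_{x\to\infty}\frac{P(Y_0>s_0x,\,Y_1>s_1x)}{P(X_i>x^{\kappa_i})}=\begin{cases}E\Big(\min\Big(s_0^{-1}\prod_{j\in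 J_i}X_j^{\alpha_j},\,s_1^{-1}\prod_{j\in J_i}X_j^{\beta_j}\Big)^{1/\beta_i}\Big),&\alpha_i=\beta_i,\\[1ex] E\Big(\prod_{j\in J_i}X_j^{\beta_j/\beta_i}\mathbf 1_{\{X_j^{\alpha_j}>0\}}\Big)s_1^{-1/\beta_i},&\alpha_i>\beta_i,\\[1ex] E\Big(\prod_{j\in J_i}X_j^{\alpha_j/\alpha_i}\mathbf 1_{\{X_j^{\beta_j}>0\}}\Big)s_0^{-1/\alpha_i},&\alpha_i<\beta_i,\end{cases}$$ and the expectation in the applicable case is finite. (iii) In any case (whether or not the solution is unique), for every solution $(\kappa_1,\dots,\kappa_n)$ and every $\varepsilon>0$, as $x\to\infty$, $$P(Y_0>x,Y_1>x)=o\big(x^{\varepsilon-\sum_{i=1}^n\kappa_i}\big),\qquad x^{-\varepsilon-\sum_{i=1}^n\kappa_i}=o\big(P(Y_0>x,Y_1>x)\big).$$ -/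

import Mathlib

open MeasureTheory ProbabilityTheory Filter Topology Asymptotics

noncomputable section

/-- A function `f` is regularly varying at infinity with index `ρ`: it is Borel measurable,
eventually positive, and `f (s x) / f x → s ^ ρ` as `x → ∞` for every `s > 0`. -/
def IsRegularlyVarying (f : ℝ → ℝ) (ρ : ℝ) : Prop :=
  Measurable f ∧ (∀ᶠ x in atTop, 0 < f x) ∧
    ∀ s : ℝ, 0 < s → Tendsto (fun x => f (s * x) / f x) atTop (𝓝 (s ^ ρ))

/-- A non-negative random variable `Z` is regularly varying with index `ρ` if its survival
function `x ↦ P(Z > x)` is. -/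
def IsRegularlyVaryingRV {Ω : Type*} [MeasurableSpace Ω] (P : Measure Ω) (Z : Ω → ℝ) (ρ : ℝ) :
    Prop :=
  IsRegularlyVarying (fun x => P.real {ω | x < Z ω}) ρ

/-- The power product `∏ i, X i ^ γ i` (with the convention `0 ^ 0 = 1`). -/
def powerProduct {Ω : Type*} {n : ℕ} (X : Fin n → Ω → ℝ) (γ : Fin n → ℝ) (ω : Ω) : ℝ :=
  ∏ i, X i ω ^ γ i

/-- Feasibility for the constraints `∑ α i κ i ≥ 1`, `∑ β i κ i ≥ 1`, `κ ≥ 0`. -/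
def LPFeasible {n : ℕ} (α β κ : Fin n → ℝ) : Prop :=
  1 ≤ ∑ i, α i * κ i ∧ 1 ≤ ∑ i, β i * κ i ∧ ∀ i, 0 ≤ κ i

/-- `κ` solves the linear program: minimize `∑ κ i` over all feasible points. -/
def LPSolution {n : ℕ} (α β κ : Fin n → ℝ) : Prop :=
  LPFeasible α β κ ∧ ∀ κ' : Fin n → ℝ, LPFeasible α β κ' → ∑ i, κ i ≤ ∑ i, κ' i

/-- `κ` is the only solution of the linear program. -/
def LPUniqueSolution {n : ℕ} (α β κ : Fin n → ℝ) : Prop :=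
  LPSolution α β κ ∧ ∀ κ' : Fin n → ℝ, LPSolution α β κ' → κ' = κ

end

/-! On the logarithmic scale, `X i` exceeds `x ^ κ i` with probability about `x ^ (-κ i)`. By
independence, forcing both products above `x` this way costs `x ^ (-∑ κ i)`, and the constraints say
exactly that the products do become that large. The linear program selects the cheapest scenario.

The matching upper bound is its dual. On the event, `x ≤ Y₀ ^ w * Y₁ ^ (1 - w)`, a power product in
which `X m` has exponent `w α m + (1 - w) β m`. Optimal weights make these exponents as small as
possible, and moments of order below one are finite. For (iii), Markov's inequality with such a
moment and the box `X i > 2 x ^ κ i` suffice.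

Uniqueness sharpens this: every nonzero direction that respects the active constraints must strictly
increase the objective (`sum_pos_of_direction`). Hence at most two components are positive, and
every other `X m` has strictly positive reduced cost, so the moments in the limit exist with room to
spare. One can then condition on those factors (`tendsto_measureReal_mixture`), with Potter bounds
as the dominating function.

With one positive component, the conditional event says that `X i` exceeds the larger of two
thresholds; a slack constraint gives a threshold of lower order. With two, the conditional event is,
in logarithmic coordinates, an open planar cone containing the positive quadrant, and the other
factors only move its apex. The cone is a union of two half cones meeting in the quadrant. Relative
to the quadrant, a half cone of slope `ρ` has asymptotic mass `∫₁^∞ t ^ (ρ - 2) dt = 1 / (1 - ρ)`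
(`half_cone_tendsto`), and inclusion-exclusion gives the prefactor of `D`.

Regular variation of the minimum follows by taking `s₀ = s₁ = s`: the limit is a positive constant
times a power of `s`, whose exponent is `-∑ κ i` by the tight constraints. -/

noncomputable section

/-! ### Regularly varying tails and Potter bounds -/

/-- Positive survival functions that are regularly varying with index `-1`. -/
structure RVTail (F : ℝ → ℝ) : Prop where
  anti : Antitone F
  pos : ∀ x, 0 < F x
  le_one : ∀ x, F x ≤ 1
  lim : ∀ s, 0 < s → Tendsto (fun x => F (s * x) / F x) atTop (𝓝 s⁻¹)

/-- The Potter envelope of the function `t ↦ t⁻¹`. -/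
def potterEnv (δ t : ℝ) : ℝ := t ^ (-1 - δ) + t ^ (-1 + δ)

lemma potterEnv_pos {δ t : ℝ} (ht : 0 < t) : 0 < potterEnv δ t := by
  unfold potterEnv; positivity

/-- This is why the envelope is a sum of two powers and not a case distinction at `1`: random scale
factors split off, and what remains expands into monomials whose moments can be computed. -/
lemma potterEnv_mul_le {δ s t : ℝ} (hs : 0 < s) (ht : 0 < t) :
    potterEnv δ (s * t) ≤ potterEnv δ s * potterEnv δ t := by
  unfold potterEnv
  rw [Real.mul_rpow hs.le ht.le, Real.mul_rpow hs.le ht.le]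
  have h1 : 0 < s ^ (-1 - δ) := by positivity
  have h2 : 0 < s ^ (-1 + δ) := by positivity
  have h3 : 0 < t ^ (-1 - δ) := by positivity
  have h4 : 0 < t ^ (-1 + δ) := by positivity
  nlinarith [mul_pos h1 h4, mul_pos h2 h3]

lemma potterEnv_le_of_one_le {δ t : ℝ} (hδ : 0 < δ) (ht : 1 ≤ t) :
    potterEnv δ t ≤ 2 * t ^ (-1 + δ) := by
  unfold potterEnv
  have := Real.rpow_le_rpow_of_exponent_le ht (show -1 - δ ≤ -1 + δ by linarith)
  linarith

lemma potterEnv_le_of_le_one {δ t : ℝ} (hδ : 0 < δ) (h0 : 0 < t) (ht : t ≤ 1) :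
    potterEnv δ t ≤ 2 * t ^ (-1 - δ) := by
  unfold potterEnv
  have := Real.rpow_le_rpow_of_exponent_ge h0 ht (show -1 - δ ≤ -1 + δ by linarith)
  linarith

namespace RVTail

variable {F : ℝ → ℝ}

lemma lim_mul_const (h : RVTail F) {s : ℝ} (hs : 0 < s) {ι : Type*} {l : Filter ι} {y : ι → ℝ}
    (hy : Tendsto y l atTop) : Tendsto (fun x => F (y x * s) / F (y x)) l (𝓝 s⁻¹) := by
  simpa [Function.comp_def, mul_comm] using (h.lim s hs).comp hy

/-- The ratio for `s = 2` tends to `1 / 2 < 2 ^ (-1 + δ)`. Iterating along `y * 2 ^ k` and filling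
the dyadic gaps by monotonicity loses at most a factor `2 ^ (1 - δ) ≤ 2`. -/
lemma potter_upper (h : RVTail F) {δ : ℝ} (hδ : 0 < δ) (hδ1 : δ < 1) :
    ∃ y₀ : ℝ, 1 ≤ y₀ ∧ ∀ y, y₀ ≤ y → ∀ t, 1 ≤ t → F (y * t) ≤ 2 * t ^ (-1 + δ) * F y := by
  have h2 : ∀ᶠ x in atTop, F (2 * x) / F x < (2:ℝ) ^ (-1 + δ) := by
    apply (h.lim 2 two_pos).eventually_lt_const
    rw [← Real.rpow_neg_one]
    exact Real.rpow_lt_rpow_of_exponent_lt one_lt_two (by linarith)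
  obtain ⟨y₁, hy₁⟩ := eventually_atTop.1 h2
  refine ⟨max 1 y₁, le_max_left _ _, fun y hy t ht => ?_⟩
  have hy1 : 1 ≤ y := (le_max_left _ _).trans hy
  have hyy : y₁ ≤ y := (le_max_right _ _).trans hy
  have hq : (0:ℝ) < 2 ^ (-1 + δ) := by positivity
  have ind : ∀ k : ℕ, F (y * 2 ^ k) ≤ ((2:ℝ) ^ (-1 + δ)) ^ k * F y := by
    intro k
    induction k with
    | zero => simp
    | succ k ih =>
      have hk : y₁ ≤ y * 2 ^ k :=
        hyy.trans (le_mul_of_one_le_right (by linarith) (one_le_pow₀ one_le_two))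
      have := (div_lt_iff₀ (h.pos _)).1 (hy₁ _ hk)
      calc F (y * 2 ^ (k + 1)) = F (2 * (y * 2 ^ k)) := by ring_nf
        _ ≤ 2 ^ (-1 + δ) * F (y * 2 ^ k) := this.le
        _ ≤ 2 ^ (-1 + δ) * (((2:ℝ) ^ (-1 + δ)) ^ k * F y) := by gcongr
        _ = _ := by ring
  obtain ⟨k, hk1, hk2⟩ := exists_nat_pow_near ht one_lt_two
  have e1 : ((2:ℝ) ^ (-1 + δ)) ^ k = (2 ^ k : ℝ) ^ (-1 + δ) := by
    rw [← Real.rpow_natCast, ← Real.rpow_mul two_pos.le, mul_comm,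
      Real.rpow_mul two_pos.le, Real.rpow_natCast]
  have e2 : (2 ^ k : ℝ) ^ (-1 + δ) ≤ 2 * t ^ (-1 + δ) := by
    have a1 : t / 2 ≤ 2 ^ k := by rw [pow_succ] at hk2; linarith
    calc (2 ^ k : ℝ) ^ (-1 + δ) ≤ (t / 2) ^ (-1 + δ) :=
          Real.rpow_le_rpow_of_nonpos (by positivity) a1 (by linarith)
      _ = t ^ (-1 + δ) * 2 ^ (1 - δ) := by
          rw [Real.div_rpow (by linarith) two_pos.le, div_eq_mul_inv, ← Real.rpow_neg two_pos.le]
          ring_nf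
      _ ≤ t ^ (-1 + δ) * 2 ^ (1:ℝ) := by
          gcongr
          · norm_num
          · linarith
      _ = _ := by rw [Real.rpow_one]; ring
  calc F (y * t) ≤ F (y * 2 ^ k) := h.anti (by gcongr)
    _ ≤ ((2:ℝ) ^ (-1 + δ)) ^ k * F y := ind k
    _ ≤ _ := by rw [e1]; exact mul_le_mul_of_nonneg_right e2 (h.pos _).le

/-- The same doubling argument, overshooting to `2 ^ (k + 1) ≤ 2 * t`; the loss is `2 ^ (1 + δ) ≤
4`. -/
lemma potter_lower (h : RVTail F) {δ : ℝ} (hδ : 0 < δ) (hδ1 : δ < 1) :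
    ∃ y₀ : ℝ, 1 ≤ y₀ ∧ ∀ y, y₀ ≤ y → ∀ t, 1 ≤ t → F y ≤ 4 * t ^ (1 + δ) * F (y * t) := by
  have h2 : ∀ᶠ x in atTop, (2:ℝ) ^ (-1 - δ) < F (2 * x) / F x := by
    apply (h.lim 2 two_pos).eventually_const_lt
    rw [← Real.rpow_neg_one]
    exact Real.rpow_lt_rpow_of_exponent_lt one_lt_two (by linarith)
  obtain ⟨y₁, hy₁⟩ := eventually_atTop.1 h2
  refine ⟨max 1 y₁, le_max_left _ _, fun y hy t ht => ?_⟩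
  have hy1 : 1 ≤ y := (le_max_left _ _).trans hy
  have hyy : y₁ ≤ y := (le_max_right _ _).trans hy
  have hq : (0:ℝ) < 2 ^ (1 + δ) := by positivity
  have ind : ∀ k : ℕ, F y ≤ ((2:ℝ) ^ (1 + δ)) ^ k * F (y * 2 ^ k) := by
    intro k
    induction k with
    | zero => simp
    | succ k ih =>
      have hk : y₁ ≤ y * 2 ^ k :=
        hyy.trans (le_mul_of_one_le_right (by linarith) (one_le_pow₀ one_le_two))
      have h3 := (lt_div_iff₀ (h.pos _)).1 (hy₁ _ hk)
      have h4 : F (y * 2 ^ k) ≤ 2 ^ (1 + δ) * F (2 * (y * 2 ^ k)) := by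
        rw [show (-1 - δ) = -(1 + δ) by ring, Real.rpow_neg two_pos.le, inv_mul_lt_iff₀ hq] at h3
        exact h3.le
      calc F y ≤ ((2:ℝ) ^ (1 + δ)) ^ k * F (y * 2 ^ k) := ih
        _ ≤ ((2:ℝ) ^ (1 + δ)) ^ k * (2 ^ (1 + δ) * F (2 * (y * 2 ^ k))) := by gcongr
        _ = _ := by ring_nf
  obtain ⟨k, hk1, hk2⟩ := exists_nat_pow_near ht one_lt_two
  have e1 : ((2:ℝ) ^ (1 + δ)) ^ (k + 1) = (2 ^ (k + 1) : ℝ) ^ (1 + δ) := by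
    rw [← Real.rpow_natCast, ← Real.rpow_mul two_pos.le, mul_comm,
      Real.rpow_mul two_pos.le, Real.rpow_natCast]
  have e2 : (2 ^ (k + 1) : ℝ) ^ (1 + δ) ≤ 4 * t ^ (1 + δ) := by
    calc (2 ^ (k + 1) : ℝ) ^ (1 + δ) ≤ (2 * t) ^ (1 + δ) :=
          Real.rpow_le_rpow (by positivity) (by rw [pow_succ]; linarith) (by linarith)
      _ = 2 ^ (1 + δ) * t ^ (1 + δ) := Real.mul_rpow two_pos.le (by linarith)
      _ ≤ 2 ^ (2:ℝ) * t ^ (1 + δ) := by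
          gcongr
          · norm_num
          · linarith
      _ = _ := by norm_num
  calc F y ≤ ((2:ℝ) ^ (1 + δ)) ^ (k + 1) * F (y * 2 ^ (k + 1)) := ind _
    _ ≤ ((2:ℝ) ^ (1 + δ)) ^ (k + 1) * F (y * t) := by
        gcongr
        exact h.anti (by gcongr)
    _ ≤ _ := by rw [e1]; exact mul_le_mul_of_nonneg_right e2 (h.pos _).le

lemma potter (h : RVTail F) {δ : ℝ} (hδ : 0 < δ) (hδ1 : δ < 1) :
    ∃ C y₀ : ℝ, 0 < C ∧ 1 ≤ y₀ ∧ ∀ y, y₀ ≤ y → ∀ t, 0 < t →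
      F (y * t) ≤ C * potterEnv δ t * F y := by
  obtain ⟨y₁, hy₁, H₁⟩ := h.potter_upper hδ hδ1
  obtain ⟨y₂, hy₂, H₂⟩ := h.potter_lower hδ hδ1
  set y₀ := max y₁ y₂ with hy₀
  have hy₀1 : 1 ≤ y₀ := hy₁.trans (le_max_left _ _)
  have hF0 := h.pos y₀
  have hF1 := h.le_one y₀
  have hinv : 1 ≤ (F y₀)⁻¹ := (one_le_inv₀ hF0).2 hF1
  refine ⟨4 * (F y₀)⁻¹, y₀, by positivity, hy₀1, fun y hy t ht => ?_⟩
  have hFy := h.pos y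
  have hp1 : 0 < t ^ (-1 - δ) := by positivity
  have hp2 : 0 < t ^ (-1 + δ) := by positivity
  have hy0 : 0 < y := by linarith
  rcases le_total 1 t with h1 | h1
  · calc F (y * t) ≤ 2 * t ^ (-1 + δ) * F y := H₁ y ((le_max_left _ _).trans hy) t h1
      _ ≤ 4 * (F y₀)⁻¹ * potterEnv δ t * F y := by
        gcongr
        · linarith
        · unfold potterEnv; linarith
  · have key : ∀ z, y₀ ≤ z → z ≤ y → F z ≤ 4 * (y / z) ^ (1 + δ) * F y := by
      intro z hz hzy
      have hz0 : 0 < z := by linarith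
      have := H₂ z ((le_max_right _ _).trans hz) (y / z) ((one_le_div hz0).2 hzy)
      rwa [mul_div_cancel₀ _ hz0.ne'] at this
    have hte : t ^ (-1 - δ) ≤ potterEnv δ t := by unfold potterEnv; linarith
    rcases le_total y₀ (y * t) with h2 | h2
    · have h3 := key (y * t) h2 (mul_le_of_le_one_right hy0.le h1)
      have e : (y / (y * t)) ^ (1 + δ) = t ^ (-1 - δ) := by
        rw [div_mul_cancel_left₀ hy0.ne', Real.inv_rpow ht.le, ← Real.rpow_neg ht.le]
        ring_nf
      rw [e] at h3
      refine h3.trans ?_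
      gcongr
      linarith
    -- Below `y₀` no regularity of `F` is available. The bound `F ≤ 1` is paid for by the constant
    -- `(F y₀)⁻¹`, and `y / y₀ ≤ t⁻¹` turns the loss between `y₀` and `y` into a power of `t`. This
    -- makes the estimate valid for every `t > 0`.
    · have h3 := key y₀ le_rfl hy
      have e : (y / y₀) ^ (1 + δ) ≤ t ^ (-1 - δ) := by
        rw [show -1 - δ = -(1 + δ) by ring, Real.rpow_neg ht.le, ← Real.inv_rpow ht.le]
        apply Real.rpow_le_rpow (by positivity) _ (by linarith)
        rw [div_le_iff₀ (by linarith), inv_mul_eq_div, le_div_iff₀ ht]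
        exact h2
      calc F (y * t) ≤ 1 := h.le_one _
        _ = (F y₀)⁻¹ * F y₀ := (inv_mul_cancel₀ hF0.ne').symm
        _ ≤ (F y₀)⁻¹ * (4 * (y / y₀) ^ (1 + δ) * F y) := by gcongr
        _ ≤ (F y₀)⁻¹ * (4 * potterEnv δ t * F y) := by gcongr; exact e.trans hte
        _ = _ := by ring

/-- Potter's bound anchored at the fixed point `y₀`; on `(0, y₀]` the trivial bound `F ≤ 1` is
absorbed by `y₀ ^ r`. -/
lemma le_rpow (h : RVTail F) {r : ℝ} (hr0 : 0 < r) (hr : r < 1) :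
    ∃ C, 0 < C ∧ ∀ t, 0 < t → F t ≤ C * t ^ (-r) := by
  obtain ⟨y₀, hy₀, H⟩ := h.potter_upper (δ := 1 - r) (by linarith) (by linarith)
  have hy0 : 0 < y₀ := by linarith
  refine ⟨2 * y₀ ^ r, by positivity, fun t ht => ?_⟩
  rcases le_total y₀ t with h1 | h1
  · have := H y₀ le_rfl (t / y₀) ((one_le_div hy0).2 h1)
    rw [mul_div_cancel₀ _ hy0.ne', show -1 + (1 - r) = -r by ring, Real.div_rpow ht.le hy0.le,
      Real.rpow_neg hy0.le, div_inv_eq_mul] at this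
    have hp : 0 < t ^ (-r) * y₀ ^ r := by positivity
    nlinarith [h.le_one y₀, h.pos y₀]
  · have h2 : 1 ≤ y₀ ^ r * t ^ (-r) := by
      rw [Real.rpow_neg ht.le, ← div_eq_mul_inv, one_le_div (by positivity)]
      exact Real.rpow_le_rpow ht.le h1 hr0.le
    nlinarith [h.le_one t]

lemma ge_rpow (h : RVTail F) {δ : ℝ} (hδ : 0 < δ) (hδ1 : δ < 1) :
    ∃ c, 0 < c ∧ ∀ t, 1 ≤ t → c * t ^ (-1 - δ) ≤ F t := by
  obtain ⟨y₀, hy₀, H⟩ := h.potter_lower hδ hδ1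
  have hy0 : 0 < y₀ := by linarith
  refine ⟨F y₀ / 4, by have := h.pos y₀; positivity, fun t ht => ?_⟩
  have h1 := (H y₀ le_rfl t ht).trans
    (mul_le_mul_of_nonneg_left (h.anti (le_mul_of_one_le_left (by linarith) hy₀)) (by positivity))
  rw [show -1 - δ = -(1 + δ) by ring, Real.rpow_neg (by linarith), ← div_eq_mul_inv,
    div_le_iff₀ (by positivity)]
  linarith

end RVTail

/-! ### Survival functions of random variables and moments of order below one -/

variable {Ω : Type*} [MeasurableSpace Ω] {P : Measure Ω} [IsProbabilityMeasure P]

lemma antitone_measureReal_lt (Z : Ω → ℝ) : Antitone fun x => P.real {ω | x < Z ω} :=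
  fun _ _ hxy => measureReal_mono fun _ h => lt_of_le_of_lt hxy h

lemma IsRegularlyVaryingRV.rvTail {Z : Ω → ℝ} (h : IsRegularlyVaryingRV P Z (-1)) :
    RVTail fun x => P.real {ω | x < Z ω} where
  anti := antitone_measureReal_lt Z
  pos x := by
    obtain ⟨y, hy, hxy⟩ := (h.2.1.and (eventually_ge_atTop x)).exists
    exact hy.trans_le (antitone_measureReal_lt Z hxy)
  le_one _ := measureReal_le_one
  lim s hs := by simpa [Real.rpow_neg_one] using h.2.2 s hs

lemma RVTail.integrable_rpow {Z : Ω → ℝ} (h : RVTail fun x => P.real {ω | x < Z ω})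
    (hm : Measurable Z) (h0 : ∀ ω, 0 ≤ Z ω) {θ : ℝ} (hθ0 : 0 ≤ θ) (hθ : θ < 1) :
    Integrable (fun ω => Z ω ^ θ) P := by
  rcases hθ0.eq_or_lt with rfl | hθ0
  · simp
  refine ⟨(hm.pow_const θ).aestronglyMeasurable, ?_⟩
  rw [hasFiniteIntegral_iff_ofReal (ae_of_all _ fun ω => Real.rpow_nonneg (h0 ω) _),
    lintegral_rpow_eq_lintegral_meas_lt_mul P (ae_of_all _ h0) hm.aemeasurable hθ0]
  refine ENNReal.mul_lt_top ENNReal.ofReal_lt_top ?_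
  -- Any decay rate strictly between `θ` and `1` would do: above `1` it makes the layer-cake
  -- integrand integrable, while on `(0, 1]` the factor `t ^ (θ - 1)` already is.
  obtain ⟨C, hC, H⟩ := h.le_rpow (r := (θ + 1) / 2) (by linarith) (by linarith)
  rw [← Set.Ioc_union_Ioi_eq_Ioi zero_le_one]
  refine (lintegral_union_le _ _ _).trans_lt (ENNReal.add_lt_top.2 ⟨?_, ?_⟩)
  · have hi : IntegrableOn (fun t : ℝ => t ^ (θ - 1)) (Set.Ioc 0 1) :=
      (intervalIntegrable_iff_integrableOn_Ioc_of_le zero_le_one).1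
        (intervalIntegral.intervalIntegrable_rpow' (by linarith))
    refine lt_of_le_of_lt ?_ hi.setLIntegral_lt_top
    refine lintegral_mono fun t => ?_
    exact mul_le_of_le_one_left zero_le prob_le_one
  · have hi : IntegrableOn (fun t : ℝ => C * t ^ (-((θ + 1) / 2) + (θ - 1))) (Set.Ioi 1) :=
      (integrableOn_Ioi_rpow_of_lt (by linarith) one_pos).const_mul C
    refine lt_of_le_of_lt ?_ hi.setLIntegral_lt_top
    refine setLIntegral_mono' measurableSet_Ioi fun t (ht : 1 < t) => ?_
    have ht0 : 0 < t := by linarith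
    rw [Real.rpow_add ht0, ← mul_assoc, ENNReal.ofReal_mul (by positivity)]
    gcongr
    rw [← ofReal_measureReal]
    exact ENNReal.ofReal_le_ofReal (H t ht0)

end

/-! ### The linear program: existence and duality -/

noncomputable section

/-- A minimax statement. The image of the simplex in the plane is convex, compact and disjoint from
the closed quadrant with corner `(c, c)`, so the two are strictly separated. The quadrant is
unbounded in both positive directions, so the separating functional has nonnegative coefficients;
normalised, these are the weights. -/
lemma exists_weight_of_forall_simplex {ι : Type*} [Fintype ι] (α β : ι → ℝ) (c : ℝ)
    (h : ∀ d : ι → ℝ, (∀ m, 0 ≤ d m) → ∑ m, d m = 1 →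
      ∑ m, α m * d m < c ∨ ∑ m, β m * d m < c) :
    ∃ w : ℝ, 0 ≤ w ∧ w ≤ 1 ∧ ∀ m, w * α m + (1 - w) * β m < c := by
  classical
  rcases isEmpty_or_nonempty ι with hι | ⟨⟨m₀⟩⟩
  · exact ⟨0, le_rfl, zero_le_one, fun m => hι.elim m⟩
  let L : (ι → ℝ) →ₗ[ℝ] ℝ × ℝ :=
    (∑ m, α m • LinearMap.proj m).prod (∑ m, β m • LinearMap.proj m)
  have hL : ∀ d, L d = (∑ m, α m * d m, ∑ m, β m * d m) := fun d => by simp [L]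
  have hLc : Continuous L := LinearMap.continuous_of_finiteDimensional L
  have hs : ∀ m, (α m, β m) ∈ L '' stdSimplex ℝ ι := fun m =>
    ⟨Pi.single m 1, single_mem_stdSimplex ℝ m, by simp [hL, Pi.single_apply]⟩
  let t : Set (ℝ × ℝ) := {y | c ≤ y.1} ∩ {y | c ≤ y.2}
  have htconv : Convex ℝ t := by
    apply Convex.inter
    · exact convex_halfSpace_ge (LinearMap.fst ℝ ℝ ℝ).isLinear c
    · exact convex_halfSpace_ge (LinearMap.snd ℝ ℝ ℝ).isLinear c
  have htclosed : IsClosed t :=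
    (isClosed_le continuous_const continuous_fst).inter
      (isClosed_le continuous_const continuous_snd)
  have hdisj : Disjoint (L '' stdSimplex ℝ ι) t := by
    rw [Set.disjoint_left]
    rintro _ ⟨d, hd, rfl⟩ ⟨h1, h2⟩
    simp only [hL, Set.mem_ofPred_eq] at h1 h2
    rcases h d hd.1 hd.2 with h3 | h3 <;> linarith
  obtain ⟨f, u, v, hfu, huv, hfv⟩ := geometric_hahn_banach_compact_closed
    ((convex_stdSimplex ℝ ι).linear_image L) ((isCompact_stdSimplex ℝ ι).image hLc)
    htconv htclosed hdisj
  set p := f (1, 0) with hp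
  set q := f (0, 1) with hq
  have hf : ∀ y : ℝ × ℝ, f y = y.1 * p + y.2 * q := by
    intro y
    have : y = y.1 • ((1:ℝ), (0:ℝ)) + y.2 • ((0:ℝ), (1:ℝ)) := by ext <;> simp
    conv_lhs => rw [this, map_add, map_smul, map_smul]
    rfl
  have hcc : v < c * p + c * q := by simpa [hf] using hfv (c, c) (by simp [t])
  have hp0 : 0 ≤ p := by
    by_contra hneg
    push Not at hneg
    -- With `p < 0`, the corner can be shifted inside the quadrant until the functional equals
    -- exactly `v`.
    have h1 : 0 ≤ (v - (c * p + c * q)) / p := div_nonneg_of_nonpos (by linarith) hneg.le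
    have h2 := hfv (c + (v - (c * p + c * q)) / p, c) (by simpa [t] using h1)
    rw [hf] at h2
    simp only [add_mul, div_mul_cancel₀ _ hneg.ne] at h2
    linarith
  have hq0 : 0 ≤ q := by
    by_contra hneg
    push Not at hneg
    have h1 : 0 ≤ (v - (c * p + c * q)) / q := div_nonneg_of_nonpos (by linarith) hneg.le
    have h2 := hfv (c, c + (v - (c * p + c * q)) / q) (by simpa [t] using h1)
    rw [hf] at h2
    simp only [add_mul, div_mul_cancel₀ _ hneg.ne] at h2
    linarith
  have hm : ∀ m, α m * p + β m * q < c * (p + q) := fun m => by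
    have := hfu _ (hs m)
    rw [hf] at this
    simp only at this
    linarith
  have hpq : 0 < p + q := by
    rcases (add_nonneg hp0 hq0).eq_or_lt with h0 | h0
    · have e1 : p = 0 := by linarith
      have e2 : q = 0 := by linarith
      have := hm m₀
      simp [e1, e2] at this
    · exact h0
  refine ⟨p / (p + q), by positivity, (div_le_one hpq).2 (by linarith), fun m => ?_⟩
  have e : p / (p + q) * α m + (1 - p / (p + q)) * β m = (α m * p + β m * q) / (p + q) := by
    field_simp
    ring
  rw [e, div_lt_iff₀ hpq]
  exact hm m

variable {n : ℕ} {α β κ : Fin n → ℝ}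

lemma exists_lpSolution (hα : ∀ i, 0 ≤ α i) (hβ : ∀ i, 0 ≤ β i)
    (hα_pos : ∃ i, 0 < α i) (hβ_pos : ∃ i, 0 < β i) : ∃ κ, LPSolution α β κ := by
  obtain ⟨i, hi⟩ := hα_pos
  obtain ⟨j, hj⟩ := hβ_pos
  set κ₀ : Fin n → ℝ := fun _ => 1 / α i + 1 / β j with hκ₀
  have hpos : 0 < 1 / α i + 1 / β j := by positivity
  have h0 : LPFeasible α β κ₀ := by
    refine ⟨?_, ?_, fun _ => hpos.le⟩
    · refine le_trans ?_ (Finset.single_le_sum (f := fun m => α m * κ₀ m)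
        (fun m _ => mul_nonneg (hα m) hpos.le) (Finset.mem_univ i))
      have : 0 < α i * (1 / β j) := by positivity
      simp only [hκ₀, mul_add, mul_one_div_cancel hi.ne']
      linarith
    · refine le_trans ?_ (Finset.single_le_sum (f := fun m => β m * κ₀ m)
        (fun m _ => mul_nonneg (hβ m) hpos.le) (Finset.mem_univ j))
      have : 0 < β j * (1 / α i) := by positivity
      simp only [hκ₀, mul_add, mul_one_div_cancel hj.ne']
      linarith
  -- Only feasible points no worse than `κ₀` matter, and they lie in the cube `[0, K]^n`; this
  -- supplies compactness.
  let K := ∑ m, κ₀ m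
  let S : Set (Fin n → ℝ) := {κ | LPFeasible α β κ ∧ ∑ m, κ m ≤ K}
  have hScl : IsClosed S := by
    have e : S = ({κ | 1 ≤ ∑ m, α m * κ m} ∩ ({κ | 1 ≤ ∑ m, β m * κ m} ∩
        ⋂ m, {κ | 0 ≤ κ m})) ∩ {κ | ∑ m, κ m ≤ K} := by
      ext κ
      simp [S, LPFeasible]
    rw [e]
    refine ((isClosed_le continuous_const (by fun_prop)).inter
      ((isClosed_le continuous_const (by fun_prop)).inter
        (isClosed_iInter fun m => isClosed_le continuous_const (by fun_prop)))).inter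
      (isClosed_le (by fun_prop) continuous_const)
  have hSc : IsCompact S := by
    refine (isCompact_univ_pi fun _ : Fin n => isCompact_Icc (a := (0:ℝ)) (b := K)).of_isClosed_subset
      hScl ?_
    rintro κ ⟨⟨-, -, h3⟩, h4⟩ m -
    exact ⟨h3 m, (Finset.single_le_sum (fun m _ => h3 m) (Finset.mem_univ m)).trans h4⟩
  obtain ⟨κ, hκ, hmin⟩ := hSc.exists_isMinOn (f := fun κ => ∑ m, κ m) ⟨κ₀, h0, le_rfl⟩
    (by fun_prop)
  refine ⟨κ, hκ.1, fun κ' hκ' => ?_⟩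
  rcases le_total (∑ m, κ' m) K with h1 | h1
  · exact hmin ⟨hκ', h1⟩
  · exact hκ.2.trans h1

lemma LPSolution.sum_pos (h : LPSolution α β κ) : 0 < ∑ m, κ m := by
  refine (Finset.sum_nonneg fun m _ => h.1.2.2 m).lt_of_ne fun h0 => ?_
  have h1 := (Finset.sum_eq_zero_iff_of_nonneg fun m _ => h.1.2.2 m).1 h0.symm
  have h2 := h.1.1
  rw [Finset.sum_eq_zero fun m hm => by rw [h1 m hm, mul_zero]] at h2
  linarith

/-- Duality up to an arbitrarily small loss: a point `d` of the simplex with both products at least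
`c` would make `d / c` feasible with objective `1 / c`, below the optimum. -/
lemma LPSolution.exists_weight (h : LPSolution α β κ) {c : ℝ} (hc : 1 / ∑ m, κ m < c) :
    ∃ w : ℝ, 0 ≤ w ∧ w ≤ 1 ∧ ∀ m, w * α m + (1 - w) * β m < c := by
  have hV := h.sum_pos
  have hc0 : 0 < c := lt_trans (by positivity) hc
  refine exists_weight_of_forall_simplex α β c fun d hd hd1 => ?_
  by_contra! hcon
  have hf : LPFeasible α β (fun m => d m / c) := by
    refine ⟨?_, ?_, fun m => div_nonneg (hd m) hc0.le⟩
    · simp_rw [mul_div_assoc', ← Finset.sum_div]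
      exact (one_le_div hc0).2 hcon.1
    · simp_rw [mul_div_assoc', ← Finset.sum_div]
      exact (one_le_div hc0).2 hcon.2
  have h1 := h.2 _ hf
  rw [← Finset.sum_div, hd1] at h1
  rw [div_lt_iff₀ hV] at hc
  rw [le_div_iff₀ hc0] at h1
  linarith

/-! ### Consequences of uniqueness: complementary slackness with strict reduced costs -/

namespace LPUniqueSolution

lemma symm (h : LPUniqueSolution α β κ) : LPUniqueSolution β α κ := by
  have hf : ∀ κ', LPFeasible β α κ' ↔ LPFeasible α β κ' := fun κ' =>
    ⟨fun ⟨a, b, c⟩ => ⟨b, a, c⟩, fun ⟨a, b, c⟩ => ⟨b, a, c⟩⟩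
  have hs : ∀ κ', LPSolution β α κ' ↔ LPSolution α β κ' := fun κ' => by
    simp only [LPSolution, hf]
  exact ⟨(hs κ).2 h.1, fun κ' hκ' => h.2 κ' ((hs κ').1 hκ')⟩

/-- All use of uniqueness passes through this lemma. Inactive constraints survive a small step and
active ones survive by assumption, so `κ + t d` is feasible for small `t > 0`; if `∑ d ≤ 0`, it
would be a second solution. -/
lemma sum_pos_of_direction (h : LPUniqueSolution α β κ) {d : Fin n → ℝ} (hd : d ≠ 0)
    (h0 : ∀ m, κ m = 0 → 0 ≤ d m) (hα : ∑ m, α m * κ m = 1 → 0 ≤ ∑ m, α m * d m)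
    (hβ : ∑ m, β m * κ m = 1 → 0 ≤ ∑ m, β m * d m) : 0 < ∑ m, d m := by
  have hmain : ∀ a b : ℝ, 0 ≤ a → (a = 0 → 0 ≤ b) → ∀ᶠ t in 𝓝[>] (0:ℝ), 0 ≤ a + t * b := by
    intro a b ha hb
    rcases ha.eq_or_lt with rfl | ha
    · filter_upwards [self_mem_nhdsWithin] with t (ht : 0 < t)
      rw [zero_add]
      exact mul_nonneg ht.le (hb rfl)
    · have : Tendsto (fun t : ℝ => a + t * b) (𝓝[>] 0) (𝓝 (a + 0 * b)) := by
        apply Tendsto.mono_left _ nhdsWithin_le_nhds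
        exact (Continuous.tendsto (by fun_prop) 0)
      filter_upwards [this.eventually_const_lt (show 0 < a + 0 * b by simpa using ha)] with t ht
      exact ht.le
  obtain ⟨h1, h2, h3⟩ := h.1.1
  have e1 : ∀ᶠ t in 𝓝[>] (0:ℝ), ∀ m, 0 ≤ κ m + t * d m :=
    eventually_all.2 fun m => hmain _ _ (h3 m) (h0 m)
  have e2 := hmain (∑ m, α m * κ m - 1) (∑ m, α m * d m) (by linarith)
    fun hh => hα (by linarith)
  have e3 := hmain (∑ m, β m * κ m - 1) (∑ m, β m * d m) (by linarith)
    fun hh => hβ (by linarith)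
  obtain ⟨t, ⟨⟨⟨e1, e2⟩, e3⟩, ht⟩⟩ := (((e1.and e2).and e3).and self_mem_nhdsWithin).exists
  replace ht : 0 < t := ht
  by_contra hle
  push Not at hle
  have hs : ∀ γ : Fin n → ℝ, ∑ m, γ m * (κ m + t * d m) =
      ∑ m, γ m * κ m + t * ∑ m, γ m * d m := by
    intro γ
    rw [Finset.mul_sum, ← Finset.sum_add_distrib]
    exact Finset.sum_congr rfl fun m _ => by ring
  have hfe : LPFeasible α β (fun m => κ m + t * d m) := by
    refine ⟨?_, ?_, e1⟩
    · rw [hs]; linarith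
    · rw [hs]; linarith
  have hsum : ∑ m, (κ m + t * d m) ≤ ∑ m, κ m := by
    rw [Finset.sum_add_distrib, ← Finset.mul_sum]
    nlinarith
  have heq := h.2 _ ⟨hfe, fun κ' hκ' => hsum.trans (h.1.2 κ' hκ')⟩
  apply hd
  funext m
  have := congrFun heq m
  simp only [add_eq_left, mul_eq_zero, ht.ne', false_or] at this
  exact this

lemma add_pos_of_direction₂ (h : LPUniqueSolution α β κ) {i j : Fin n} (hij : i ≠ j)
    {a b : ℝ} (hab : a ≠ 0 ∨ b ≠ 0) (hi : κ i = 0 → 0 ≤ a) (hj : κ j = 0 → 0 ≤ b)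
    (hα : ∑ m, α m * κ m = 1 → 0 ≤ α i * a + α j * b)
    (hβ : ∑ m, β m * κ m = 1 → 0 ≤ β i * a + β j * b) : 0 < a + b := by
  have hs : ∀ γ : Fin n → ℝ, ∑ m, γ m * (Pi.single i a + Pi.single j b : Fin n → ℝ) m =
      γ i * a + γ j * b := by
    intro γ
    simp [mul_add, Finset.sum_add_distrib, Pi.single_apply]
  have := h.sum_pos_of_direction (d := Pi.single i a + Pi.single j b) ?_ ?_ ?_ ?_
  · simpa [Finset.sum_add_distrib] using this
  · intro h0
    have h1 := congrFun h0 i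
    have h2 := congrFun h0 j
    simp [hij, hij.symm] at h1 h2
    simp [h1, h2] at hab
  · intro m hm
    by_cases h1 : m = i
    · subst h1; simpa [hij] using hi hm
    by_cases h2 : m = j
    · subst h2; simpa [h1] using hj hm
    simp [h1, h2]
  · rw [hs]; exact hα
  · rw [hs]; exact hβ

lemma add_pos_of_direction₃ (h : LPUniqueSolution α β κ) {i j k : Fin n}
    (hik : i ≠ k) (hjk : j ≠ k) {a b c : ℝ} (hc0 : c ≠ 0) (hi : 0 < κ i) (hj : 0 < κ j)
    (hk : κ k = 0 → 0 ≤ c)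
    (hα : 0 ≤ α i * a + α j * b + α k * c) (hβ : 0 ≤ β i * a + β j * b + β k * c) :
    0 < a + b + c := by
  have hs : ∀ γ : Fin n → ℝ, ∑ m, γ m *
      (Pi.single i a + Pi.single j b + Pi.single k c : Fin n → ℝ) m =
      γ i * a + γ j * b + γ k * c := by
    intro γ
    simp [mul_add, Finset.sum_add_distrib, Pi.single_apply]
  have := h.sum_pos_of_direction (d := Pi.single i a + Pi.single j b + Pi.single k c) ?_ ?_ ?_ ?_
  · simpa [Finset.sum_add_distrib] using this
  · intro h0
    have h1 := congrFun h0 k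
    simp [hik.symm, hjk.symm] at h1
    exact hc0 h1
  · intro m hm
    have h1 : m ≠ i := fun e => by rw [e] at hm; linarith
    have h2 : m ≠ j := fun e => by rw [e] at hm; linarith
    by_cases h3 : m = k
    · subst h3; simpa [h1, h2] using hk hm
    simp [h1, h2, h3]
  · rw [hs]; exact fun _ => hα
  · rw [hs]; exact fun _ => hβ

lemma det_ne_zero (h : LPUniqueSolution α β κ) {i j : Fin n} (hij : i ≠ j)
    (hi : 0 < κ i) (hj : 0 < κ j) : α i * β j - α j * β i ≠ 0 := by
  intro hdet
  have key : ∀ a b : ℝ, α i * a + α j * b = 0 → β i * a + β j * b = 0 → a = 0 ∧ b = 0 := by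
    intro a b h1 h2
    by_contra hab
    have hab' : a ≠ 0 ∨ b ≠ 0 := by tauto
    have p1 := h.add_pos_of_direction₂ hij hab' (by intro; linarith) (by intro; linarith)
      (by intro; linarith) (by intro; linarith)
    have p2 := h.add_pos_of_direction₂ hij (a := -a) (b := -b) (by simpa using hab')
      (by intro; linarith) (by intro; linarith) (by intro; linarith) (by intro; linarith)
    linarith
  -- For a singular matrix both of these vectors lie in the kernel. Triviality of the kernel then
  -- forces all four entries to vanish, which puts `(1, 0)` in the kernel as well.
  have k1 := key (α j) (-α i) (by ring) (by linarith)
  have k2 := key (β j) (-β i) (by linarith) (by ring)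
  have := key 1 0 (by linarith) (by linarith)
  exact one_ne_zero this.1

/-- By Cramer's rule column `m` is a combination of columns `i` and `j`. Trading one against the
other changes neither constraint, and with three positive components it can be done in both
directions, so the objective would have to increase both ways. -/
lemma eq_zero_of_ne (h : LPUniqueSolution α β κ) {i j m : Fin n} (hij : i ≠ j)
    (hi : 0 < κ i) (hj : 0 < κ j) (hmi : m ≠ i) (hmj : m ≠ j) : κ m = 0 := by
  by_contra hm
  have hm' : 0 < κ m := lt_of_le_of_ne (h.1.1.2.2 m) (Ne.symm hm)
  have hdet := h.det_ne_zero hij hi hj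
  have ea : α i * ((α m * β j - α j * β m) / (α i * β j - α j * β i)) +
      α j * ((α i * β m - α m * β i) / (α i * β j - α j * β i)) = α m := by
    field_simp; ring
  have eb : β i * ((α m * β j - α j * β m) / (α i * β j - α j * β i)) +
      β j * ((α i * β m - α m * β i) / (α i * β j - α j * β i)) = β m := by
    rw [mul_div_assoc', mul_div_assoc', ← add_div, div_eq_iff hdet]; ring
  have p1 := h.add_pos_of_direction₃ hmi.symm hmj.symm (c := -1) (by norm_num) hi hj
    (by intro; linarith) (a := (α m * β j - α j * β m) / (α i * β j - α j * β i))
    (b := (α i * β m - α m * β i) / (α i * β j - α j * β i)) (by linarith) (by linarith)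
  have p2 := h.add_pos_of_direction₃ hmi.symm hmj.symm (c := 1) (by norm_num) hi hj
    (by intro; linarith) (a := -((α m * β j - α j * β m) / (α i * β j - α j * β i)))
    (b := -((α i * β m - α m * β i) / (α i * β j - α j * β i))) (by linarith) (by linarith)
  linarith

lemma card_pos_le_two (h : LPUniqueSolution α β κ) :
    (Finset.univ.filter fun i => 0 < κ i).card ≤ 2 := by
  by_contra hcard
  push Not at hcard
  obtain ⟨i, j, m, hi, hj, hm, hij, him, hjm⟩ := Finset.two_lt_card_iff.1 hcard
  simp only [Finset.mem_filter, Finset.mem_univ, true_and] at hi hj hm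
  exact hm.ne' (h.eq_zero_of_ne hij hi hj him.symm hjm.symm)

lemma sum_mul_eq_add (h : LPUniqueSolution α β κ) {i j : Fin n} (hij : i ≠ j)
    (hi : 0 < κ i) (hj : 0 < κ j) (γ : Fin n → ℝ) :
    ∑ m, γ m * κ m = γ i * κ i + γ j * κ j := by
  rw [← Finset.sum_subset (Finset.subset_univ {i, j}), Finset.sum_pair hij]
  intro m _ hm
  simp only [Finset.mem_insert, Finset.mem_singleton, not_or] at hm
  rw [h.eq_zero_of_ne hij hi hj hm.1 hm.2, mul_zero]

/-- If the `α`-constraint were slack, `±(β j, -β i)` would both be admissible, since they preserve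
the `β`-constraint. -/
lemma tight_left (h : LPUniqueSolution α β κ) {i j : Fin n} (hij : i ≠ j)
    (hi : 0 < κ i) (hj : 0 < κ j) : α i * κ i + α j * κ j = 1 := by
  by_contra hne
  rw [← h.sum_mul_eq_add hij hi hj] at hne
  have hdet := h.det_ne_zero hij hi hj
  have hab : β j ≠ 0 ∨ -β i ≠ 0 := by
    by_contra! hcon
    apply hdet
    rw [hcon.1, neg_eq_zero.1 hcon.2]; ring
  have p1 := h.add_pos_of_direction₂ hij hab (by intro; linarith) (by intro; linarith)
    (fun e => absurd e hne) (by intro; linarith)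
  have p2 := h.add_pos_of_direction₂ hij (a := -β j) (b := β i) (by simpa using hab)
    (by intro; linarith) (by intro; linarith) (fun e => absurd e hne) (by intro; linarith)
  linarith

lemma tight_right (h : LPUniqueSolution α β κ) {i j : Fin n} (hij : i ≠ j)
    (hi : 0 < κ i) (hj : 0 < κ j) : β i * κ i + β j * κ j = 1 :=
  h.symm.tight_left hij hi hj

/-- The quotient is the shadow price of the `α`-constraint: the change of the objective along the
direction in components `i`, `j` that raises this constraint at unit rate and leaves the other one
fixed. -/
lemma multiplier_left_pos (h : LPUniqueSolution α β κ) {i j : Fin n} (hij : i ≠ j)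
    (hi : 0 < κ i) (hj : 0 < κ j) : 0 < (β j - β i) / (α i * β j - α j * β i) := by
  have hdet := h.det_ne_zero hij hi hj
  have ea : α i * (β j / (α i * β j - α j * β i)) + α j * (-β i / (α i * β j - α j * β i)) = 1 := by
    field_simp; ring
  have eb : β i * (β j / (α i * β j - α j * β i)) + β j * (-β i / (α i * β j - α j * β i)) = 0 := by
    field_simp; ring
  have hab : β j / (α i * β j - α j * β i) ≠ 0 ∨ -β i / (α i * β j - α j * β i) ≠ 0 := by
    by_contra! hcon
    rw [hcon.1, hcon.2] at ea
    simp at ea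
  have := h.add_pos_of_direction₂ hij hab (by intro; linarith) (by intro; linarith)
    (by intro; linarith) (by intro; linarith)
  rwa [← add_div, ← sub_eq_add_neg] at this

lemma multiplier_right_pos (h : LPUniqueSolution α β κ) {i j : Fin n} (hij : i ≠ j)
    (hi : 0 < κ i) (hj : 0 < κ j) : 0 < (α i - α j) / (α i * β j - α j * β i) := by
  have := h.symm.multiplier_left_pos hij hi hj
  rw [← neg_div_neg_eq] at this
  convert this using 2 <;> ring

/-- The reduced cost of `m` is positive: increasing `κ m` while compensating in `i` and `j` must
raise the objective. The left side is the exponent of `X m` in the limiting expectation, so this is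
what makes that expectation finite. -/
lemma multiplier_lt_one (h : LPUniqueSolution α β κ) {i j m : Fin n} (hij : i ≠ j)
    (hi : 0 < κ i) (hj : 0 < κ j) (hmi : m ≠ i) (hmj : m ≠ j) :
    (β j - β i) / (α i * β j - α j * β i) * α m +
      (α i - α j) / (α i * β j - α j * β i) * β m < 1 := by
  have hdet := h.det_ne_zero hij hi hj
  have ea : α i * ((α m * β j - α j * β m) / (α i * β j - α j * β i)) +
      α j * ((α i * β m - α m * β i) / (α i * β j - α j * β i)) = α m := by
    field_simp; ring
  have eb : β i * ((α m * β j - α j * β m) / (α i * β j - α j * β i)) +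
      β j * ((α i * β m - α m * β i) / (α i * β j - α j * β i)) = β m := by
    rw [mul_div_assoc', mul_div_assoc', ← add_div, div_eq_iff hdet]; ring
  have p2 := h.add_pos_of_direction₃ hmi.symm hmj.symm (c := 1) (by norm_num) hi hj
    (by intro; linarith) (a := -((α m * β j - α j * β m) / (α i * β j - α j * β i)))
    (b := -((α i * β m - α m * β i) / (α i * β j - α j * β i))) (by linarith) (by linarith)
  have e : (β j - β i) / (α i * β j - α j * β i) * α m +
      (α i - α j) / (α i * β j - α j * β i) * β m =
      (α m * β j - α j * β m) / (α i * β j - α j * β i) +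
      (α i * β m - α m * β i) / (α i * β j - α j * β i) := by
    field_simp; ring
  linarith

lemma sum_mul_eq_single {i : Fin n} (h0 : ∀ j, j ≠ i → κ j = 0)
    (γ : Fin n → ℝ) : ∑ m, γ m * κ m = γ i * κ i :=
  Fintype.sum_eq_single i fun j hj => by rw [h0 j hj, mul_zero]

/-- Complementary slackness for a unique solution with a single positive component. -/
lemma exists_weight_single (h : LPUniqueSolution α β κ) {i : Fin n} (hi : 0 < κ i)
    (h0 : ∀ j, j ≠ i → κ j = 0) :
    1 / κ i ≤ α i ∧ 1 / κ i ≤ β i ∧ ∃ w : ℝ, 0 ≤ w ∧ w ≤ 1 ∧ w * α i + (1 - w) * β i = 1 / κ i ∧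
      (α i < β i → w = 1) ∧ (β i < α i → w = 0) ∧
      ∀ m, m ≠ i → w * α m + (1 - w) * β m < 1 / κ i := by
  obtain ⟨h1, h2, -⟩ := h.1.1
  have sα := sum_mul_eq_single h0 α
  have sβ := sum_mul_eq_single h0 β
  rw [sα] at h1
  rw [sβ] at h2
  have hα1 : 1 / κ i ≤ α i := (div_le_iff₀ hi).2 h1
  have hβ1 : 1 / κ i ≤ β i := (div_le_iff₀ hi).2 h2
  have hinv : 0 < 1 / κ i := by positivity
  have dir : ∀ d : Fin n → ℝ, (∀ m, m ≠ i → 0 ≤ d m) → d i < 0 →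
      (α i * κ i = 1 → 0 ≤ ∑ m, α m * d m) →
      (β i * κ i = 1 → 0 ≤ ∑ m, β m * d m) → 0 < ∑ m, d m := by
    intro d hd hdi ha hb
    refine h.sum_pos_of_direction (fun e => by simp [e] at hdi) (fun m hm => hd m fun e => ?_)
      (by rwa [sα]) (by rwa [sβ])
    rw [e] at hm
    linarith
  -- Otherwise `κ i` alone could be decreased.
  have htight : α i * κ i = 1 ∨ β i * κ i = 1 := by
    by_contra! hcon
    have := dir (Pi.single i (-1)) (fun m hm => by simp [hm]) (by simp)
      (fun e => absurd e hcon.1) (fun e => absurd e hcon.2)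
    norm_num at this
  -- When only the `b`-constraint is active, moving mass from `i` to `m` costs nothing, so it must
  -- violate that constraint. Stated for general `a`, `b` to cover both unbalanced cases.
  have strict : ∀ a b : Fin n → ℝ, (∀ m, m ≠ i → 0 < b i → b i * κ i = 1 → a i * κ i ≠ 1 →
      (∀ d : Fin n → ℝ, (∀ m, m ≠ i → 0 ≤ d m) → d i < 0 →
      (a i * κ i = 1 → 0 ≤ ∑ m, a m * d m) →
      (b i * κ i = 1 → 0 ≤ ∑ m, b m * d m) → 0 < ∑ m, d m) → b m < b i) := by
    intro a b m hm hb hb1 ha hdir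
    by_contra! hcon
    have := hdir (Pi.single m 1 + Pi.single i (-1)) (fun k hk => by
        by_cases hkm : k = m
        · subst hkm; simp [hk]
        · simp [hk, hkm]) (by simp [hm.symm]) (fun e => absurd e ha) (fun _ => by
        simp [mul_add, Finset.sum_add_distrib, Pi.single_apply]; linarith)
    simp [Finset.sum_add_distrib] at this
  rcases lt_trichotomy (α i) (β i) with hlt | heq | hgt
  · have hb : β i * κ i ≠ 1 := by
      have := mul_lt_mul_of_pos_right hlt hi
      linarith
    have ha : α i * κ i = 1 := htight.resolve_right hb
    have ha' : α i = 1 / κ i := eq_div_of_mul_eq hi.ne' ha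
    refine ⟨hα1, hβ1, 1, zero_le_one, le_rfl, by linarith, fun _ => rfl,
      fun hh => absurd hh hlt.not_gt, fun m hm => ?_⟩
    have := strict β α m hm (by linarith) ha hb fun d h1 h2 h3 h4 => dir d h1 h2 h4 h3
    linarith
  · have ha : α i * κ i = 1 := by
      rcases htight with h | h
      · exact h
      · rw [heq]; exact h
    have ha' : α i = 1 / κ i := eq_div_of_mul_eq hi.ne' ha
    obtain ⟨w, hw0, hw1, hw⟩ := exists_weight_of_forall_simplex
      (fun m : {m // m ≠ i} => α m) (fun m : {m // m ≠ i} => β m) (1 / κ i) (by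
        intro d hd hd1
        by_contra! hcon
        -- In the balanced case both constraints are active and the dual weight is not determined by
        -- component `i`. A probability vector on the other indices, with `-1` at `i`, has total
        -- zero, so it cannot preserve both constraints; this is the hypothesis of the separation
        -- lemma.
        let D : Fin n → ℝ := fun m => if hm : m ≠ i then d ⟨m, hm⟩ else -1
        have hD : ∀ γ : Fin n → ℝ, ∑ m, γ m * D m =
            ∑ m : {m // m ≠ i}, γ m * d m - γ i := by
          intro γ
          rw [← Finset.add_sum_erase _ _ (Finset.mem_univ i),
            Finset.sum_subtype (p := fun m => m ≠ i) (Finset.univ.erase i) (by simp)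
              (fun m => γ m * D m)]
          have e2 : ∑ m : {m // m ≠ i}, γ m * D m = ∑ m : {m // m ≠ i}, γ m * d m :=
            Finset.sum_congr rfl fun m _ => by simp [D, m.2]
          rw [e2]
          simp [D]
          ring
        have := dir D (fun m hm => by simp [D, hm, hd]) (by simp [D])
          (fun _ => by rw [hD]; linarith [hcon.1]) (fun _ => by rw [hD]; linarith [hcon.2])
        have h1 := hD fun _ => 1
        simp only [one_mul] at h1
        rw [h1, hd1] at this
        linarith)
    refine ⟨hα1, hβ1, w, hw0, hw1, by rw [← heq, ← ha']; ring, fun hh => absurd hh heq.not_lt,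
      fun hh => absurd hh heq.symm.not_lt, fun m hm => hw ⟨m, hm⟩⟩
  · have ha : α i * κ i ≠ 1 := by
      have := mul_lt_mul_of_pos_right hgt hi
      linarith
    have hb : β i * κ i = 1 := htight.resolve_left ha
    have hb' : β i = 1 / κ i := eq_div_of_mul_eq hi.ne' hb
    refine ⟨hα1, hβ1, 0, le_rfl, zero_le_one, by linarith,
      fun hh => absurd hh hgt.not_gt, fun _ => rfl, fun m hm => ?_⟩
    have := strict α β m hm (by linarith) hb ha dir
    linarith

end LPUniqueSolution

end

/-! ### Asymptotics of a half cone for two independent regularly varying variables -/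

noncomputable section

lemma ProbabilityTheory.IndepFun.measureReal_setOf_and {Ω : Type*} [MeasurableSpace Ω]
    {P : Measure Ω} {U V : Ω → ℝ} (h : IndepFun U V P)
    {A B : Set ℝ} (hA : MeasurableSet A) (hB : MeasurableSet B) :
    P.real {ω | U ω ∈ A ∧ V ω ∈ B} = P.real {ω | U ω ∈ A} * P.real {ω | V ω ∈ B} := by
  simp only [measureReal_def, ← ENNReal.toReal_mul]
  congr 1
  exact h.measure_inter_preimage_eq_mul A B hA hB

section HalfCone

variable {Ω : Type*} [MeasurableSpace Ω] {P : Measure Ω} [IsProbabilityMeasure P]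
variable {U V : Ω → ℝ} {F G : ℝ → ℝ} {ρ τ : ℝ}

/-- The slices are geometrically small uniformly in the scales: Potter's bound gives `τ ^ (-1 + δ)`
per slice for `G` and a growth of `τ ^ (ρ * (1 + δ))` for `F`, and the product is below `1` because
`2 * δ < 1 - ρ`. -/
lemma rv_slice_le (hF : RVTail F) (hG : RVTail G) (hρ0 : 0 ≤ ρ) (hρ : ρ < 1) (hτ : 1 < τ)
    {δ : ℝ} (hδ : 0 < δ) (hδρ : 2 * δ < 1 - ρ) :
    ∃ M q y₀ : ℝ, 0 < M ∧ 0 < q ∧ q < 1 ∧ 1 ≤ y₀ ∧ ∀ y z u v : ℝ, y₀ ≤ y → y₀ ≤ z →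
      0 < u → 0 < v → ∀ k : ℕ,
      G (z * v * τ ^ k) * F (y * u * (τ ^ (-ρ)) ^ (k + 1)) ≤
        M * q ^ k * (potterEnv δ u * potterEnv δ v * (F y * G z)) := by
  have hτ0 : 0 < τ := by linarith
  obtain ⟨C₁, y₁, hC₁, hy₁, H₁⟩ := hF.potter hδ (by linarith)
  obtain ⟨C₂, y₂, hC₂, hy₂, H₂⟩ := hG.potter hδ (by linarith)
  have hσ0 : 0 < τ ^ (-ρ) := by positivity
  have hσ1 : τ ^ (-ρ) ≤ 1 := Real.rpow_le_one_of_one_le_of_nonpos hτ.le (by linarith)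
  set a := τ ^ (-1 + δ) with ha
  set b := (τ ^ (-ρ)) ^ (-1 - δ) with hb
  have ha0 : 0 < a := by positivity
  have hb0 : 0 < b := by positivity
  have hab : a * b < 1 := by
    rw [ha, hb, ← Real.rpow_mul hτ0.le, ← Real.rpow_add hτ0]
    exact Real.rpow_lt_one_of_one_lt_of_neg hτ (by nlinarith)
  refine ⟨C₂ * C₁ * 4 * b, a * b, max y₁ y₂, by positivity, by positivity, hab,
    hy₁.trans (le_max_left _ _), fun y z u v hy hz hu hv k => ?_⟩
  have e1 : potterEnv δ (τ ^ k) ≤ 2 * a ^ k := by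
    refine (potterEnv_le_of_one_le hδ (one_le_pow₀ hτ.le)).trans_eq ?_
    rw [ha, Real.rpow_pow_comm hτ0.le]
  have e2 : potterEnv δ ((τ ^ (-ρ)) ^ (k + 1)) ≤ 2 * b ^ (k + 1) := by
    refine (potterEnv_le_of_le_one hδ (by positivity) (pow_le_one₀ hσ0.le hσ1)).trans_eq ?_
    rw [hb, Real.rpow_pow_comm hσ0.le]
  have hFy := hF.pos y
  have hGz := hG.pos z
  have pu := potterEnv_pos (δ := δ) hu
  have pv := potterEnv_pos (δ := δ) hv
  have g1 : G (z * v * τ ^ k) ≤ C₂ * (potterEnv δ v * (2 * a ^ k)) * G z := by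
    rw [mul_assoc]
    refine (H₂ z ((le_max_right _ _).trans hz) (v * τ ^ k) (by positivity)).trans ?_
    gcongr
    exact (potterEnv_mul_le hv (by positivity)).trans (by gcongr)
  have g2 : F (y * u * (τ ^ (-ρ)) ^ (k + 1)) ≤ C₁ * (potterEnv δ u * (2 * b ^ (k + 1))) * F y := by
    rw [mul_assoc]
    refine (H₁ y ((le_max_left _ _).trans hy) (u * (τ ^ (-ρ)) ^ (k + 1)) (by positivity)).trans ?_
    gcongr
    exact (potterEnv_mul_le hu (by positivity)).trans (by gcongr)
  refine (mul_le_mul g1 g2 (hF.pos _).le (by positivity)).trans_eq ?_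
  rw [mul_pow]
  ring

lemma hasSum_half_cone (hU : Measurable U) (hV : Measurable V) (hτ : 1 < τ) {z : ℝ}
    (hz : 0 < z) (g : ℝ → ℝ) (hg : Measurable g) :
    HasSum (fun k : ℕ => P.real {ω | (z * τ ^ k < V ω ∧ V ω ≤ z * τ ^ (k + 1)) ∧ g (V ω) < U ω})
      (P.real {ω | z < V ω ∧ g (V ω) < U ω}) := by
  have hτ0 : 0 < τ := by linarith
  have hset : {ω | z < V ω ∧ g (V ω) < U ω} =
      ⋃ k : ℕ, {ω | (z * τ ^ k < V ω ∧ V ω ≤ z * τ ^ (k + 1)) ∧ g (V ω) < U ω} := by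
    ext ω
    simp only [Set.mem_ofPred_eq, Set.mem_iUnion]
    constructor
    · rintro ⟨h1, h2⟩
      obtain ⟨k, hk⟩ := pow_unbounded_of_one_lt (V ω / z) hτ
      have hex : ∃ k : ℕ, V ω ≤ z * τ ^ k := ⟨k, by rw [div_lt_iff₀ hz] at hk; linarith⟩
      classical
      have hn := Nat.find_spec hex
      have hn0 : Nat.find hex ≠ 0 := by
        intro h0
        rw [h0] at hn
        simp at hn
        linarith
      obtain ⟨m, hm⟩ := Nat.exists_eq_succ_of_ne_zero hn0
      refine ⟨m, ⟨?_, by rw [hm] at hn; exact hn⟩, h2⟩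
      have := Nat.find_min hex (m := m) (by omega)
      push Not at this
      exact this
    · rintro ⟨k, ⟨h1, -⟩, h2⟩
      exact ⟨lt_of_le_of_lt (le_mul_of_one_le_right hz.le (one_le_pow₀ hτ.le)) h1, h2⟩
  have hmeas : ∀ k : ℕ, MeasurableSet
      {ω | (z * τ ^ k < V ω ∧ V ω ≤ z * τ ^ (k + 1)) ∧ g (V ω) < U ω} := fun k =>
    ((measurableSet_lt measurable_const hV).inter (measurableSet_le hV measurable_const)).inter
      (measurableSet_lt (hg.comp hV) hU)
  have hdisj : Pairwise (Function.onFun Disjoint fun k : ℕ =>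
      {ω | (z * τ ^ k < V ω ∧ V ω ≤ z * τ ^ (k + 1)) ∧ g (V ω) < U ω}) := by
    have key : ∀ k l : ℕ, k < l → Disjoint
        {ω | (z * τ ^ k < V ω ∧ V ω ≤ z * τ ^ (k + 1)) ∧ g (V ω) < U ω}
        {ω | (z * τ ^ l < V ω ∧ V ω ≤ z * τ ^ (l + 1)) ∧ g (V ω) < U ω} := by
      intro k l hkl
      rw [Set.disjoint_left]
      rintro ω ⟨⟨-, h1⟩, -⟩ ⟨⟨h2, -⟩, -⟩
      have := mul_le_mul_of_nonneg_left (pow_le_pow_right₀ hτ.le (Nat.succ_le_of_lt hkl)) hz.le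
      simp only [Nat.succ_eq_add_one] at this
      linarith
    intro k l hkl
    rcases hkl.lt_or_gt with h | h
    · exact key k l h
    · exact (key l k h).symm
  have h1 := measure_iUnion (μ := P) hdisj hmeas
  rw [hset]
  simp only [measureReal_def]
  rw [h1, ENNReal.tsum_toReal_eq fun k => measure_ne_top _ _]
  exact ENNReal.hasSum_toReal (by rw [← h1]; exact measure_ne_top _ _)

/-- The threshold for `U` is nonincreasing in `V`, so on a slice it lies between its values at the
two endpoints; with a constant threshold, independence factors the probability. -/
lemma half_cone_slice_bounds (hV : Measurable V) (hUV : IndepFun U V P)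
    (hFU : ∀ x, P.real {ω | x < U ω} = F x) (hGV : ∀ x, P.real {ω | x < V ω} = G x)
    (hρ0 : 0 ≤ ρ) (hτ : 1 < τ) {y z : ℝ} (hy : 0 < y) (hz : 0 < z) (k : ℕ) :
    (G (z * τ ^ k) - G (z * τ ^ (k + 1))) * F (y * (τ ^ (-ρ)) ^ k) ≤
      P.real {ω | (z * τ ^ k < V ω ∧ V ω ≤ z * τ ^ (k + 1)) ∧ y * (V ω / z) ^ (-ρ) < U ω} ∧
    P.real {ω | (z * τ ^ k < V ω ∧ V ω ≤ z * τ ^ (k + 1)) ∧ y * (V ω / z) ^ (-ρ) < U ω} ≤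
      (G (z * τ ^ k) - G (z * τ ^ (k + 1))) * F (y * (τ ^ (-ρ)) ^ (k + 1)) := by
  have hτ0 : 0 < τ := by linarith
  have hslice : ∀ c, P.real {ω | (z * τ ^ k < V ω ∧ V ω ≤ z * τ ^ (k + 1)) ∧ c < U ω} =
      (G (z * τ ^ k) - G (z * τ ^ (k + 1))) * F c := by
    intro c
    have h1 := hUV.symm.measureReal_setOf_and
      (measurableSet_Ioc (a := z * τ ^ k) (b := z * τ ^ (k + 1))) (measurableSet_Ioi (a := c))
    simp only [Set.mem_Ioc, Set.mem_Ioi] at h1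
    rw [h1, hFU, ← hGV, ← hGV, ← measureReal_sdiff]
    · congr 2
      ext ω
      simp
    · intro ω (h : z * τ ^ (k + 1) < V ω)
      refine lt_of_le_of_lt ?_ h
      gcongr
      · exact hτ.le
      · omega
    · exact measurableSet_lt measurable_const hV
  constructor
  · rw [← hslice]
    refine measureReal_mono fun ω => ?_
    rintro ⟨⟨h1, h2⟩, h3⟩
    refine ⟨⟨h1, h2⟩, lt_of_le_of_lt ?_ h3⟩
    rw [Real.rpow_pow_comm hτ0.le]
    gcongr y * ?_
    refine Real.rpow_le_rpow_of_nonpos (by positivity) ?_ (by linarith)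
    rw [le_div_iff₀ hz]
    linarith
  · rw [← hslice]
    refine measureReal_mono fun ω => ?_
    rintro ⟨⟨h1, h2⟩, h3⟩
    refine ⟨⟨h1, h2⟩, lt_of_le_of_lt ?_ h3⟩
    rw [Real.rpow_pow_comm hτ0.le]
    gcongr y * ?_
    have hV0 : 0 < V ω := lt_trans (by positivity) h1
    refine Real.rpow_le_rpow_of_nonpos (by positivity) ?_ (by linarith)
    rw [div_le_iff₀ hz]
    linarith

lemma half_cone_le (hU : Measurable U) (hV : Measurable V) (hUV : IndepFun U V P)
    (hFU : ∀ x, P.real {ω | x < U ω} = F x) (hGV : ∀ x, P.real {ω | x < V ω} = G x)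
    (hF : RVTail F) (hG : RVTail G) (hρ0 : 0 ≤ ρ) (hρ : ρ < 1)
    {δ : ℝ} (hδ : 0 < δ) (hδρ : 2 * δ < 1 - ρ) :
    ∃ C y₀ : ℝ, 0 < C ∧ 1 ≤ y₀ ∧ ∀ y z u v : ℝ, y₀ ≤ y → y₀ ≤ z → 0 < u → 0 < v →
      P.real {ω | z * v < V ω ∧ y * u * (V ω / (z * v)) ^ (-ρ) < U ω} ≤
        C * (potterEnv δ u * potterEnv δ v) * (F y * G z) := by
  obtain ⟨M, q, y₀, hM, hq0, hq1, hy₀, H⟩ := rv_slice_le hF hG hρ0 hρ one_lt_two hδ hδρ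
  refine ⟨M * (1 - q)⁻¹, y₀, ?_, hy₀, fun y z u v hy hz hu hv => ?_⟩
  · have : 0 < 1 - q := by linarith
    positivity
  have hz0 : 0 < z * v := mul_pos (by linarith) hv
  have hy0 : 0 < y * u := mul_pos (by linarith) hu
  have h1 := hasSum_half_cone (P := P) hU hV one_lt_two hz0
    (fun t => y * u * (t / (z * v)) ^ (-ρ)) (by fun_prop)
  have h2 : HasSum (fun k : ℕ => M * q ^ k * (potterEnv δ u * potterEnv δ v * (F y * G z)))
      (M * (1 - q)⁻¹ * (potterEnv δ u * potterEnv δ v * (F y * G z))) :=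
    ((hasSum_geometric_of_lt_one hq0.le hq1).mul_left M).mul_right _
  rw [mul_assoc]
  refine hasSum_le (fun k => ?_) h1 h2
  refine ((half_cone_slice_bounds hV hUV hFU hGV hρ0 one_lt_two hy0 hz0 k).2).trans ?_
  refine le_trans ?_ (H y z u v hy hz hu hv k)
  gcongr
  · exact (hF.pos _).le
  · linarith [hG.pos (z * v * 2 ^ (k + 1))]

/-- A quotient of difference quotients at `1`, of `τ⁻¹` (derivative `-1`) and of `τ ^ (ρ - 1)`
(derivative `ρ - 1`). -/
lemma riemann_quotient_tendsto (hρ : ρ < 1) :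
    Tendsto (fun τ : ℝ => (1 - τ⁻¹) / (1 - τ ^ (ρ - 1))) (𝓝[>] 1) (𝓝 (1 / (1 - ρ))) := by
  have h1 : HasDerivAt (fun τ : ℝ => τ⁻¹) (-1) 1 := by
    simpa using hasDerivAt_inv (one_ne_zero (α := ℝ))
  have h2 : HasDerivAt (fun τ : ℝ => τ ^ (ρ - 1)) (ρ - 1) 1 := by
    simpa using Real.hasDerivAt_rpow_const (x := 1) (p := ρ - 1) (Or.inl one_ne_zero)
  have h3 := (h1.tendsto_slope.div h2.tendsto_slope (by linarith)).mono_left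
    (nhdsWithin_mono 1 (fun x (hx : 1 < x) => hx.ne') : 𝓝[>] (1:ℝ) ≤ 𝓝[≠] 1)
  have e : (-1 : ℝ) / (ρ - 1) = 1 / (1 - ρ) := by
    rw [← neg_div_neg_eq]; ring_nf
  rw [e] at h3
  refine h3.congr' ?_
  filter_upwards [self_mem_nhdsWithin] with τ (hτ : 1 < τ)
  have hτ1 : τ - 1 ≠ 0 := by linarith
  simp only [Pi.div_apply, slope_def_field, Real.one_rpow, inv_one]
  rw [div_div_div_cancel_right₀ hτ1, ← neg_div_neg_eq]
  simp

/-- The limit is `∫₁^∞ t ^ ρ * t ^ (-2) dt`, obtained from Riemann sums on the geometric grid `τ ^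
k`. For fixed `τ` the slice bound justifies the termwise limit; then `τ ↓ 1` closes the gap between
lower and upper sums. -/
lemma half_cone_tendsto (hU : Measurable U) (hV : Measurable V) (hUV : IndepFun U V P)
    (hFU : ∀ x, P.real {ω | x < U ω} = F x) (hGV : ∀ x, P.real {ω | x < V ω} = G x)
    (hF : RVTail F) (hG : RVTail G) (hρ0 : 0 ≤ ρ) (hρ : ρ < 1)
    {ι : Type*} {l : Filter ι} {y z : ι → ℝ} (hy : Tendsto y l atTop) (hz : Tendsto z l atTop) :
    Tendsto (fun x => P.real {ω | z x < V ω ∧ y x * (V ω / z x) ^ (-ρ) < U ω} /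
      (F (y x) * G (z x))) l (𝓝 (1 / (1 - ρ))) := by
  set δ := (1 - ρ) / 4 with hδdef
  have hδ : 0 < δ := by linarith
  have hδρ : 2 * δ < 1 - ρ := by linarith
  have hpos : ∀ x, 0 < F (y x) * G (z x) := fun x => mul_pos (hF.pos _) (hG.pos _)
  -- Riemann sums with slice ratio `τ`; `e = 0` gives the lower and `e = 1` the upper sums
  have main : ∀ τ : ℝ, 1 < τ → ∀ e : ℕ, e ≤ 1 →
      Tendsto (fun x => ∑' k : ℕ, (G (z x * τ ^ k) - G (z x * τ ^ (k + 1))) *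
        F (y x * (τ ^ (-ρ)) ^ (k + e)) / (F (y x) * G (z x))) l
        (𝓝 ((1 - τ⁻¹) / (1 - τ ^ (ρ - 1)) * (τ ^ ρ) ^ e)) ∧
      ∀ᶠ x in l, Summable (fun k : ℕ => (G (z x * τ ^ k) - G (z x * τ ^ (k + 1))) *
        F (y x * (τ ^ (-ρ)) ^ (k + e)) / (F (y x) * G (z x))) := by
    intro τ hτ e he
    have hτ0 : 0 < τ := by linarith
    obtain ⟨M, q, y₀, hM, hq0, hq1, hy₀, H⟩ := rv_slice_le hF hG hρ0 hρ hτ hδ hδρ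
    have hσ0 : 0 < τ ^ (-ρ) := by positivity
    have hσ1 : τ ^ (-ρ) ≤ 1 := Real.rpow_le_one_of_one_le_of_nonpos hτ.le (by linarith)
    have hsum : Summable fun k : ℕ => M * q ^ k * (potterEnv δ 1 * potterEnv δ 1) :=
      ((summable_geometric_of_lt_one hq0.le hq1).mul_left M).mul_right _
    have hbd : ∀ᶠ x in l, ∀ k : ℕ, ‖(G (z x * τ ^ k) - G (z x * τ ^ (k + 1))) *
        F (y x * (τ ^ (-ρ)) ^ (k + e)) / (F (y x) * G (z x))‖ ≤
        M * q ^ k * (potterEnv δ 1 * potterEnv δ 1) := by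
      filter_upwards [hy.eventually_ge_atTop y₀, hz.eventually_ge_atTop y₀] with x h1 h2 k
      have hG1 : 0 ≤ G (z x * τ ^ k) - G (z x * τ ^ (k + 1)) := by
        refine sub_nonneg.2 (hG.anti ?_)
        gcongr
        · linarith
        · exact hτ.le
        · omega
      rw [Real.norm_of_nonneg (div_nonneg (mul_nonneg hG1 (hF.pos _).le) (hpos x).le),
        div_le_iff₀ (hpos x)]
      have h3 := H (y x) (z x) 1 1 h1 h2 one_pos one_pos k
      rw [mul_one, mul_one, ← mul_assoc] at h3
      refine le_trans ?_ h3
      refine mul_le_mul (by linarith [hG.pos (z x * τ ^ (k + 1))]) (hF.anti ?_) (hF.pos _).le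
        (hG.pos _).le
      have hyx : 0 ≤ y x := by linarith
      refine mul_le_mul_of_nonneg_left ?_ hyx
      exact pow_le_pow_of_le_one hσ0.le hσ1 (by omega)
    constructor
    · have hs : HasSum (fun k : ℕ => ((τ ^ k)⁻¹ - (τ ^ (k + 1))⁻¹) * ((τ ^ (-ρ)) ^ (k + e))⁻¹)
          ((1 - τ⁻¹) / (1 - τ ^ (ρ - 1)) * (τ ^ ρ) ^ e) := by
        have hr1 : τ ^ (ρ - 1) < 1 := Real.rpow_lt_one_of_one_lt_of_neg hτ (by linarith)
        have h := ((hasSum_geometric_of_lt_one (by positivity) hr1).mul_left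
          ((1 - τ⁻¹))).mul_right ((τ ^ ρ) ^ e)
        rw [← div_eq_mul_inv] at h
        refine h.congr_fun fun k => ?_
        rw [Real.rpow_neg hτ0.le, Real.rpow_sub_one hτ0.ne']
        have : τ ^ ρ ≠ 0 := by positivity
        simp only [div_pow, inv_pow, pow_add, pow_one]
        field_simp
      rw [← hs.tsum_eq]
      refine tendsto_tsum_of_dominated_convergence hsum (fun k => ?_) hbd
      have t1 := (hG.lim_mul_const (pow_pos hτ0 k) hz).sub
        (hG.lim_mul_const (pow_pos hτ0 (k + 1)) hz)
      have t2 := hF.lim_mul_const (pow_pos hσ0 (k + e)) hy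
      refine (t1.mul t2).congr fun x => ?_
      have a1 := (hF.pos (y x)).ne'
      have a2 := (hG.pos (z x)).ne'
      field_simp
    · filter_upwards [hbd] with x hx
      exact hsum.of_norm_bounded hx
  have hlim1 := riemann_quotient_tendsto hρ
  have hlim2 : Tendsto (fun τ : ℝ => (1 - τ⁻¹) / (1 - τ ^ (ρ - 1)) * τ ^ ρ) (𝓝[>] 1)
      (𝓝 (1 / (1 - ρ))) := by
    have h := (Real.continuousAt_rpow_const 1 ρ (Or.inl one_ne_zero)).tendsto.mono_left
      (nhdsWithin_le_nhds (s := Set.Ioi 1))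
    rw [Real.one_rpow] at h
    simpa using hlim1.mul h
  rw [tendsto_order]
  constructor
  · intro a ha
    obtain ⟨τ, hτa, hτ⟩ := ((hlim1.eventually_const_lt ha).and self_mem_nhdsWithin).exists
    replace hτ : 1 < τ := hτ
    obtain ⟨m1, m2⟩ := main τ hτ 0 zero_le_one
    rw [pow_zero, mul_one] at m1
    filter_upwards [m1.eventually_const_lt hτa, m2, hy.eventually_gt_atTop 0,
      hz.eventually_gt_atTop 0] with x h1 h2 h3 h4
    refine h1.trans_le ?_
    have hs := hasSum_half_cone (P := P) hU hV hτ h4 (fun t => y x * (t / z x) ^ (-ρ))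
      (by fun_prop)
    refine hasSum_le (fun k => ?_) h2.hasSum (hs.div_const (F (y x) * G (z x)))
    have := (hpos x)
    gcongr
    exact (half_cone_slice_bounds hV hUV hFU hGV hρ0 hτ h3 h4 k).1
  · intro b hb
    obtain ⟨τ, hτb, hτ⟩ := ((hlim2.eventually_lt_const hb).and self_mem_nhdsWithin).exists
    replace hτ : 1 < τ := hτ
    obtain ⟨m1, m2⟩ := main τ hτ 1 le_rfl
    rw [pow_one] at m1
    filter_upwards [m1.eventually_lt_const hτb, m2, hy.eventually_gt_atTop 0,
      hz.eventually_gt_atTop 0] with x h1 h2 h3 h4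
    refine lt_of_le_of_lt ?_ h1
    have hs := hasSum_half_cone (P := P) hU hV hτ h4 (fun t => y x * (t / z x) ^ (-ρ))
      (by fun_prop)
    refine hasSum_le (fun k => ?_) (hs.div_const (F (y x) * G (z x))) h2.hasSum
    have := (hpos x)
    gcongr
    exact (half_cone_slice_bounds hV hUV hFU hGV hρ0 hτ h3 h4 k).2

end HalfCone

end

/-! ### Conditioning on the remaining factors and moments of partial products -/

noncomputable section

section Mixture

variable {Ω : Type*} [MeasurableSpace Ω] {P : Measure Ω} [IsProbabilityMeasure P]
  {A B : Type*} [MeasurableSpace A] [MeasurableSpace B] {T : Ω → A} {W : Ω → B}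

lemma measurable_measureReal_section (hT : Measurable T) {S : Set (A × B)}
    (hS : MeasurableSet S) : Measurable fun b => P.real {ω | (T ω, b) ∈ S} := by
  have h := (measurable_measure_prodMk_right (μ := P.map T) hS).ennreal_toReal
  have e : ∀ b, (P.map T) ((fun a => (a, b)) ⁻¹' S) = P {ω | (T ω, b) ∈ S} := fun b => by
    rw [Measure.map_apply hT (measurable_prodMk_right hS)]
    rfl
  simpa only [e, measureReal_def] using h

lemma measureReal_eq_integral_section (hT : Measurable T) (hW : Measurable W)
    (hTW : IndepFun T W P) {S : Set (A × B)} (hS : MeasurableSet S) :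
    P.real {ω | (T ω, W ω) ∈ S} = ∫ ω, P.real {ω' | (T ω', W ω) ∈ S} ∂P := by
  have hsec : ∀ b, (P.map T) ((fun a => (a, b)) ⁻¹' S) = P {ω | (T ω, b) ∈ S} := fun b => by
    rw [Measure.map_apply hT (measurable_prodMk_right hS)]
    rfl
  have h1 : P {ω | (T ω, W ω) ∈ S} = ∫⁻ ω, P {ω' | (T ω', W ω) ∈ S} ∂P := by
    have := Measure.map_apply (μ := P) (hT.prodMk hW) hS
    rw [hTW.map_prod_eq_prod_map_map hT.aemeasurable hW.aemeasurable,
      Measure.prod_apply_symm hS, lintegral_map (measurable_measure_prodMk_right hS) hW] at this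
    simp only [hsec] at this
    exact this.symm
  have hm : Measurable fun b => P {ω | (T ω, b) ∈ S} := by
    simpa only [hsec] using measurable_measure_prodMk_right (μ := P.map T) hS
  simp only [measureReal_def]
  rw [h1]
  exact (integral_toReal (hm.comp hW).aemeasurable (ae_of_all _ fun _ => measure_lt_top _ _)).symm

/-- Dominated convergence for the probability of an event that depends on two independent
random elements, conditionally on the second one. -/
lemma tendsto_measureReal_mixture (hT : Measurable T) (hW : Measurable W)
    (hTW : IndepFun T W P) {S : ℝ → Set (A × B)} (hS : ∀ x, MeasurableSet (S x))
    {c : ℝ → ℝ} (hc : ∀ x, 0 < c x) {bd L : B → ℝ} (hbd : Integrable (fun ω => bd (W ω)) P)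
    (hle : ∀ᶠ x in atTop, ∀ ω, P.real {ω' | (T ω', W ω) ∈ S x} ≤ bd (W ω) * c x)
    (hlim : ∀ ω, Tendsto (fun x => P.real {ω' | (T ω', W ω) ∈ S x} / c x) atTop (𝓝 (L (W ω)))) :
    Integrable (fun ω => L (W ω)) P ∧
    Tendsto (fun x => P.real {ω | (T ω, W ω) ∈ S x} / c x) atTop (𝓝 (∫ ω, L (W ω) ∂P)) := by
  have hmeas : ∀ x, AEStronglyMeasurable (fun ω => P.real {ω' | (T ω', W ω) ∈ S x} / c x) P :=
    fun x => (((measurable_measureReal_section hT (hS x)).comp hW).div_const _).aestronglyMeasurable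
  have hb : ∀ᶠ x in atTop, ∀ᵐ ω ∂P, ‖P.real {ω' | (T ω', W ω) ∈ S x} / c x‖ ≤ bd (W ω) := by
    filter_upwards [hle] with x hx
    refine ae_of_all _ fun ω => ?_
    rw [Real.norm_of_nonneg (div_nonneg measureReal_nonneg (hc x).le), div_le_iff₀ (hc x)]
    exact hx ω
  constructor
  · refine hbd.mono' (aestronglyMeasurable_of_tendsto_ae atTop hmeas (ae_of_all _ hlim)) ?_
    refine ae_of_all _ fun ω => le_of_tendsto (hlim ω).norm ?_
    filter_upwards [hle] with x hx
    rw [Real.norm_of_nonneg (div_nonneg measureReal_nonneg (hc x).le), div_le_iff₀ (hc x)]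
    exact hx ω
  · simp_rw [measureReal_eq_integral_section hT hW hTW (hS _), ← integral_div]
    exact tendsto_integral_filter_of_dominated_convergence _ (Eventually.of_forall hmeas) hb hbd
      (ae_of_all _ hlim)

end Mixture

/-- Monotonicity of `F` replaces uniform convergence: the varying factor is eventually on one side
of a constant `s` arbitrarily close to `t`. -/
lemma RVTail.lim_mul_tendsto {F : ℝ → ℝ} (h : RVTail F) {ι : Type*} {l : Filter ι} {y g : ι → ℝ}
    {t : ℝ} (hy : Tendsto y l atTop) (hg : Tendsto g l (𝓝 t)) (ht : 0 < t) :
    Tendsto (fun x => F (y x * g x) / F (y x)) l (𝓝 t⁻¹) := by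
  have hinv : ContinuousAt (fun s : ℝ => s⁻¹) t := continuousAt_inv₀ ht.ne'
  rw [tendsto_order]
  constructor
  · intro a ha
    obtain ⟨s, hs, hts⟩ := (((hinv.tendsto.mono_left nhdsWithin_le_nhds).eventually_const_lt
      ha).and (self_mem_nhdsWithin (s := Set.Ioi t))).exists
    replace hts : t < s := hts
    filter_upwards [(h.lim_mul_const (ht.trans hts) hy).eventually_const_lt hs,
      hg.eventually_lt_const hts, hy.eventually_ge_atTop 0] with x h1 h2 h3
    refine h1.trans_le ?_
    have := h.pos (y x)
    gcongr
    exact h.anti (by gcongr)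
  · intro b hb
    obtain ⟨s, ⟨hs, hs0⟩, hts⟩ := ((((hinv.tendsto.mono_left nhdsWithin_le_nhds).eventually_lt_const
      hb).and (Filter.Eventually.filter_mono nhdsWithin_le_nhds (eventually_gt_nhds ht))).and
      (self_mem_nhdsWithin (s := Set.Iio t))).exists
    replace hts : s < t := hts
    filter_upwards [(h.lim_mul_const hs0 hy).eventually_lt_const hs,
      hg.eventually_const_lt hts, hy.eventually_ge_atTop 0] with x h1 h2 h3
    refine lt_of_le_of_lt ?_ h1
    have := h.pos (y x)
    gcongr
    exact h.anti (by gcongr)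

section PowerProducts

variable {Ω : Type*} {n : ℕ}
  {X : Fin n → Ω → ℝ} {α β : Fin n → ℝ}

/-- The pair of partial power products over an index set `s`. -/
def partialProducts (X : Fin n → Ω → ℝ) (α β : Fin n → ℝ) (s : Finset (Fin n)) (ω : Ω) : ℝ × ℝ :=
  (∏ m ∈ s, X m ω ^ α m, ∏ m ∈ s, X m ω ^ β m)

lemma partialProducts_nonneg (h0 : ∀ i ω, 0 ≤ X i ω) (s : Finset (Fin n)) (ω : Ω) :
    0 ≤ (partialProducts X α β s ω).1 ∧ 0 ≤ (partialProducts X α β s ω).2 :=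
  ⟨Finset.prod_nonneg fun m _ => Real.rpow_nonneg (h0 m ω) _,
    Finset.prod_nonneg fun m _ => Real.rpow_nonneg (h0 m ω) _⟩

lemma partialProducts_rpow_mul (h0 : ∀ i ω, 0 ≤ X i ω) (hα : ∀ i, 0 ≤ α i) (hβ : ∀ i, 0 ≤ β i)
    {a b : ℝ} (ha : 0 ≤ a) (hb : 0 ≤ b) (s : Finset (Fin n)) (ω : Ω) :
    (partialProducts X α β s ω).1 ^ a * (partialProducts X α β s ω).2 ^ b =
      ∏ m ∈ s, X m ω ^ (a * α m + b * β m) := by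
  simp only [partialProducts]
  rw [← Real.finsetProd_rpow _ _ fun m _ => Real.rpow_nonneg (h0 m ω) _,
    ← Real.finsetProd_rpow _ _ fun m _ => Real.rpow_nonneg (h0 m ω) _, ← Finset.prod_mul_distrib]
  refine Finset.prod_congr rfl fun m _ => ?_
  -- Nonnegative exponents keep additivity valid where `X m` vanishes, with `0 ^ 0 = 1`.
  rw [← Real.rpow_mul (h0 m ω), ← Real.rpow_mul (h0 m ω),
    Real.rpow_add_of_nonneg (h0 m ω) (mul_nonneg ha (hα m)) (mul_nonneg hb (hβ m)),
    mul_comm a, mul_comm b]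

lemma powerProduct_eq_mul_erase (γ : Fin n → ℝ) (i : Fin n) (ω : Ω) :
    powerProduct X γ ω = X i ω ^ γ i * ∏ m ∈ Finset.univ.erase i, X m ω ^ γ m :=
  (Finset.mul_prod_erase _ _ (Finset.mem_univ i)).symm

lemma powerProduct_eq_mul_sdiff (γ : Fin n → ℝ) {i j : Fin n} (hij : i ≠ j) (ω : Ω) :
    powerProduct X γ ω =
      X i ω ^ γ i * X j ω ^ γ j * ∏ m ∈ Finset.univ \ {i, j}, X m ω ^ γ m := by
  rw [powerProduct, ← Finset.prod_sdiff (Finset.subset_univ {i, j}), Finset.prod_pair hij,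
    mul_comm]

variable [MeasurableSpace Ω] {P : Measure Ω}

lemma measurable_partialProducts (hX : ∀ i, Measurable (X i)) (s : Finset (Fin n)) :
    Measurable (partialProducts X α β s) :=
  (Finset.measurable_prod _ fun m _ => (hX m).pow_const _).prodMk
    (Finset.measurable_prod _ fun m _ => (hX m).pow_const _)

lemma indepFun_partialProducts (hX : ∀ i, Measurable (X i)) (hind : iIndepFun X P)
    {s t : Finset (Fin n)} (hst : Disjoint s t) :
    IndepFun (fun ω (i : s) => X i ω) (partialProducts X α β t) P := by
  have h := hind.indepFun_finset s t hst hX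
  have h2 := h.comp (φ := id)
    (ψ := fun f : t → ℝ => (∏ m : t, f m ^ α m, ∏ m : t, f m ^ β m)) measurable_id
    ((Finset.measurable_prod _ fun m _ => (measurable_pi_apply m).pow_const _).prodMk
      (Finset.measurable_prod _ fun m _ => (measurable_pi_apply m).pow_const _))
  have e : partialProducts X α β t = (fun f : t → ℝ => (∏ m : t, f m ^ α m, ∏ m : t, f m ^ β m)) ∘
      fun ω (i : t) => X i ω := by
    funext ω
    simp only [partialProducts, Function.comp]
    rw [← Finset.prod_coe_sort t, ← Finset.prod_coe_sort t]
  rw [e]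
  exact h2

lemma integrable_prod_rpow [IsProbabilityMeasure P] (hX : ∀ i, Measurable (X i))
    (h0 : ∀ i ω, 0 ≤ X i ω) (hind : iIndepFun X P)
    (hrv : ∀ i, RVTail fun x => P.real {ω | x < X i ω}) {s : Finset (Fin n)} {θ : Fin n → ℝ}
    (hθ0 : ∀ m ∈ s, 0 ≤ θ m) (hθ : ∀ m ∈ s, θ m < 1) :
    Integrable (fun ω => ∏ m ∈ s, X m ω ^ θ m) P := by
  refine ⟨(Finset.measurable_prod _ fun m _ => (hX m).pow_const _).aestronglyMeasurable, ?_⟩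
  rw [hasFiniteIntegral_iff_ofReal (ae_of_all _ fun ω =>
    Finset.prod_nonneg fun m _ => Real.rpow_nonneg (h0 m ω) _)]
  simp_rw [ENNReal.ofReal_prod_of_nonneg fun m _ => Real.rpow_nonneg (h0 m _) (θ m)]
  have hind' : iIndepFun (fun m ω => ENNReal.ofReal (X m ω ^ θ m)) P :=
    hind.comp (fun m x => ENNReal.ofReal (x ^ θ m))
      fun m => (measurable_id.pow_const _).ennreal_ofReal
  rw [lintegral_prod_eq_prod_lintegral_of_indepFun s _ hind'
    fun m => ((hX m).pow_const _).ennreal_ofReal]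
  refine ENNReal.prod_lt_top fun m hm => ?_
  have := ((hrv m).integrable_rpow (hX m) (h0 m) (hθ0 m hm) (hθ m hm)).2
  rwa [hasFiniteIntegral_iff_ofReal (ae_of_all _ fun ω => Real.rpow_nonneg (h0 m ω) _)] at this

lemma integrable_partialProducts_rpow [IsProbabilityMeasure P] (hX : ∀ i, Measurable (X i))
    (h0 : ∀ i ω, 0 ≤ X i ω) (hind : iIndepFun X P)
    (hrv : ∀ i, RVTail fun x => P.real {ω | x < X i ω})
    (hα : ∀ i, 0 ≤ α i) (hβ : ∀ i, 0 ≤ β i) {s : Finset (Fin n)} {a b : ℝ}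
    (ha : 0 ≤ a) (hb : 0 ≤ b) (hab : ∀ m ∈ s, a * α m + b * β m < 1) :
    Integrable (fun ω => (partialProducts X α β s ω).1 ^ a *
      (partialProducts X α β s ω).2 ^ b) P := by
  simp_rw [partialProducts_rpow_mul h0 hα hβ ha hb]
  exact integrable_prod_rpow hX h0 hind hrv
    (fun m _ => add_nonneg (mul_nonneg ha (hα m)) (mul_nonneg hb (hβ m))) hab

end PowerProducts

end

/-! ### One positive component -/

noncomputable section

lemma lt_rpow_mul_iff {c u a w : ℝ} (hc : 0 ≤ c) (hu : 0 ≤ u) (ha : 0 < a) (hw : 0 < w) :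
    c < u ^ a * w ↔ (c / w) ^ (1 / a) < u := by
  rw [one_div, Real.rpow_inv_lt_iff_of_pos (div_nonneg hc hw.le) hu ha, div_lt_iff₀ hw]

section SingleComponent

variable {Ω : Type*} [MeasurableSpace Ω] {P : Measure Ω} [IsProbabilityMeasure P] {n : ℕ}
  {X : Fin n → Ω → ℝ} {α β : Fin n → ℝ}

lemma exists_potter_exponent {ι : Type*} [Finite ι] {c : ι → ℝ} (hc : ∀ m, c m < 1) :
    ∃ δ : ℝ, 0 < δ ∧ δ < 1 ∧ ∀ m, c m * (1 + δ) < 1 := by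
  have h1 : ∀ᶠ δ in 𝓝[>] (0:ℝ), ∀ m, c m * (1 + δ) < 1 := by
    refine eventually_all.2 fun m => ?_
    have : Tendsto (fun δ : ℝ => c m * (1 + δ)) (𝓝[>] 0) (𝓝 (c m * (1 + 0))) :=
      (Continuous.tendsto (by fun_prop) 0).mono_left nhdsWithin_le_nhds
    exact this.eventually_lt_const (by simpa using hc m)
  have h2 : ∀ᶠ δ in 𝓝[>] (0:ℝ), δ < 1 :=
    Filter.Eventually.filter_mono nhdsWithin_le_nhds (eventually_lt_nhds one_pos)
  obtain ⟨δ, ⟨h1, h2⟩, h3⟩ := ((h1.and h2).and self_mem_nhdsWithin).exists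
  exact ⟨δ, h3, h2, h1⟩

/-- Combining the two inequalities with the dual weights leaves `u` with exponent exactly `1 / k`.
The resulting lower bound for `u` depends on the other factors only through the product whose
moments are controlled. -/
lemma rpow_le_of_lt_of_lt {a b w k s₀ s₁ x u p q : ℝ} (hw0 : 0 ≤ w) (hw1 : w ≤ 1) (hk : 0 < k)
    (hab : w * a + (1 - w) * b = 1 / k) (hs₀ : 0 < s₀) (hs₁ : 0 < s₁) (hx : 0 < x) (hu : 0 < u)
    (hp : 0 < p) (hq : 0 < q) (h₀ : s₀ * x < u ^ a * p) (h₁ : s₁ * x < u ^ b * q) :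
    x ^ k * ((s₀ ^ w * s₁ ^ (1 - w)) ^ k * ((p ^ w * q ^ (1 - w)) ^ k)⁻¹) ≤ u := by
  have h2 : (s₀ * x) ^ w * (s₁ * x) ^ (1 - w) ≤ (u ^ a * p) ^ w * (u ^ b * q) ^ (1 - w) := by
    have := sub_nonneg.2 hw1
    gcongr
  have e1 : (s₀ * x) ^ w * (s₁ * x) ^ (1 - w) = x * (s₀ ^ w * s₁ ^ (1 - w)) := by
    rw [Real.mul_rpow hs₀.le hx.le, Real.mul_rpow hs₁.le hx.le]
    have : x ^ w * x ^ (1 - w) = x := by rw [← Real.rpow_add hx]; simp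
    linear_combination (s₀ ^ w * s₁ ^ (1 - w)) * this
  have e2 : (u ^ a * p) ^ w * (u ^ b * q) ^ (1 - w) = u ^ (1 / k) * (p ^ w * q ^ (1 - w)) := by
    rw [Real.mul_rpow (by positivity) hp.le, Real.mul_rpow (by positivity) hq.le,
      ← Real.rpow_mul hu.le, ← Real.rpow_mul hu.le, ← hab, Real.rpow_add hu]
    ring_nf
  rw [e1, e2] at h2
  have h3 := Real.rpow_le_rpow (by positivity) h2 hk.le
  rw [Real.mul_rpow hx.le (by positivity), Real.mul_rpow (x := u ^ (1 / k)) (by positivity)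
    (by positivity), ← Real.rpow_mul hu.le, one_div_mul_cancel hk.ne', Real.rpow_one] at h3
  rw [← mul_assoc, ← div_eq_mul_inv, div_le_iff₀ (by positivity)]
  exact h3

/-- Given the other factors, the event is `X i > max` of two thresholds asymptotic to `t * x ^ k`,
so the conditional ratio tends to `t⁻¹`. The function `L` is left abstract so that all three cases
of (ii) are instances. -/
lemma tendsto_single_component (hX : ∀ i, Measurable (X i)) (h0 : ∀ i ω, 0 ≤ X i ω)
    (hind : iIndepFun X P) (hrv : ∀ i, RVTail fun x => P.real {ω | x < X i ω})
    (hα : ∀ i, 0 ≤ α i) (hβ : ∀ i, 0 ≤ β i) {i : Fin n} {k w s₀ s₁ : ℝ} (hk : 0 < k)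
    (hαi : 0 < α i) (hβi : 0 < β i) (hw0 : 0 ≤ w) (hw1 : w ≤ 1)
    (hwk : w * α i + (1 - w) * β i = 1 / k)
    (hlt : ∀ m, m ≠ i → w * α m + (1 - w) * β m < 1 / k) (hs₀ : 0 < s₀) (hs₁ : 0 < s₁)
    (L : ℝ × ℝ → ℝ) (hL0 : ∀ p : ℝ × ℝ, 0 ≤ p.1 → 0 ≤ p.2 → p.1 = 0 ∨ p.2 = 0 → L p = 0)
    (hL : ∀ p : ℝ × ℝ, 0 < p.1 → 0 < p.2 → ∃ t, 0 < t ∧ L p = t⁻¹ ∧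
      Tendsto (fun x : ℝ => max ((s₀ * x / p.1) ^ (1 / α i)) ((s₁ * x / p.2) ^ (1 / β i)) / x ^ k)
        atTop (𝓝 t)) :
    Integrable (fun ω => L (partialProducts X α β (Finset.univ.erase i) ω)) P ∧
    Tendsto (fun x : ℝ =>
      P.real {ω | s₀ * x < powerProduct X α ω ∧ s₁ * x < powerProduct X β ω} /
        P.real {ω | x ^ k < X i ω}) atTop
      (𝓝 (∫ ω, L (partialProducts X α β (Finset.univ.erase i) ω) ∂P)) := by
  set W := partialProducts X α β (Finset.univ.erase i) with hW
  have hWm : Measurable W := measurable_partialProducts hX _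
  have hW0 : ∀ ω, 0 ≤ (W ω).1 ∧ 0 ≤ (W ω).2 := partialProducts_nonneg h0 _
  have hTW : IndepFun (X i) W P := by
    have hd : Disjoint {i} (Finset.univ.erase i) := by simp
    exact (indepFun_partialProducts (α := α) (β := β) hX hind hd).comp
      (φ := fun f : ({i} : Finset (Fin n)) → ℝ => f ⟨i, by simp⟩) (ψ := id)
      (measurable_pi_apply _) measurable_id
  set F : ℝ → ℝ := fun x => P.real {ω | x < X i ω} with hFdef
  have hF : RVTail F := hrv i
  have hxk : Tendsto (fun x : ℝ => x ^ k) atTop atTop := tendsto_rpow_atTop hk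
  let S : ℝ → Set (ℝ × ℝ × ℝ) := fun x =>
    {y | s₀ * x < y.1 ^ α i * y.2.1 ∧ s₁ * x < y.1 ^ β i * y.2.2}
  have hS : ∀ x, MeasurableSet (S x) := fun x =>
    (measurableSet_lt (g := fun y : ℝ × ℝ × ℝ => y.1 ^ α i * y.2.1) measurable_const
      (by fun_prop)).inter
      (measurableSet_lt (g := fun y : ℝ × ℝ × ℝ => y.1 ^ β i * y.2.2) measurable_const
        (by fun_prop))
  have hev : ∀ x, {ω | s₀ * x < powerProduct X α ω ∧ s₁ * x < powerProduct X β ω} =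
      {ω | (X i ω, W ω) ∈ S x} := fun x => by
    ext ω
    simp only [powerProduct_eq_mul_erase _ i, Set.mem_ofPred_eq, S, hW, partialProducts]
  have hempty : ∀ x, 0 < x → ∀ ω, (W ω).1 = 0 ∨ (W ω).2 = 0 →
      P.real {ω' | (X i ω', W ω) ∈ S x} = 0 := by
    intro x hx ω h
    have : {ω' | (X i ω', W ω) ∈ S x} = ∅ := by
      ext ω'
      simp only [Set.mem_ofPred_eq, S, Set.mem_empty_iff_false, iff_false, not_and]
      intro h1 h2
      rcases h with h | h
      · rw [h, mul_zero] at h1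
        exact absurd h1 (by have := mul_pos hs₀ hx; linarith)
      · rw [h, mul_zero] at h2
        exact absurd h2 (by have := mul_pos hs₁ hx; linarith)
    rw [this, measureReal_empty]
  obtain ⟨δ, hδ, hδ1, hδm⟩ := exists_potter_exponent
    (c := fun m : {m // m ≠ i} => (w * α m + (1 - w) * β m) * k)
    fun m => (lt_div_iff₀ hk).1 (hlt m m.2)
  obtain ⟨C, y₀, hC, hy₀, hpot⟩ := hF.potter hδ hδ1
  -- The division by `2` turns the non-strict lower bound on `X i` into the strict one required by
  -- the survival function.
  set q : ℝ := (s₀ ^ w * s₁ ^ (1 - w)) ^ k / 2 with hq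
  have hq0 : 0 < q := by positivity
  have h1w := sub_nonneg.2 hw1
  have hδ1' := sub_nonneg.2 hδ1.le
  -- The Potter envelope at `q / (p.1 ^ w * p.2 ^ (1 - w)) ^ k`, expanded into powers of the partial
  -- products.
  let bd : ℝ × ℝ → ℝ := fun p =>
    C * (q ^ (-1 - δ) * (p.1 ^ (w * k * (1 + δ)) * p.2 ^ ((1 - w) * k * (1 + δ))) +
      q ^ (-1 + δ) * (p.1 ^ (w * k * (1 - δ)) * p.2 ^ ((1 - w) * k * (1 - δ))))
  have hbd : Integrable (fun ω => bd (W ω)) P := by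
    refine (Integrable.add (Integrable.const_mul ?_ _) (Integrable.const_mul ?_ _)).const_mul _
    · refine integrable_partialProducts_rpow hX h0 hind hrv hα hβ (by positivity) (by positivity)
        fun m hm => ?_
      have := hδm ⟨m, Finset.ne_of_mem_erase hm⟩
      simp only at this
      linarith
    · refine integrable_partialProducts_rpow hX h0 hind hrv hα hβ (by positivity) (by positivity)
        fun m hm => ?_
      have := hδm ⟨m, Finset.ne_of_mem_erase hm⟩
      simp only at this
      have h3 : 0 ≤ (w * α m + (1 - w) * β m) * k * δ := by
        have := hα m
        have := hβ m
        positivity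
      linarith
  have hbd0 : ∀ ω, 0 ≤ bd (W ω) := fun ω => by
    have := hW0 ω
    have h1 := Real.rpow_nonneg this.1
    have h2 := Real.rpow_nonneg this.2
    exact mul_nonneg hC.le (add_nonneg
      (mul_nonneg (by positivity) (mul_nonneg (h1 _) (h2 _)))
      (mul_nonneg (by positivity) (mul_nonneg (h1 _) (h2 _))))
  have hpow : ∀ p₀ p₁ η : ℝ, 0 < p₀ → 0 < p₁ → (q * ((p₀ ^ w * p₁ ^ (1 - w)) ^ k)⁻¹) ^ (-η) =
      q ^ (-η) * (p₀ ^ (w * k * η) * p₁ ^ ((1 - w) * k * η)) := by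
    intro p₀ p₁ η hp₀ hp₁
    rw [Real.mul_rpow hq0.le (by positivity), Real.inv_rpow (by positivity),
      Real.rpow_neg (x := (p₀ ^ w * p₁ ^ (1 - w)) ^ k) (by positivity), inv_inv,
      Real.mul_rpow (by positivity) (by positivity), Real.mul_rpow (by positivity) (by positivity),
      ← Real.rpow_mul hp₀.le, ← Real.rpow_mul hp₁.le, ← Real.rpow_mul hp₀.le,
      ← Real.rpow_mul hp₁.le]
  have hmix := tendsto_measureReal_mixture (hX i) hWm hTW hS (c := fun x => F (x ^ k))
    (fun x => hF.pos _) (bd := bd) (L := L) hbd ?_ ?_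
  · simpa only [hev] using hmix
  · filter_upwards [eventually_gt_atTop 0, hxk.eventually_ge_atTop y₀] with x hx hxy ω
    by_cases hz : (W ω).1 = 0 ∨ (W ω).2 = 0
    · rw [hempty x hx ω hz]
      exact mul_nonneg (hbd0 ω) (hF.pos _).le
    · push Not at hz
      have hp₀ : 0 < (W ω).1 := lt_of_le_of_ne (hW0 ω).1 hz.1.symm
      have hp₁ : 0 < (W ω).2 := lt_of_le_of_ne (hW0 ω).2 hz.2.symm
      set m := (W ω).1 ^ w * (W ω).2 ^ (1 - w) with hm
      have hm0 : 0 < m := by positivity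
      have hsub : P.real {ω' | (X i ω', W ω) ∈ S x} ≤ F (x ^ k * (q * (m ^ k)⁻¹)) := by
        refine measureReal_mono fun ω' h => ?_
        simp only [Set.mem_ofPred_eq, S] at h
        have hu : 0 < X i ω' := by
          refine lt_of_le_of_ne (h0 i ω') fun e => ?_
          rw [← e, Real.zero_rpow hαi.ne', zero_mul] at h
          have := mul_pos hs₀ hx
          linarith [h.1]
        have h3 := rpow_le_of_lt_of_lt hw0 hw1 hk hwk hs₀ hs₁ hx hu hp₀ hp₁ h.1 h.2
        refine lt_of_lt_of_le ?_ h3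
        gcongr
        rw [hq]
        exact half_lt_self (by positivity)
      refine hsub.trans ((hpot _ hxy _ (by positivity)).trans_eq ?_)
      simp only [bd, potterEnv]
      rw [show (-1 - δ) = -(1 + δ) by ring, show (-1 + δ) = -(1 - δ) by ring, hpow _ _ _ hp₀ hp₁,
        hpow _ _ _ hp₀ hp₁]
  · intro ω
    by_cases hz : (W ω).1 = 0 ∨ (W ω).2 = 0
    · rw [hL0 _ (hW0 ω).1 (hW0 ω).2 hz]
      refine tendsto_const_nhds.congr' ?_
      filter_upwards [eventually_gt_atTop 0] with x hx
      rw [hempty x hx ω hz, zero_div]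
    · push Not at hz
      have hp₀ : 0 < (W ω).1 := lt_of_le_of_ne (hW0 ω).1 hz.1.symm
      have hp₁ : 0 < (W ω).2 := lt_of_le_of_ne (hW0 ω).2 hz.2.symm
      obtain ⟨t, ht, hLt, hlim⟩ := hL (W ω) hp₀ hp₁
      rw [hLt]
      refine (hF.lim_mul_tendsto hxk hlim ht).congr' ?_
      filter_upwards [eventually_gt_atTop 0] with x hx
      congr 1
      rw [mul_div_cancel₀ _ (by positivity)]
      change P.real _ = P.real _
      congr 1
      ext ω'
      simp only [Set.mem_ofPred_eq, S]
      rw [lt_rpow_mul_iff (by positivity) (h0 i ω') hαi hp₀,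
        lt_rpow_mul_iff (by positivity) (h0 i ω') hβi hp₁, max_lt_iff]

/-- The normalised threshold of the dominant or balanced product. -/
lemma tendsto_threshold_div {s p a k : ℝ} (hs : 0 < s) (hp : 0 < p) (hk : 1 / k ≤ a)
    (hk0 : 0 < k) :
    Tendsto (fun x : ℝ => (s * x / p) ^ (1 / a) / x ^ k) atTop
      (𝓝 (if a = 1 / k then (s / p) ^ (1 / a) else 0)) := by
  have ha : 0 < a := lt_of_lt_of_le (by positivity) hk
  have e : ∀ᶠ x : ℝ in atTop,
      (s / p) ^ (1 / a) * x ^ (-(k - 1 / a)) = (s * x / p) ^ (1 / a) / x ^ k := by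
    filter_upwards [eventually_gt_atTop 0] with x hx
    rw [mul_div_right_comm, Real.mul_rpow (by positivity) hx.le, mul_div_assoc,
      ← Real.rpow_sub hx]
    ring_nf
  refine Tendsto.congr' e ?_
  split_ifs with h
  · have : k - 1 / a = 0 := by rw [h, one_div_one_div, sub_self]
    simp only [this, neg_zero, Real.rpow_zero, mul_one]
    exact tendsto_const_nhds
  · have h1 : 0 < k - 1 / a := by
      have h2 : 1 / k < a := lt_of_le_of_ne hk (Ne.symm h)
      have := one_div_lt_one_div_of_lt (by positivity) h2
      rw [one_div_one_div] at this
      linarith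
    simpa using (tendsto_rpow_neg_atTop h1).const_mul ((s / p) ^ (1 / a))

lemma tendsto_max_threshold_div {s₀ s₁ p₀ p₁ a b k : ℝ} (hs₀ : 0 < s₀) (hs₁ : 0 < s₁)
    (hp₀ : 0 < p₀) (hp₁ : 0 < p₁) (hk0 : 0 < k) (ha : 1 / k ≤ a) (hb : 1 / k ≤ b) :
    Tendsto (fun x : ℝ => max ((s₀ * x / p₀) ^ (1 / a)) ((s₁ * x / p₁) ^ (1 / b)) / x ^ k) atTop
      (𝓝 (max (if a = 1 / k then (s₀ / p₀) ^ (1 / a) else 0)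
        (if b = 1 / k then (s₁ / p₁) ^ (1 / b) else 0))) := by
  refine ((tendsto_threshold_div hs₀ hp₀ ha hk0).max
    (tendsto_threshold_div hs₁ hp₁ hb hk0)).congr' ?_
  filter_upwards [eventually_gt_atTop 0] with x hx
  rw [max_div_div_right (by positivity)]

end SingleComponent

end

noncomputable section

section SingleComponent

variable {Ω : Type*} {n : ℕ} {X : Fin n → Ω → ℝ} {α β : Fin n → ℝ}

/-- Shows that the integrand, written factor by factor, depends only on the two partial products, as
`L` must. -/
lemma prod_rpow_mul_indicator (h0 : ∀ i ω, 0 ≤ X i ω) (b : ℝ) (s : Finset (Fin n)) (ω : Ω) :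
    ∏ j ∈ s, X j ω ^ (β j / b) * Set.indicator {ω' | 0 < X j ω' ^ α j} 1 ω =
      (∏ j ∈ s, X j ω ^ β j) ^ (1 / b) * if 0 < ∏ j ∈ s, X j ω ^ α j then 1 else 0 := by
  have hnn : ∀ j, 0 ≤ X j ω ^ α j := fun j => Real.rpow_nonneg (h0 j ω) _
  have e1 : (∏ j ∈ s, X j ω ^ β j) ^ (1 / b) = ∏ j ∈ s, X j ω ^ (β j / b) := by
    rw [← Real.finsetProd_rpow _ _ fun m _ => Real.rpow_nonneg (h0 m ω) _]
    refine Finset.prod_congr rfl fun j _ => ?_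
    rw [← Real.rpow_mul (h0 j ω), mul_one_div]
  rw [Finset.prod_mul_distrib, e1]
  congr 1
  split_ifs with h
  · refine Finset.prod_eq_one fun j hj => ?_
    have hj' : 0 < X j ω ^ α j := by
      refine lt_of_le_of_ne (hnn j) fun e => ?_
      rw [Finset.prod_eq_zero hj e.symm] at h
      exact lt_irrefl _ h
    exact Set.indicator_of_mem (s := {ω' | 0 < X j ω' ^ α j}) hj' 1
  · have h' : ∏ j ∈ s, X j ω ^ α j = 0 :=
      le_antisymm (not_lt.1 h) (Finset.prod_nonneg fun j _ => hnn j)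
    obtain ⟨j, hj, hj0⟩ := Finset.prod_eq_zero_iff.1 h'
    refine Finset.prod_eq_zero hj (Set.indicator_of_notMem (fun hmem => ?_) 1)
    have hmem' : 0 < X j ω ^ α j := hmem
    linarith

variable [MeasurableSpace Ω] {P : Measure Ω} [IsProbabilityMeasure P] {κ : Fin n → ℝ}

lemma LPUniqueSolution.tendsto_single_of_eq (h : LPUniqueSolution α β κ)
    (hX : ∀ i, Measurable (X i)) (h0 : ∀ i ω, 0 ≤ X i ω)
    (hind : iIndepFun X P) (hrv : ∀ i, RVTail fun x => P.real {ω | x < X i ω})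
    (hα : ∀ i, 0 ≤ α i) (hβ : ∀ i, 0 ≤ β i) {i : Fin n} {s₀ s₁ : ℝ} (hi : 0 < κ i)
    (hi0 : ∀ j, j ≠ i → κ j = 0) (hs₀ : 0 < s₀) (hs₁ : 0 < s₁) (hab : α i = β i) :
    Integrable (fun ω => min (s₀⁻¹ * ∏ j ∈ Finset.univ.erase i, X j ω ^ α j)
      (s₁⁻¹ * ∏ j ∈ Finset.univ.erase i, X j ω ^ β j) ^ (1 / β i)) P ∧
    Tendsto (fun x : ℝ =>
        P.real {ω | s₀ * x < powerProduct X α ω ∧ s₁ * x < powerProduct X β ω} /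
          P.real {ω | x ^ κ i < X i ω}) atTop
      (𝓝 (∫ ω, min (s₀⁻¹ * ∏ j ∈ Finset.univ.erase i, X j ω ^ α j)
        (s₁⁻¹ * ∏ j ∈ Finset.univ.erase i, X j ω ^ β j) ^ (1 / β i) ∂P)) := by
  obtain ⟨ha1, hb1, w, hw0, hw1, hwk, -, -, hlt⟩ := h.exists_weight_single hi hi0
  have hk : 0 < 1 / κ i := by positivity
  have hαk : α i = 1 / κ i := by rw [← hwk, ← hab]; ring
  have hβk : β i = 1 / κ i := by rw [← hab]; exact hαk
  refine tendsto_single_component hX h0 hind hrv hα hβ hi (by linarith) (by linarith) hw0 hw1 hwk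
    hlt hs₀ hs₁ (fun p => min (s₀⁻¹ * p.1) (s₁⁻¹ * p.2) ^ (1 / β i)) ?_ ?_
  · rintro p h1 h2 h3
    have hb : 1 / β i ≠ 0 := by rw [hβk, one_div_one_div]; exact hi.ne'
    have h1' := mul_nonneg (inv_pos.2 hs₀).le h1
    have h2' := mul_nonneg (inv_pos.2 hs₁).le h2
    have : min (s₀⁻¹ * p.1) (s₁⁻¹ * p.2) = 0 := by
      rcases h3 with h3 | h3
      · rw [h3, mul_zero]; exact min_eq_left h2'
      · rw [h3, mul_zero]; exact min_eq_right h1'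
    simp only [this, Real.zero_rpow hb]
  · intro p hp₀ hp₁
    have hlim := tendsto_max_threshold_div hs₀ hs₁ hp₀ hp₁ hi ha1 hb1
    rw [if_pos hαk, if_pos hβk] at hlim
    refine ⟨_, by positivity, ?_, hlim⟩
    have hc : 0 ≤ 1 / β i := by rw [hβk]; positivity
    rw [hab]
    have hmono : MonotoneOn (fun x : ℝ => x ^ (1 / β i)) (Set.Ici 0) :=
      Real.monotoneOn_rpow_Ici_of_exponent_nonneg hc
    have hq₀ : 0 < s₀ / p.1 := by positivity
    have hq₁ : 0 < s₁ / p.2 := by positivity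
    have e1 : max ((s₀ / p.1) ^ (1 / β i)) ((s₁ / p.2) ^ (1 / β i)) =
        (max (s₀ / p.1) (s₁ / p.2)) ^ (1 / β i) :=
      (hmono.map_max hq₀.le hq₁.le).symm
    have e2 : min (s₀⁻¹ * p.1) (s₁⁻¹ * p.2) = (max (s₀ / p.1) (s₁ / p.2))⁻¹ := by
      rcases le_total (s₀ / p.1) (s₁ / p.2) with hle | hle
      · rw [max_eq_right hle, min_eq_right]
        · field_simp
        · have := inv_anti₀ hq₀ hle
          rw [inv_div, inv_div] at this
          rw [inv_mul_eq_div, inv_mul_eq_div]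
          exact this
      · rw [max_eq_left hle, min_eq_left]
        · field_simp
        · have := inv_anti₀ hq₁ hle
          rw [inv_div, inv_div] at this
          rw [inv_mul_eq_div, inv_mul_eq_div]
          exact this
    simp only [e2]
    rw [Real.inv_rpow (by positivity), ← e1]

lemma LPUniqueSolution.tendsto_single_of_lt (h : LPUniqueSolution α β κ)
    (hX : ∀ i, Measurable (X i)) (h0 : ∀ i ω, 0 ≤ X i ω)
    (hind : iIndepFun X P) (hrv : ∀ i, RVTail fun x => P.real {ω | x < X i ω})
    (hα : ∀ i, 0 ≤ α i) (hβ : ∀ i, 0 ≤ β i) {i : Fin n} {s₀ s₁ : ℝ} (hi : 0 < κ i)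
    (hi0 : ∀ j, j ≠ i → κ j = 0) (hs₀ : 0 < s₀) (hs₁ : 0 < s₁) (hab : β i < α i) :
    Integrable (fun ω => ∏ j ∈ Finset.univ.erase i,
      X j ω ^ (β j / β i) * Set.indicator {ω' | 0 < X j ω' ^ α j} 1 ω) P ∧
    Tendsto (fun x : ℝ =>
        P.real {ω | s₀ * x < powerProduct X α ω ∧ s₁ * x < powerProduct X β ω} /
          P.real {ω | x ^ κ i < X i ω}) atTop
      (𝓝 ((∫ ω, ∏ j ∈ Finset.univ.erase i,
        X j ω ^ (β j / β i) * Set.indicator {ω' | 0 < X j ω' ^ α j} 1 ω ∂P) *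
          s₁ ^ (-(1 / β i)))) := by
  obtain ⟨ha1, hb1, w, hw0, hw1, hwk, -, hw, hlt⟩ := h.exists_weight_single hi hi0
  have hk : 0 < 1 / κ i := by positivity
  have hβk : β i = 1 / κ i := by rw [← hwk, hw hab]; ring
  have hαk : α i ≠ 1 / κ i := by rw [← hβk]; exact hab.ne'
  have hb : 1 / β i ≠ 0 := by rw [hβk, one_div_one_div]; exact hi.ne'
  have hs : s₁ ^ (-(1 / β i)) ≠ 0 := by positivity
  have key := tendsto_single_component hX h0 hind hrv hα hβ hi (by linarith) (by linarith) hw0 hw1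
    hwk hlt hs₀ hs₁
    (fun p => p.2 ^ (1 / β i) * (if 0 < p.1 then 1 else 0) * s₁ ^ (-(1 / β i))) ?_ ?_
  · simp_rw [prod_rpow_mul_indicator h0]
    rw [← integral_mul_const]
    refine ⟨?_, key.2⟩
    have := key.1.mul_const (s₁ ^ (-(1 / β i)))⁻¹
    simp only [mul_assoc, mul_inv_cancel₀ hs, mul_one] at this
    exact this
  · rintro p - - (h3 | h3)
    · simp [h3]
    · simp only [h3, Real.zero_rpow hb, zero_mul]
  · intro p hp₀ hp₁
    have hlim := tendsto_max_threshold_div hs₀ hs₁ hp₀ hp₁ hi ha1 hb1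
    -- The `α`-threshold is of smaller order than `x ^ κ i` and drops out. That constraint survives
    -- only in the requirement that its partial product be nonzero, which is the origin of the
    -- indicator.
    rw [if_neg hαk, if_pos hβk, max_eq_right (by positivity)] at hlim
    refine ⟨_, by positivity, ?_, hlim⟩
    simp only [if_pos hp₀]
    rw [mul_one, Real.rpow_neg hs₁.le, Real.div_rpow hs₁.le hp₁.le, inv_div]
    exact (div_eq_mul_inv _ _).symm

lemma LPUniqueSolution.tendsto_single_of_gt (h : LPUniqueSolution α β κ)
    (hX : ∀ i, Measurable (X i)) (h0 : ∀ i ω, 0 ≤ X i ω)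
    (hind : iIndepFun X P) (hrv : ∀ i, RVTail fun x => P.real {ω | x < X i ω})
    (hα : ∀ i, 0 ≤ α i) (hβ : ∀ i, 0 ≤ β i) {i : Fin n} {s₀ s₁ : ℝ} (hi : 0 < κ i)
    (hi0 : ∀ j, j ≠ i → κ j = 0) (hs₀ : 0 < s₀) (hs₁ : 0 < s₁) (hab : α i < β i) :
    Integrable (fun ω => ∏ j ∈ Finset.univ.erase i,
      X j ω ^ (α j / α i) * Set.indicator {ω' | 0 < X j ω' ^ β j} 1 ω) P ∧
    Tendsto (fun x : ℝ =>
        P.real {ω | s₀ * x < powerProduct X α ω ∧ s₁ * x < powerProduct X β ω} /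
          P.real {ω | x ^ κ i < X i ω}) atTop
      (𝓝 ((∫ ω, ∏ j ∈ Finset.univ.erase i,
        X j ω ^ (α j / α i) * Set.indicator {ω' | 0 < X j ω' ^ β j} 1 ω ∂P) *
          s₀ ^ (-(1 / α i)))) := by
  have := h.symm.tendsto_single_of_lt hX h0 hind hrv hβ hα hi hi0 hs₁ hs₀ hab
  simpa only [and_comm] using this

end SingleComponent

end

/-! ### Two positive components: geometry and mass of the cone -/

noncomputable section

section Cone

variable {a b u v aᵢ aⱼ bᵢ bⱼ : ℝ}

/-- With `p = log (u / a)` and `q = log (v / b)` the event is the cone `aᵢ p + aⱼ q > 0`, `bᵢ p + bⱼ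
q > 0`. Since `p` and `q` are not both nonpositive there, it splits into the parts `q > 0` and `p >
0`. In each part one inequality implies the other because the determinant is positive. The cases `u
= 0` and `v = 0` lie outside the logarithmic chart. -/
lemma cone_iff (ha : 0 < a) (hb : 0 < b) (hu : 0 ≤ u) (hv : 0 ≤ v) (haj : 0 ≤ aⱼ) (haij : aⱼ < aᵢ)
    (hbi : 0 ≤ bᵢ) (hbij : bᵢ < bⱼ) :
    ((a ^ aᵢ * b ^ aⱼ < u ^ aᵢ * v ^ aⱼ ∧ a ^ bᵢ * b ^ bⱼ < u ^ bᵢ * v ^ bⱼ) ↔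
      (b < v ∧ a * (v / b) ^ (-(aⱼ / aᵢ)) < u) ∨ (a < u ∧ b * (u / a) ^ (-(bᵢ / bⱼ)) < v)) ∧
    ((b < v ∧ a * (v / b) ^ (-(aⱼ / aᵢ)) < u) ∧ (a < u ∧ b * (u / a) ^ (-(bᵢ / bⱼ)) < v) ↔
      b < v ∧ a < u) := by
  have hai : 0 < aᵢ := by linarith
  have hbj : 0 < bⱼ := by linarith
  rcases hu.eq_or_lt with rfl | hu
  · have h1 : ¬ a * (v / b) ^ (-(aⱼ / aᵢ)) < 0 := not_lt.2 (by positivity)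
    have h2 : ¬ a < 0 := ha.not_gt
    have h3 : ¬ a ^ aᵢ * b ^ aⱼ < 0 ^ aᵢ * v ^ aⱼ := by
      rw [Real.zero_rpow hai.ne', zero_mul]
      exact not_lt.2 (by positivity)
    simp only [h1, h2, h3, and_false, false_and, or_false]
    exact ⟨trivial, trivial⟩
  rcases hv.eq_or_lt with rfl | hv
  · have h1 : ¬ b * (u / a) ^ (-(bᵢ / bⱼ)) < 0 := not_lt.2 (by positivity)
    have h2 : ¬ b < 0 := hb.not_gt
    have h3 : ¬ a ^ bᵢ * b ^ bⱼ < u ^ bᵢ * 0 ^ bⱼ := by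
      rw [Real.zero_rpow hbj.ne', mul_zero]
      exact not_lt.2 (by positivity)
    simp only [h1, h2, h3, and_false, false_and, or_false]
    exact ⟨trivial, trivial⟩
  have lp : ∀ {s t e f : ℝ}, 0 < s → 0 < t →
      Real.log (s ^ e * t ^ f) = e * Real.log s + f * Real.log t := by
    intro s t e f hs ht
    rw [Real.log_mul (by positivity) (by positivity), Real.log_rpow hs, Real.log_rpow ht]
  have lq : ∀ {s t r e : ℝ}, 0 < s → 0 < t → 0 < r →
      Real.log (s * (t / r) ^ (-e)) = Real.log s - e * (Real.log t - Real.log r) := by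
    intro s t r e hs ht hr
    rw [Real.log_mul (by positivity) (by positivity), Real.log_rpow (by positivity),
      Real.log_div ht.ne' hr.ne']
    ring
  rw [← Real.log_lt_log_iff (by positivity) (by positivity), lp ha hb, lp hu hv,
    ← Real.log_lt_log_iff (x := a ^ bᵢ * b ^ bⱼ) (by positivity) (by positivity), lp ha hb,
    lp hu hv, ← Real.log_lt_log_iff (x := b) hb hv, ← Real.log_lt_log_iff (x := a) ha hu,
    ← Real.log_lt_log_iff (y := u) (x := a * (v / b) ^ (-(aⱼ / aᵢ))) (by positivity) hu, lq ha hv hb,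
    ← Real.log_lt_log_iff (y := v) (x := b * (u / a) ^ (-(bᵢ / bⱼ))) (by positivity) hv, lq hb hu ha]
  obtain ⟨p, hp⟩ : ∃ p, p = Real.log u - Real.log a := ⟨_, rfl⟩
  obtain ⟨q, hq⟩ : ∃ q, q = Real.log v - Real.log b := ⟨_, rfl⟩
  have hu' : Real.log u = Real.log a + p := by linarith
  have hv' : Real.log v = Real.log b + q := by linarith
  rw [hu', hv']
  have e1 : Real.log a - aⱼ / aᵢ * (Real.log b + q - Real.log b) < Real.log a + p ↔
      0 < aᵢ * p + aⱼ * q := by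
    have : aᵢ * p + aⱼ * q = aᵢ * (p + aⱼ / aᵢ * q) := by field_simp
    rw [this, mul_pos_iff_of_pos_left hai]
    constructor <;> intro h <;> linarith
  have e2 : Real.log b - bᵢ / bⱼ * (Real.log a + p - Real.log a) < Real.log b + q ↔
      0 < bᵢ * p + bⱼ * q := by
    have : bᵢ * p + bⱼ * q = bⱼ * (bᵢ / bⱼ * p + q) := by field_simp
    rw [this, mul_pos_iff_of_pos_left hbj]
    constructor <;> intro h <;> linarith
  have e3 : aᵢ * Real.log a + aⱼ * Real.log b <
      aᵢ * (Real.log a + p) + aⱼ * (Real.log b + q) ↔ 0 < aᵢ * p + aⱼ * q := by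
    constructor <;> intro h <;> linarith
  have e4 : bᵢ * Real.log a + bⱼ * Real.log b <
      bᵢ * (Real.log a + p) + bⱼ * (Real.log b + q) ↔ 0 < bᵢ * p + bⱼ * q := by
    constructor <;> intro h <;> linarith
  rw [e1, e2, e3, e4, lt_add_iff_pos_right, lt_add_iff_pos_right]
  refine ⟨⟨fun ⟨h1, h2⟩ => ?_, ?_⟩, ⟨fun ⟨⟨h1, _⟩, ⟨h2, _⟩⟩ => ⟨h1, h2⟩, fun ⟨h1, h2⟩ => ?_⟩⟩
  · rcases lt_or_ge 0 q with hq0 | hq0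
    · exact Or.inl ⟨hq0, h1⟩
    · refine Or.inr ⟨?_, h2⟩
      by_contra hp0
      push Not at hp0
      rcases hp0.eq_or_lt with hp0 | hp0
      · rw [hp0] at h1
        nlinarith
      · nlinarith
  · rintro (⟨h1, h2⟩ | ⟨h1, h2⟩)
    · refine ⟨h2, ?_⟩
      by_contra hcon
      push Not at hcon
      -- The certificate is `aᵢ (bᵢ p + bⱼ q) = bᵢ (aᵢ p + aⱼ q) + (aᵢ bⱼ - aⱼ bᵢ) q`.
      nlinarith [mul_nonneg hbi h2.le, mul_nonneg hbi haj, mul_pos hbj hai,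
        mul_le_mul_of_nonneg_left hcon hai.le, mul_lt_mul'' haij hbij haj hbi,
        mul_pos h1 (sub_pos.2 (mul_lt_mul'' haij hbij haj hbi))]
    · refine ⟨?_, h2⟩
      by_contra hcon
      push Not at hcon
      nlinarith [mul_nonneg haj h2.le, mul_nonneg hbi haj, mul_pos hbj hai,
        mul_le_mul_of_nonneg_left hcon hbj.le, mul_lt_mul'' haij hbij haj hbi,
        mul_pos h1 (sub_pos.2 (mul_lt_mul'' haij hbij haj hbi))]
  · have h3 := mul_pos hai h2
    have h4 := mul_nonneg haj h1.le
    have h5 := mul_pos hbj h1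
    have h6 := mul_nonneg hbi h2.le
    exact ⟨⟨h1, by linarith⟩, h2, by linarith⟩

end Cone

section TwoComponents

variable {Ω : Type*} [MeasurableSpace Ω] {P : Measure Ω} [IsProbabilityMeasure P]
  {U V : Ω → ℝ} {F G : ℝ → ℝ} {ρ σ : ℝ}

/-- Inclusion-exclusion: the half cones contribute `1 / (1 - ρ)` and `1 / (1 - σ)`, and their
intersection is a quadrant of relative mass `1`. Shifting the apex by `(u, v)` contributes `u⁻¹ *
v⁻¹` by regular variation. -/
lemma double_cone_tendsto (hU : Measurable U) (hV : Measurable V) (hUV : IndepFun U V P)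
    (hFU : ∀ x, P.real {ω | x < U ω} = F x) (hGV : ∀ x, P.real {ω | x < V ω} = G x)
    (hF : RVTail F) (hG : RVTail G) (hρ0 : 0 ≤ ρ) (hρ : ρ < 1) (hσ0 : 0 ≤ σ) (hσ : σ < 1)
    {E : ℝ → ℝ → Set Ω}
    (hE : ∀ a b, 0 < a → 0 < b → ∀ ω,
      (ω ∈ E a b ↔ (b < V ω ∧ a * (V ω / b) ^ (-ρ) < U ω) ∨
        (a < U ω ∧ b * (U ω / a) ^ (-σ) < V ω)) ∧
      ((b < V ω ∧ a * (V ω / b) ^ (-ρ) < U ω) ∧ (a < U ω ∧ b * (U ω / a) ^ (-σ) < V ω) ↔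
        b < V ω ∧ a < U ω))
    {y z : ℝ → ℝ} (hy : Tendsto y atTop atTop) (hz : Tendsto z atTop atTop)
    {u v : ℝ} (hu : 0 < u) (hv : 0 < v) :
    Tendsto (fun x => P.real (E (y x * u) (z x * v)) / (F (y x) * G (z x))) atTop
      (𝓝 (u⁻¹ * v⁻¹ * (1 / (1 - ρ) + 1 / (1 - σ) - 1))) := by
  have hyu := hy.atTop_mul_const hu
  have hzv := hz.atTop_mul_const hv
  have t1 := half_cone_tendsto hU hV hUV hFU hGV hF hG hρ0 hρ hyu hzv
  have t2 := half_cone_tendsto hV hU hUV.symm hGV hFU hG hF hσ0 hσ hzv hyu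
  have t3 := (hF.lim_mul_const hu hy).mul (hG.lim_mul_const hv hz)
  refine (t3.mul ((t1.add t2).sub_const 1)).congr' ?_
  filter_upwards [hyu.eventually_gt_atTop 0, hzv.eventually_gt_atTop 0] with x hx1 hx2
  set a := y x * u
  set b := z x * v
  have hunion := measureReal_union_add_inter (μ := P)
    (s := {ω | b < V ω ∧ a * (V ω / b) ^ (-ρ) < U ω})
    (t := {ω | a < U ω ∧ b * (U ω / a) ^ (-σ) < V ω})
    ((measurableSet_lt measurable_const hU).inter
      (measurableSet_lt (((hU.div_const _).pow_const _).const_mul _) hV))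
  have e1 : {ω | b < V ω ∧ a * (V ω / b) ^ (-ρ) < U ω} ∪
      {ω | a < U ω ∧ b * (U ω / a) ^ (-σ) < V ω} = E a b := by
    ext ω
    exact ((hE a b hx1 hx2 ω).1).symm
  have e2 : {ω | b < V ω ∧ a * (V ω / b) ^ (-ρ) < U ω} ∩
      {ω | a < U ω ∧ b * (U ω / a) ^ (-σ) < V ω} = {ω | V ω ∈ Set.Ioi b ∧ U ω ∈ Set.Ioi a} := by
    ext ω
    exact (hE a b hx1 hx2 ω).2
  rw [e1, e2, hUV.symm.measureReal_setOf_and measurableSet_Ioi measurableSet_Ioi] at hunion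
  simp only [Set.mem_Ioi] at hunion
  rw [hFU, hGV] at hunion
  have p1 := (hF.pos (y x)).ne'
  have p2 := (hG.pos (z x)).ne'
  have p3 := (hF.pos a).ne'
  have p4 := (hG.pos b).ne'
  field_simp
  linarith

lemma double_cone_le (hU : Measurable U) (hV : Measurable V) (hUV : IndepFun U V P)
    (hFU : ∀ x, P.real {ω | x < U ω} = F x) (hGV : ∀ x, P.real {ω | x < V ω} = G x)
    (hF : RVTail F) (hG : RVTail G) (hρ0 : 0 ≤ ρ) (hρ : ρ < 1) (hσ0 : 0 ≤ σ) (hσ : σ < 1)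
    {E : ℝ → ℝ → Set Ω}
    (hE : ∀ a b, 0 < a → 0 < b → ∀ ω,
      (ω ∈ E a b ↔ (b < V ω ∧ a * (V ω / b) ^ (-ρ) < U ω) ∨
        (a < U ω ∧ b * (U ω / a) ^ (-σ) < V ω)))
    {δ : ℝ} (hδ : 0 < δ) (hδρ : 2 * δ < 1 - ρ) (hδσ : 2 * δ < 1 - σ) :
    ∃ C y₀ : ℝ, 0 < C ∧ 1 ≤ y₀ ∧ ∀ y z u v : ℝ, y₀ ≤ y → y₀ ≤ z → 0 < u → 0 < v →
      P.real (E (y * u) (z * v)) ≤ C * (potterEnv δ u * potterEnv δ v) * (F y * G z) := by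
  obtain ⟨C₁, y₁, hC₁, hy₁, H₁⟩ := half_cone_le hU hV hUV hFU hGV hF hG hρ0 hρ hδ hδρ
  obtain ⟨C₂, y₂, hC₂, hy₂, H₂⟩ := half_cone_le hV hU hUV.symm hGV hFU hG hF hσ0 hσ hδ hδσ
  refine ⟨C₁ + C₂, max y₁ y₂, by positivity, hy₁.trans (le_max_left _ _),
    fun y z u v hy hz hu hv => ?_⟩
  have hy0 : 0 < y := by linarith [le_max_left y₁ y₂]
  have hz0 : 0 < z := by linarith [le_max_left y₁ y₂]
  have e1 : E (y * u) (z * v) =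
      {ω | z * v < V ω ∧ y * u * (V ω / (z * v)) ^ (-ρ) < U ω} ∪
      {ω | y * u < U ω ∧ z * v * (U ω / (y * u)) ^ (-σ) < V ω} := by
    ext ω
    exact hE _ _ (by positivity) (by positivity) ω
  rw [e1]
  refine (measureReal_union_le _ _).trans ?_
  have h1 := H₁ y z u v ((le_max_left _ _).trans hy) ((le_max_left _ _).trans hz) hu hv
  have h2 := H₂ z y v u ((le_max_right _ _).trans hz) ((le_max_right _ _).trans hy) hv hu
  calc _ ≤ _ := add_le_add h1 h2
    _ = _ := by ring

end TwoComponents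

end

/-! ### Two positive components: the joint tail limit -/

noncomputable section

section TwoComponents

/-- At `η = η' = -1` the exponents are the dual multipliers and all inequalities are strict. They
are open conditions, so they persist at the four corners `-1 ± δ` produced by the product of two
Potter envelopes. -/
lemma exists_two_component_exponent {ι : Type*} [Finite ι] {p q p' q' r : ℝ} {f g : ι → ℝ}
    (hp : 0 < p + p') (hq : 0 < q + q') (hr : 0 < r)
    (hfg : ∀ m, (p + p') * f m + (q + q') * g m < 1) :
    ∃ δ : ℝ, 0 < δ ∧ 2 * δ < r ∧ ∀ η η' : ℝ, (η = -1 - δ ∨ η = -1 + δ) →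
      (η' = -1 - δ ∨ η' = -1 + δ) → 0 ≤ -(p * η + p' * η') ∧ 0 ≤ -(q * η + q' * η') ∧
      ∀ m, -(p * η + p' * η') * f m + -(q * η + q' * η') * g m < 1 := by
  have hcond : ∀ᶠ y in 𝓝 ((-1 : ℝ), (-1 : ℝ)), 0 < -(p * y.1 + p' * y.2) ∧
      0 < -(q * y.1 + q' * y.2) ∧
      ∀ m, -(p * y.1 + p' * y.2) * f m + -(q * y.1 + q' * y.2) * g m < 1 := by
    have c1 : Continuous fun y : ℝ × ℝ => -(p * y.1 + p' * y.2) := by fun_prop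
    have c2 : Continuous fun y : ℝ × ℝ => -(q * y.1 + q' * y.2) := by fun_prop
    refine ((c1.tendsto _).eventually_const_lt (by simp only; linarith)).and
      (((c2.tendsto _).eventually_const_lt (by simp only; linarith)).and
        (eventually_all.2 fun m => ?_))
    refine (((c1.mul_const (f m)).add (c2.mul_const (g m))).tendsto _).eventually_lt_const ?_
    have := hfg m
    simp only [Pi.add_apply]
    linarith
  obtain ⟨ε, hε, H⟩ := Metric.eventually_nhds_iff.1 hcond
  have hδ : 0 < min (ε / 2) (r / 4) := by positivity
  have h1 := min_le_left (ε / 2) (r / 4)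
  have h2 := min_le_right (ε / 2) (r / 4)
  refine ⟨min (ε / 2) (r / 4), hδ, by linarith, fun η η' hη hη' => ?_⟩
  have hdist : ∀ t, (t = -1 - min (ε / 2) (r / 4) ∨ t = -1 + min (ε / 2) (r / 4)) →
      dist t (-1) < ε := by
    rintro t (rfl | rfl)
    · rw [Real.dist_eq, abs_lt]
      constructor <;> linarith
    · rw [Real.dist_eq, abs_lt]
      constructor <;> linarith
  have := H (y := (η, η')) (by rw [Prod.dist_eq]; exact max_lt (hdist _ hη) (hdist _ hη'))
  exact ⟨this.1.le, this.2.1.le, this.2.2⟩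

lemma rpow_mul_rpow_pair {c d p q p' q' s t : ℝ} (hc : 0 < c) (hd : 0 < d) :
    (c ^ p * d ^ q) ^ s * (c ^ p' * d ^ q') ^ t = c ^ (p * s + p' * t) * d ^ (q * s + q' * t) := by
  rw [Real.mul_rpow (by positivity) (by positivity), Real.mul_rpow (by positivity) (by positivity),
    ← Real.rpow_mul hc.le, ← Real.rpow_mul hc.le, ← Real.rpow_mul hd.le, ← Real.rpow_mul hd.le,
    Real.rpow_add hc, Real.rpow_add hd]
  ring

lemma div_rpow_eq {s w e : ℝ} (hs : 0 < s) (hw : 0 < w) : (s / w) ^ e = s ^ e * w ^ (-e) := by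
  rw [Real.div_rpow hs.le hw.le, Real.rpow_neg hw.le, div_eq_mul_inv]

variable {Ω : Type*} [MeasurableSpace Ω] {P : Measure Ω} [IsProbabilityMeasure P] {n : ℕ}
  {X : Fin n → Ω → ℝ} {α β : Fin n → ℝ}

lemma tendsto_two_components (hX : ∀ i, Measurable (X i)) (h0 : ∀ i ω, 0 ≤ X i ω)
    (hind : iIndepFun X P) (hrv : ∀ i, RVTail fun x => P.real {ω | x < X i ω})
    (hα : ∀ i, 0 ≤ α i) (hβ : ∀ i, 0 ≤ β i) {i j : Fin n} (hij : i ≠ j) {k l s₀ s₁ lam mu : ℝ}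
    (hk : 0 < k) (hl : 0 < l) (hαkl : α i * k + α j * l = 1) (hβkl : β i * k + β j * l = 1)
    (hαij : α j < α i) (hβij : β i < β j)
    (hlam : lam = (β j - β i) / (α i * β j - α j * β i))
    (hmu : mu = (α i - α j) / (α i * β j - α j * β i))
    (hlt : ∀ m, m ≠ i → m ≠ j → lam * α m + mu * β m < 1) (hs₀ : 0 < s₀) (hs₁ : 0 < s₁) :
    Integrable (fun ω => (α i * β j - α j * β i) / ((α i - α j) * (β j - β i)) *
      (s₀ ^ (-lam) * s₁ ^ (-mu)) * ((partialProducts X α β (Finset.univ \ {i, j}) ω).1 ^ lam *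
        (partialProducts X α β (Finset.univ \ {i, j}) ω).2 ^ mu)) P ∧
    Tendsto (fun x : ℝ =>
      P.real {ω | s₀ * x < powerProduct X α ω ∧ s₁ * x < powerProduct X β ω} /
        (P.real {ω | x ^ k < X i ω} * P.real {ω | x ^ l < X j ω})) atTop
      (𝓝 (∫ ω, (α i * β j - α j * β i) / ((α i - α j) * (β j - β i)) *
        (s₀ ^ (-lam) * s₁ ^ (-mu)) * ((partialProducts X α β (Finset.univ \ {i, j}) ω).1 ^ lam *
          (partialProducts X α β (Finset.univ \ {i, j}) ω).2 ^ mu) ∂P)) := by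
  set W := partialProducts X α β (Finset.univ \ {i, j}) with hW
  have hWm : Measurable W := measurable_partialProducts hX _
  have hW0 : ∀ ω, 0 ≤ (W ω).1 ∧ 0 ≤ (W ω).2 := partialProducts_nonneg h0 _
  have hTm : Measurable fun ω => (X i ω, X j ω) := (hX i).prodMk (hX j)
  have hTW : IndepFun (fun ω => (X i ω, X j ω)) W P :=
    (indepFun_partialProducts (α := α) (β := β) hX hind
      (Finset.disjoint_sdiff (s := {i, j}) (t := Finset.univ))).comp
      (φ := fun f : ({i, j} : Finset (Fin n)) → ℝ => (f ⟨i, by simp⟩, f ⟨j, by simp⟩)) (ψ := id)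
      ((measurable_pi_apply _).prodMk (measurable_pi_apply _)) measurable_id
  set F : ℝ → ℝ := fun x => P.real {ω | x < X i ω} with hFdef
  set G : ℝ → ℝ := fun x => P.real {ω | x < X j ω} with hGdef
  have hF : RVTail F := hrv i
  have hG : RVTail G := hrv j
  have hyk : Tendsto (fun x : ℝ => x ^ k) atTop atTop := tendsto_rpow_atTop hk
  have hzl : Tendsto (fun x : ℝ => x ^ l) atTop atTop := tendsto_rpow_atTop hl
  have hai : 0 < α i := (hα j).trans_lt hαij
  have hbj : 0 < β j := (hβ i).trans_lt hβij
  have hdet : 0 < α i * β j - α j * β i :=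
    sub_pos.2 (mul_lt_mul'' hαij hβij (hα j) (hβ i))
  set D := α i * β j - α j * β i with hD
  -- exponents of the apex of the cone
  obtain ⟨p, hp⟩ : ∃ p, p = β j / D := ⟨_, rfl⟩
  obtain ⟨q, hq⟩ : ∃ q, q = -α j / D := ⟨_, rfl⟩
  obtain ⟨p', hp'⟩ : ∃ p', p' = -β i / D := ⟨_, rfl⟩
  obtain ⟨q', hq'⟩ : ∃ q', q' = α i / D := ⟨_, rfl⟩
  have hpp : p + p' = lam := by rw [hp, hp', hlam]; ring
  have hqq : q + q' = mu := by rw [hq, hq', hmu]; ring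
  have ea0 : p * α i + p' * α j = 1 := by
    rw [hp, hp', div_mul_eq_mul_div, div_mul_eq_mul_div, ← add_div, div_eq_one_iff_eq hdet.ne', hD]
    ring
  have ea1 : q * α i + q' * α j = 0 := by rw [hq, hq']; ring
  have eb0 : p * β i + p' * β j = 0 := by rw [hp, hp']; ring
  have eb1 : q * β i + q' * β j = 1 := by
    rw [hq, hq', div_mul_eq_mul_div, div_mul_eq_mul_div, ← add_div, div_eq_one_iff_eq hdet.ne', hD]
    ring
  have hlam0 : 0 < lam := by rw [hlam]; exact div_pos (sub_pos.2 hβij) hdet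
  have hmu0 : 0 < mu := by rw [hmu]; exact div_pos (sub_pos.2 hαij) hdet
  have hρ0 : 0 ≤ α j / α i := div_nonneg (hα j) hai.le
  have hρ : α j / α i < 1 := (div_lt_one hai).2 hαij
  have hσ0 : 0 ≤ β i / β j := div_nonneg (hβ i) hbj.le
  have hσ : β i / β j < 1 := (div_lt_one hbj).2 hβij
  obtain ⟨δ, hδ, hδr, hδm⟩ := exists_two_component_exponent (p := p) (q := q) (p' := p') (q' := q')
    (r := min (1 - α j / α i) (1 - β i / β j))
    (f := fun m : {m // m ≠ i ∧ m ≠ j} => α m) (g := fun m : {m // m ≠ i ∧ m ≠ j} => β m)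
    (by rw [hpp]; exact hlam0) (by rw [hqq]; exact hmu0)
    (lt_min (sub_pos.2 hρ) (sub_pos.2 hσ))
    (fun m => by rw [hpp, hqq]; exact hlt m m.2.1 m.2.2)
  let E : ℝ → ℝ → Set Ω := fun a b => {ω | a ^ α i * b ^ α j < X i ω ^ α i * X j ω ^ α j ∧
    a ^ β i * b ^ β j < X i ω ^ β i * X j ω ^ β j}
  have hE : ∀ a b : ℝ, 0 < a → 0 < b → ∀ ω,
      (ω ∈ E a b ↔ (b < X j ω ∧ a * (X j ω / b) ^ (-(α j / α i)) < X i ω) ∨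
        (a < X i ω ∧ b * (X i ω / a) ^ (-(β i / β j)) < X j ω)) ∧
      ((b < X j ω ∧ a * (X j ω / b) ^ (-(α j / α i)) < X i ω) ∧
        (a < X i ω ∧ b * (X i ω / a) ^ (-(β i / β j)) < X j ω) ↔
        b < X j ω ∧ a < X i ω) := fun a b ha hb ω =>
    cone_iff (u := X i ω) (v := X j ω) ha hb (h0 i ω) (h0 j ω) (hα j) hαij (hβ i) hβij
  have hUV : IndepFun (X i) (X j) P := hind.indepFun hij
  obtain ⟨C, y₀, hC, hy₀, hle⟩ := double_cone_le (hX i) (hX j) hUV (F := F) (G := G)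
    (fun _ => rfl) (fun _ => rfl) hF hG hρ0 hρ hσ0 hσ (E := E)
    (fun a b ha hb ω => (hE a b ha hb ω).1) hδ (hδr.trans_le (min_le_left _ _))
    (hδr.trans_le (min_le_right _ _))
  let S : ℝ → Set ((ℝ × ℝ) × ℝ × ℝ) := fun x =>
    {y | s₀ * x < y.1.1 ^ α i * y.1.2 ^ α j * y.2.1 ∧ s₁ * x < y.1.1 ^ β i * y.1.2 ^ β j * y.2.2}
  have hS : ∀ x, MeasurableSet (S x) := fun x =>
    (measurableSet_lt (g := fun y : (ℝ × ℝ) × ℝ × ℝ => y.1.1 ^ α i * y.1.2 ^ α j * y.2.1)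
      measurable_const (by fun_prop)).inter
    (measurableSet_lt (g := fun y : (ℝ × ℝ) × ℝ × ℝ => y.1.1 ^ β i * y.1.2 ^ β j * y.2.2)
      measurable_const (by fun_prop))
  have hev : ∀ x, {ω | s₀ * x < powerProduct X α ω ∧ s₁ * x < powerProduct X β ω} =
      {ω | ((X i ω, X j ω), W ω) ∈ S x} := fun x => by
    ext ω
    simp only [powerProduct_eq_mul_sdiff _ hij, Set.mem_ofPred_eq, S, hW, partialProducts]
  have hempty : ∀ x, 0 < x → ∀ ω, (W ω).1 = 0 ∨ (W ω).2 = 0 →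
      P.real {ω' | ((X i ω', X j ω'), W ω) ∈ S x} = 0 := by
    intro x hx ω h
    have : {ω' | ((X i ω', X j ω'), W ω) ∈ S x} = ∅ := by
      ext ω'
      simp only [Set.mem_ofPred_eq, S, Set.mem_empty_iff_false, iff_false, not_and]
      intro h1 h2
      rcases h with h | h
      · rw [h, mul_zero] at h1
        exact absurd h1 (by have := mul_pos hs₀ hx; linarith)
      · rw [h, mul_zero] at h2
        exact absurd h2 (by have := mul_pos hs₁ hx; linarith)
    rw [this, measureReal_empty]
  -- The apex solves a linear system in logarithms. The tight constraints account for `x ^ k` and `x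
  -- ^ l`, and `p, q, p', q'` are the entries of the inverse matrix applied to `s₀ / w.1` and `s₁ /
  -- w.2`.
  have hsec : ∀ x, 0 < x → ∀ w : ℝ × ℝ, 0 < w.1 → 0 < w.2 →
      {ω' | ((X i ω', X j ω'), w) ∈ S x} =
        E (x ^ k * ((s₀ / w.1) ^ p * (s₁ / w.2) ^ q))
          (x ^ l * ((s₀ / w.1) ^ p' * (s₁ / w.2) ^ q')) := by
    intro x hx w hw₀ hw₁
    have hc₀ : 0 < s₀ / w.1 := by positivity
    have hc₁ : 0 < s₁ / w.2 := by positivity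
    have key : ∀ e f : ℝ, e * k + f * l = 1 →
        (x ^ k * ((s₀ / w.1) ^ p * (s₁ / w.2) ^ q)) ^ e *
          (x ^ l * ((s₀ / w.1) ^ p' * (s₁ / w.2) ^ q')) ^ f =
        x * ((s₀ / w.1) ^ (p * e + p' * f) * (s₁ / w.2) ^ (q * e + q' * f)) := by
      intro e f hef
      rw [← rpow_mul_rpow_pair hc₀ hc₁, Real.mul_rpow (x := x ^ k) (by positivity) (by positivity),
        Real.mul_rpow (x := x ^ l) (by positivity) (by positivity), ← Real.rpow_mul hx.le,
        ← Real.rpow_mul hx.le]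
      have : x ^ (k * e) * x ^ (l * f) = x := by
        rw [← Real.rpow_add hx, show k * e + l * f = 1 by linarith, Real.rpow_one]
      linear_combination (((s₀ / w.1) ^ p * (s₁ / w.2) ^ q) ^ e *
        ((s₀ / w.1) ^ p' * (s₁ / w.2) ^ q') ^ f) * this
    ext ω'
    simp only [Set.mem_ofPred_eq, S, E]
    rw [key _ _ hαkl, key _ _ hβkl, ea0, ea1, eb0, eb1, Real.rpow_one, Real.rpow_one,
      Real.rpow_zero, Real.rpow_zero, mul_one, one_mul, mul_div_assoc', mul_div_assoc',
      div_lt_iff₀ hw₀, div_lt_iff₀ hw₁, mul_comm x, mul_comm x]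
  -- `term η η'` is `u ^ η * v ^ η'` for the apex `(u, v)`
  let term : ℝ → ℝ → ℝ × ℝ → ℝ := fun η η' w =>
    s₀ ^ (p * η + p' * η') * s₁ ^ (q * η + q' * η') *
      (w.1 ^ (-(p * η + p' * η')) * w.2 ^ (-(q * η + q' * η')))
  have hterm : ∀ η η' (w : ℝ × ℝ), 0 < w.1 → 0 < w.2 →
      ((s₀ / w.1) ^ p * (s₁ / w.2) ^ q) ^ η * ((s₀ / w.1) ^ p' * (s₁ / w.2) ^ q') ^ η' =
        term η η' w := by
    intro η η' w hw₀ hw₁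
    rw [rpow_mul_rpow_pair (by positivity) (by positivity), div_rpow_eq hs₀ hw₀,
      div_rpow_eq hs₁ hw₁]
    simp only [term]
    ring
  have hterm0 : ∀ η η' ω, 0 ≤ term η η' (W ω) := fun η η' ω =>
    mul_nonneg (by positivity)
      (mul_nonneg (Real.rpow_nonneg (hW0 ω).1 _) (Real.rpow_nonneg (hW0 ω).2 _))
  have htermi : ∀ η η', (η = -1 - δ ∨ η = -1 + δ) → (η' = -1 - δ ∨ η' = -1 + δ) →
      Integrable (fun ω => term η η' (W ω)) P := by
    intro η η' hη hη'
    obtain ⟨h1, h2, h3⟩ := hδm η η' hη hη'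
    refine (integrable_partialProducts_rpow hX h0 hind hrv hα hβ h1 h2 fun m hm => ?_).const_mul _
    simp only [Finset.mem_sdiff, Finset.mem_univ, Finset.mem_insert, Finset.mem_singleton, not_or,
      true_and] at hm
    exact h3 ⟨m, hm⟩
  -- The product of the envelopes at the two apex coordinates, multiplied out.
  let bd : ℝ × ℝ → ℝ := fun w => C * (term (-1 - δ) (-1 - δ) w + term (-1 - δ) (-1 + δ) w +
    term (-1 + δ) (-1 - δ) w + term (-1 + δ) (-1 + δ) w)
  have hbd : Integrable (fun ω => bd (W ω)) P :=
    ((((htermi _ _ (Or.inl rfl) (Or.inl rfl)).add (htermi _ _ (Or.inl rfl) (Or.inr rfl))).add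
      (htermi _ _ (Or.inr rfl) (Or.inl rfl))).add
      (htermi _ _ (Or.inr rfl) (Or.inr rfl))).const_mul C
  have hmix := tendsto_measureReal_mixture hTm hWm hTW hS (c := fun x => F (x ^ k) * G (x ^ l))
    (fun x => mul_pos (hF.pos _) (hG.pos _)) (bd := bd)
    (L := fun w => D / ((α i - α j) * (β j - β i)) * (s₀ ^ (-lam) * s₁ ^ (-mu)) *
      (w.1 ^ lam * w.2 ^ mu)) hbd ?_ ?_
  · simpa only [hev] using hmix
  · filter_upwards [eventually_gt_atTop 0, hyk.eventually_ge_atTop y₀,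
      hzl.eventually_ge_atTop y₀] with x hx hxy hxz ω
    by_cases hz : (W ω).1 = 0 ∨ (W ω).2 = 0
    · rw [hempty x hx ω hz]
      refine mul_nonneg (mul_nonneg hC.le ?_) (mul_pos (hF.pos _) (hG.pos _)).le
      exact add_nonneg (add_nonneg (add_nonneg (hterm0 _ _ _) (hterm0 _ _ _)) (hterm0 _ _ _))
        (hterm0 _ _ _)
    · push Not at hz
      have hw₀ : 0 < (W ω).1 := lt_of_le_of_ne (hW0 ω).1 hz.1.symm
      have hw₁ : 0 < (W ω).2 := lt_of_le_of_ne (hW0 ω).2 hz.2.symm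
      rw [hsec x hx _ hw₀ hw₁]
      refine (hle _ _ _ _ hxy hxz (by positivity) (by positivity)).trans_eq ?_
      congr 1
      simp only [bd, ← hterm _ _ _ hw₀ hw₁, potterEnv]
      ring
  · intro ω
    by_cases hz : (W ω).1 = 0 ∨ (W ω).2 = 0
    · have : (W ω).1 ^ lam * (W ω).2 ^ mu = 0 := by
        rcases hz with hz | hz
        · rw [hz, Real.zero_rpow hlam0.ne', zero_mul]
        · rw [hz, Real.zero_rpow hmu0.ne', mul_zero]
      rw [this, mul_zero]
      refine tendsto_const_nhds.congr' ?_
      filter_upwards [eventually_gt_atTop 0] with x hx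
      rw [hempty x hx ω hz, zero_div]
    · push Not at hz
      have hw₀ : 0 < (W ω).1 := lt_of_le_of_ne (hW0 ω).1 hz.1.symm
      have hw₁ : 0 < (W ω).2 := lt_of_le_of_ne (hW0 ω).2 hz.2.symm
      have hlim := double_cone_tendsto (hX i) (hX j) hUV (F := F) (G := G)
        (fun _ => rfl) (fun _ => rfl) hF hG hρ0 hρ hσ0 hσ (E := E) hE hyk hzl
        (u := (s₀ / (W ω).1) ^ p * (s₁ / (W ω).2) ^ q)
        (v := (s₀ / (W ω).1) ^ p' * (s₁ / (W ω).2) ^ q') (by positivity) (by positivity)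
      have e1 : (((s₀ / (W ω).1) ^ p * (s₁ / (W ω).2) ^ q))⁻¹ *
          ((s₀ / (W ω).1) ^ p' * (s₁ / (W ω).2) ^ q')⁻¹ =
          (s₀ ^ (-lam) * s₁ ^ (-mu)) * ((W ω).1 ^ lam * (W ω).2 ^ mu) := by
        rw [← Real.rpow_neg_one, ← Real.rpow_neg_one, hterm _ _ _ hw₀ hw₁]
        simp only [term]
        rw [show p * -1 + p' * -1 = -lam by rw [← hpp]; ring,
          show q * -1 + q' * -1 = -mu by rw [← hqq]; ring, neg_neg, neg_neg]
      have e2 : 1 / (1 - α j / α i) + 1 / (1 - β i / β j) - 1 =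
          D / ((α i - α j) * (β j - β i)) := by
        have h1 : α i - α j ≠ 0 := (sub_pos.2 hαij).ne'
        have h2 : β j - β i ≠ 0 := (sub_pos.2 hβij).ne'
        rw [one_sub_div hai.ne', one_sub_div hbj.ne', one_div_div, one_div_div, hD,
          div_add_div _ _ h1 h2, div_sub_one (mul_ne_zero h1 h2)]
        ring
      rw [e1, e2, mul_comm _ (D / _), ← mul_assoc] at hlim
      refine hlim.congr' ?_
      filter_upwards [eventually_gt_atTop 0] with x hx
      rw [hsec x hx _ hw₀ hw₁]

end TwoComponents

end

/-! ### Limits under uniqueness and regular variation of the minimum -/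

noncomputable section

lemma LPUniqueSolution.exists_pair_or_single {n : ℕ} {α β κ : Fin n → ℝ}
    (h : LPUniqueSolution α β κ) :
    (∃ i j, i ≠ j ∧ 0 < κ i ∧ 0 < κ j) ∨ ∃ i, 0 < κ i ∧ ∀ j, j ≠ i → κ j = 0 := by
  have hV := h.1.sum_pos
  obtain ⟨i, -, hi⟩ := Finset.exists_lt_of_sum_lt (f := fun _ => (0:ℝ)) (g := κ)
    (s := Finset.univ) (by simpa using hV)
  by_cases hex : ∃ j, i ≠ j ∧ 0 < κ j
  · obtain ⟨j, hij, hj⟩ := hex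
    exact Or.inl ⟨i, j, hij, hi, hj⟩
  · push Not at hex
    exact Or.inr ⟨i, hi, fun j hj => le_antisymm (hex j hj.symm) (h.1.1.2.2 j)⟩

variable {Ω : Type*} [MeasurableSpace Ω] {P : Measure Ω} {n : ℕ}
  {X : Fin n → Ω → ℝ} {α β κ : Fin n → ℝ}

lemma measureReal_all_pos (hind : iIndepFun X P)
    (hrv : ∀ i, RVTail fun x => P.real {ω | x < X i ω}) (t : Fin n → ℝ) :
    P.real {ω | ∀ i, t i < X i ω} = ∏ i, P.real {ω | t i < X i ω} ∧
      0 < P.real {ω | ∀ i, t i < X i ω} := by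
  have h1 : P.real {ω | ∀ i, t i < X i ω} = ∏ i, P.real {ω | t i < X i ω} := by
    have e : {ω | ∀ i, t i < X i ω} = ⋂ i, X i ⁻¹' Set.Ioi (t i) := by ext ω; simp
    simp only [measureReal_def]
    rw [e, hind.meas_iInter fun i => ⟨Set.Ioi (t i), measurableSet_Ioi, rfl⟩, ENNReal.toReal_prod]
    rfl
  exact ⟨h1, by rw [h1]; exact Finset.prod_pos fun i _ => (hrv i).pos _⟩

/-- Guarantees that the limit constants do not vanish: all `X i` are positive simultaneously with
positive probability. -/
lemma integral_pos_of_pos_on (hind : iIndepFun X P)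
    (hrv : ∀ i, RVTail fun x => P.real {ω | x < X i ω}) {f : Ω → ℝ} (hf : Integrable f P)
    (hf0 : ∀ ω, 0 ≤ f ω) (hpos : ∀ ω, (∀ i, 0 < X i ω) → 0 < f ω) : 0 < ∫ ω, f ω ∂P := by
  rw [integral_pos_iff_support_of_nonneg hf0 hf]
  have h1 := (measureReal_all_pos hind hrv fun _ => 0).2
  refine lt_of_lt_of_le (ENNReal.toReal_pos_iff.1 h1).1 (measure_mono fun ω hω => ?_)
  exact (hpos ω hω).ne'

variable [IsProbabilityMeasure P]

lemma LPUniqueSolution.tendsto_pair_of_det_pos (h : LPUniqueSolution α β κ)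
    (hX : ∀ i, Measurable (X i)) (h0 : ∀ i ω, 0 ≤ X i ω)
    (hind : iIndepFun X P) (hrv : ∀ i, RVTail fun x => P.real {ω | x < X i ω})
    (hα : ∀ i, 0 ≤ α i) (hβ : ∀ i, 0 ≤ β i) {i j : Fin n} (hij : i ≠ j) (hi : 0 < κ i)
    (hj : 0 < κ j) (hdet : 0 < α i * β j - α j * β i) {s₀ s₁ : ℝ} (hs₀ : 0 < s₀) (hs₁ : 0 < s₁) :
    Integrable (fun ω => ∏ m ∈ Finset.univ \ {i, j},
      X m ω ^ ((α m * (β j - β i) + β m * (α i - α j)) / (α i * β j - α j * β i))) P ∧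
    Tendsto (fun x : ℝ =>
        P.real {ω | s₀ * x < powerProduct X α ω ∧ s₁ * x < powerProduct X β ω} /
          (P.real {ω | x ^ κ i < X i ω} * P.real {ω | x ^ κ j < X j ω})) atTop
      (𝓝 ((|α i * β j - α j * β i| / ((α i - α j) * (β j - β i)) *
            ∫ ω, ∏ m ∈ Finset.univ \ {i, j},
              X m ω ^ ((α m * (β j - β i) + β m * (α i - α j)) / (α i * β j - α j * β i)) ∂P) *
          s₀ ^ ((β i - β j) / (α i * β j - α j * β i)) *
          s₁ ^ ((α j - α i) / (α i * β j - α j * β i)))) := by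
  have hl := h.multiplier_left_pos hij hi hj
  have hm := h.multiplier_right_pos hij hi hj
  -- Positivity of the multipliers fixes the orientation that the cone decomposition requires.
  have hβij : β i < β j := sub_pos.1 ((div_pos_iff_of_pos_right hdet).1 hl)
  have hαij : α j < α i := sub_pos.1 ((div_pos_iff_of_pos_right hdet).1 hm)
  have key := tendsto_two_components hX h0 hind hrv hα hβ hij hi hj (h.tight_left hij hi hj)
    (h.tight_right hij hi hj) hαij hβij rfl rfl (fun m => h.multiplier_lt_one hij hi hj) hs₀ hs₁
  have e : ∀ ω, (partialProducts X α β (Finset.univ \ {i, j}) ω).1 ^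
        ((β j - β i) / (α i * β j - α j * β i)) *
      (partialProducts X α β (Finset.univ \ {i, j}) ω).2 ^
        ((α i - α j) / (α i * β j - α j * β i)) =
      ∏ m ∈ Finset.univ \ {i, j},
        X m ω ^ ((α m * (β j - β i) + β m * (α i - α j)) / (α i * β j - α j * β i)) := by
    intro ω
    rw [partialProducts_rpow_mul h0 hα hβ hl.le hm.le]
    refine Finset.prod_congr rfl fun m _ => ?_
    congr 1
    ring
  simp only [e] at key
  have e0 : (β i - β j) / (α i * β j - α j * β i) = -((β j - β i) / (α i * β j - α j * β i)) := by
    ring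
  have e1 : (α j - α i) / (α i * β j - α j * β i) = -((α i - α j) / (α i * β j - α j * β i)) := by
    ring
  refine ⟨?_, ?_⟩
  · have hne : (α i * β j - α j * β i) / ((α i - α j) * (β j - β i)) *
        (s₀ ^ (-((β j - β i) / (α i * β j - α j * β i))) *
          s₁ ^ (-((α i - α j) / (α i * β j - α j * β i)))) ≠ 0 := by
      have := sub_pos.2 hαij
      have := sub_pos.2 hβij
      positivity
    exact (integrable_const_mul_iff (IsUnit.mk0 _ hne) _).1 key.1
  · convert key.2 using 2
    rw [integral_const_mul, e0, e1, abs_of_pos hdet]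
    ring

lemma LPUniqueSolution.tendsto_pair (h : LPUniqueSolution α β κ)
    (hX : ∀ i, Measurable (X i)) (h0 : ∀ i ω, 0 ≤ X i ω)
    (hind : iIndepFun X P) (hrv : ∀ i, RVTail fun x => P.real {ω | x < X i ω})
    (hα : ∀ i, 0 ≤ α i) (hβ : ∀ i, 0 ≤ β i) {i j : Fin n} (hij : i ≠ j) (hi : 0 < κ i)
    (hj : 0 < κ j) {s₀ s₁ : ℝ} (hs₀ : 0 < s₀) (hs₁ : 0 < s₁) :
    Integrable (fun ω => ∏ m ∈ Finset.univ \ {i, j},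
      X m ω ^ ((α m * (β j - β i) + β m * (α i - α j)) / (α i * β j - α j * β i))) P ∧
    Tendsto (fun x : ℝ =>
        P.real {ω | s₀ * x < powerProduct X α ω ∧ s₁ * x < powerProduct X β ω} /
          (P.real {ω | x ^ κ i < X i ω} * P.real {ω | x ^ κ j < X j ω})) atTop
      (𝓝 ((|α i * β j - α j * β i| / ((α i - α j) * (β j - β i)) *
            ∫ ω, ∏ m ∈ Finset.univ \ {i, j},
              X m ω ^ ((α m * (β j - β i) + β m * (α i - α j)) / (α i * β j - α j * β i)) ∂P) *
          s₀ ^ ((β i - β j) / (α i * β j - α j * β i)) *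
          s₁ ^ ((α j - α i) / (α i * β j - α j * β i)))) := by
  rcases (h.det_ne_zero hij hi hj).lt_or_gt with hneg | hpos
  -- Swapping `i` and `j` reverses the sign of the determinant and leaves every expression in the
  -- claim unchanged.
  · have hdet : α j * β i - α i * β j = -(α i * β j - α j * β i) := by ring
    have hab : (α j - α i) * (β i - β j) = (α i - α j) * (β j - β i) := by ring
    have key := h.tendsto_pair_of_det_pos hX h0 hind hrv hα hβ hij.symm hj hi
      (by linarith) hs₀ hs₁
    have e : ∀ m, (α m * (β i - β j) + β m * (α j - α i)) / (α j * β i - α i * β j) =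
        (α m * (β j - β i) + β m * (α i - α j)) / (α i * β j - α j * β i) := by
      intro m
      rw [← neg_div_neg_eq]
      congr 1 <;> ring
    have e0 : (β j - β i) / (α j * β i - α i * β j) = (β i - β j) / (α i * β j - α j * β i) := by
      rw [← neg_div_neg_eq]
      congr 1 <;> ring
    have e1 : (α i - α j) / (α j * β i - α i * β j) = (α j - α i) / (α i * β j - α j * β i) := by
      rw [← neg_div_neg_eq]
      congr 1 <;> ring
    simp only [e, e0, e1, hab, Finset.pair_comm j i, mul_comm (P.real {ω | _ ^ κ j < X j ω})] at key
    rw [hdet, abs_neg] at key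
    exact key
  · exact h.tendsto_pair_of_det_pos hX h0 hind hrv hα hβ hij hi hj hpos hs₀ hs₁

/-- A joint tail limit with a homogeneous positive limit yields regular variation of the minimum. -/
lemma isRegularlyVaryingRV_min_of_tendsto {Y₀ Y₁ : Ω → ℝ} {c : ℝ → ℝ} {K ρ : ℝ} (hK : 0 < K)
    (h : ∀ s : ℝ, 0 < s → Tendsto (fun x : ℝ =>
      P.real {ω | s * x < Y₀ ω ∧ s * x < Y₁ ω} / c x) atTop (𝓝 (K * s ^ ρ)))
    (hc : ∀ x, 0 < c x) : IsRegularlyVaryingRV P (fun ω => min (Y₀ ω) (Y₁ ω)) ρ := by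
  have e : ∀ x, {ω | x < min (Y₀ ω) (Y₁ ω)} = {ω | x < Y₀ ω ∧ x < Y₁ ω} := fun x => by
    ext ω; simp
  have h1 : Tendsto (fun x : ℝ => P.real {ω | x < min (Y₀ ω) (Y₁ ω)} / c x) atTop (𝓝 K) := by
    simpa [e] using h 1 one_pos
  refine ⟨(antitone_measureReal_lt _).measurable, ?_, fun s hs => ?_⟩
  · filter_upwards [h1.eventually_const_lt hK] with x hx
    exact (div_pos_iff_of_pos_right (hc x)).1 hx
  · have h2 := (h s hs).div h1 hK.ne'
    rw [mul_div_cancel_left₀ _ hK.ne'] at h2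
    refine h2.congr fun x => ?_
    simp only [Pi.div_apply]
    rw [div_div_div_cancel_right₀ (hc x).ne', e, e]

lemma LPUniqueSolution.isRegularlyVaryingRV_min (h : LPUniqueSolution α β κ)
    (hX : ∀ i, Measurable (X i)) (h0 : ∀ i ω, 0 ≤ X i ω)
    (hind : iIndepFun X P) (hrv : ∀ i, RVTail fun x => P.real {ω | x < X i ω})
    (hα : ∀ i, 0 ≤ α i) (hβ : ∀ i, 0 ≤ β i) :
    IsRegularlyVaryingRV P (fun ω => min (powerProduct X α ω) (powerProduct X β ω))
      (-∑ i, κ i) := by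
  have hprod : ∀ (s : Finset (Fin n)) (γ : Fin n → ℝ) ω, 0 ≤ ∏ m ∈ s, X m ω ^ γ m :=
    fun s γ ω => Finset.prod_nonneg fun m _ => Real.rpow_nonneg (h0 m ω) _
  have hprodpos : ∀ (s : Finset (Fin n)) (γ : Fin n → ℝ) ω, (∀ i, 0 < X i ω) →
      0 < ∏ m ∈ s, X m ω ^ γ m :=
    fun s γ ω hω => Finset.prod_pos fun m _ => Real.rpow_pos_of_pos (hω m) _
  rcases h.exists_pair_or_single with ⟨i, j, hij, hi, hj⟩ | ⟨i, hi, hi0⟩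
  · have hl := h.multiplier_left_pos hij hi hj
    have hm := h.multiplier_right_pos hij hi hj
    have hdet := h.det_ne_zero hij hi hj
    have hsum : ∑ m, κ m = κ i + κ j := by
      simpa using h.sum_mul_eq_add hij hi hj fun _ => 1
    have hab : 0 < (α i - α j) * (β j - β i) := by
      have := mul_pos hl hm
      rw [div_mul_div_comm] at this
      have h2 : 0 < (α i * β j - α j * β i) * (α i * β j - α j * β i) :=
        mul_self_pos.2 hdet
      have := (div_pos_iff_of_pos_right h2).1 this
      linarith
    -- Strong duality: the multipliers add up to the optimal value, by combining the two tight
    -- constraints.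
    have hexp : (β i - β j) / (α i * β j - α j * β i) + (α j - α i) / (α i * β j - α j * β i) =
        -∑ m, κ m := by
      have t1 := h.tight_left hij hi hj
      have t2 := h.tight_right hij hi hj
      rw [hsum, ← add_div, div_eq_iff hdet]
      linear_combination (β j - β i) * t1 + (α i - α j) * t2
    have hint := (h.tendsto_pair hX h0 hind hrv hα hβ hij hi hj one_pos one_pos).1
    have hI := integral_pos_of_pos_on hind hrv hint (fun ω => hprod _ _ ω)
      (fun ω hω => hprodpos _ _ ω hω)
    refine isRegularlyVaryingRV_min_of_tendsto
      (mul_pos (div_pos (abs_pos.2 hdet) hab) hI) (fun s hs => ?_)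
      (fun x => mul_pos ((hrv i).pos (x ^ κ i)) ((hrv j).pos (x ^ κ j)))
    have := (h.tendsto_pair hX h0 hind hrv hα hβ hij hi hj hs hs).2
    rwa [mul_assoc (_ * _), ← Real.rpow_add hs, hexp] at this
  · have hsum : ∑ m, κ m = κ i := by simpa using LPUniqueSolution.sum_mul_eq_single hi0 fun _ => 1
    obtain ⟨ha1, hb1, w, hw0, hw1, hwk, hwα, hwβ, hlt⟩ := h.exists_weight_single hi hi0
    rw [hsum]
    rcases lt_trichotomy (β i) (α i) with hab | hab | hab
    · have hβk : β i = 1 / κ i := by rw [← hwk, hwβ hab]; ring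
      have hint := (h.tendsto_single_of_lt hX h0 hind hrv hα hβ hi hi0 one_pos one_pos hab).1
      refine isRegularlyVaryingRV_min_of_tendsto (integral_pos_of_pos_on hind hrv hint
        (fun ω => ?_) (fun ω hω => ?_)) (fun s hs => ?_) (fun x => (hrv i).pos (x ^ κ i))
      · rw [prod_rpow_mul_indicator h0]
        exact mul_nonneg (Real.rpow_nonneg (hprod _ _ _) _) (by split_ifs <;> norm_num)
      · rw [prod_rpow_mul_indicator h0, if_pos (hprodpos _ _ ω hω), mul_one]
        exact Real.rpow_pos_of_pos (hprodpos _ _ ω hω) _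
      · have := (h.tendsto_single_of_lt hX h0 hind hrv hα hβ hi hi0 hs hs hab).2
        rwa [show 1 / β i = κ i by rw [hβk, one_div_one_div]] at this
    · have hβk : β i = 1 / κ i := by rw [← hwk, ← hab]; ring
      have hint := (h.tendsto_single_of_eq hX h0 hind hrv hα hβ hi hi0 one_pos one_pos hab.symm).1
      refine isRegularlyVaryingRV_min_of_tendsto (integral_pos_of_pos_on hind hrv hint
        (fun ω => ?_) (fun ω hω => ?_)) (fun s hs => ?_) (fun x => (hrv i).pos (x ^ κ i))
      · have := hprod (Finset.univ.erase i) α ω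
        have := hprod (Finset.univ.erase i) β ω
        positivity
      · have := hprodpos (Finset.univ.erase i) α ω hω
        have := hprodpos (Finset.univ.erase i) β ω hω
        positivity
      · have := (h.tendsto_single_of_eq hX h0 hind hrv hα hβ hi hi0 hs hs hab.symm).2
        have e : ∀ ω, min (s⁻¹ * ∏ j ∈ Finset.univ.erase i, X j ω ^ α j)
            (s⁻¹ * ∏ j ∈ Finset.univ.erase i, X j ω ^ β j) ^ (1 / β i) =
            min (1⁻¹ * ∏ j ∈ Finset.univ.erase i, X j ω ^ α j)
            (1⁻¹ * ∏ j ∈ Finset.univ.erase i, X j ω ^ β j) ^ (1 / β i) * s ^ (-κ i) := by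
          intro ω
          have p1 := hprod (Finset.univ.erase i) α ω
          have p2 := hprod (Finset.univ.erase i) β ω
          rw [← mul_min_of_nonneg _ _ (inv_pos.2 hs).le, Real.mul_rpow (by positivity)
            (by positivity), Real.inv_rpow hs.le, inv_one, one_mul, one_mul, Real.rpow_neg hs.le,
            show 1 / β i = κ i by rw [hβk, one_div_one_div], mul_comm]
        simp only [e] at this
        rwa [integral_mul_const] at this
    · have hαk : α i = 1 / κ i := by rw [← hwk, hwα hab]; ring
      have hint := (h.tendsto_single_of_gt hX h0 hind hrv hα hβ hi hi0 one_pos one_pos hab).1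
      refine isRegularlyVaryingRV_min_of_tendsto (integral_pos_of_pos_on hind hrv hint
        (fun ω => ?_) (fun ω hω => ?_)) (fun s hs => ?_) (fun x => (hrv i).pos (x ^ κ i))
      · rw [prod_rpow_mul_indicator h0]
        exact mul_nonneg (Real.rpow_nonneg (hprod _ _ _) _) (by split_ifs <;> norm_num)
      · rw [prod_rpow_mul_indicator h0, if_pos (hprodpos _ _ ω hω), mul_one]
        exact Real.rpow_pos_of_pos (hprodpos _ _ ω hω) _
      · have := (h.tendsto_single_of_gt hX h0 hind hrv hα hβ hi hi0 hs hs hab).2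
        rwa [show 1 / α i = κ i by rw [hαk, one_div_one_div]] at this

end

/-! ### Bounds on the power scale for arbitrary solutions -/

noncomputable section

lemma isLittleO_rpow_rpow_of_lt {a b : ℝ} (hab : a < b) :
    (fun x : ℝ => x ^ a) =o[atTop] fun x : ℝ => x ^ b := by
  refine isLittleO_of_tendsto' ?_ ?_
  · filter_upwards [eventually_gt_atTop 0] with x hx h
    exact absurd h (by positivity)
  · refine (tendsto_rpow_neg_atTop (sub_pos.2 hab)).congr' ?_
    filter_upwards [eventually_gt_atTop 0] with x hx
    rw [← Real.rpow_sub hx, neg_sub]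

lemma lt_powerProduct_of_forall_lt {Ω : Type*} {n : ℕ} {X : Fin n → Ω → ℝ} {α κ : Fin n → ℝ}
    (hα : ∀ i, 0 ≤ α i) (hα_pos : ∃ i, 0 < α i)
    (hκ : 1 ≤ ∑ i, α i * κ i) {x : ℝ} (hx : 1 ≤ x) {ω : Ω} (h : ∀ i, 2 * x ^ κ i < X i ω) :
    x < powerProduct X α ω := by
  have hx0 : 0 < x := by linarith
  have hs : 0 < ∑ i, α i :=
    Finset.sum_pos' (fun i _ => hα i) (hα_pos.imp fun i hi => ⟨Finset.mem_univ i, hi⟩)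
  -- Feasibility alone gives only `≥ x`; the factor `2 ^ (∑ i, α i) > 1` makes the inequality
  -- strict.
  have e : ∏ i, (2 * x ^ κ i) ^ α i = 2 ^ (∑ i, α i) * x ^ (∑ i, α i * κ i) := by
    rw [Real.rpow_sum_of_pos two_pos, Real.rpow_sum_of_pos hx0, ← Finset.prod_mul_distrib]
    refine Finset.prod_congr rfl fun i _ => ?_
    rw [Real.mul_rpow two_pos.le (by positivity), ← Real.rpow_mul hx0.le, mul_comm (κ i)]
  calc x = 1 * x ^ (1:ℝ) := by rw [Real.rpow_one, one_mul]
    _ < 2 ^ (∑ i, α i) * x ^ (∑ i, α i * κ i) := by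
        refine mul_lt_mul (Real.one_lt_rpow one_lt_two hs)
          (Real.rpow_le_rpow_of_exponent_le hx hκ) (by positivity) (by positivity)
    _ = ∏ i, (2 * x ^ κ i) ^ α i := e.symm
    _ ≤ powerProduct X α ω := Finset.prod_le_prod (fun i _ => by positivity) fun i _ =>
        Real.rpow_le_rpow (by positivity) (h i).le (hα i)

variable {Ω : Type*} [MeasurableSpace Ω] {P : Measure Ω} [IsProbabilityMeasure P] {n : ℕ}
  {X : Fin n → Ω → ℝ} {α β κ : Fin n → ℝ}

/-- Markov's inequality for `Y₀ ^ (w * b) * Y₁ ^ ((1 - w) * b)` with `b` slightly below the optimal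
value. Duality provides a weight for which every exponent is below `1`, so the moment is finite and
the tail is `O(x ^ (-b))`. -/
lemma LPSolution.isLittleO_joint_tail (h : LPSolution α β κ)
    (hX : ∀ i, Measurable (X i)) (h0 : ∀ i ω, 0 ≤ X i ω)
    (hind : iIndepFun X P) (hrv : ∀ i, RVTail fun x => P.real {ω | x < X i ω})
    (hα : ∀ i, 0 ≤ α i) (hβ : ∀ i, 0 ≤ β i) {ε : ℝ} (hε : 0 < ε) :
    (fun x : ℝ => P.real {ω | x < powerProduct X α ω ∧ x < powerProduct X β ω})
      =o[atTop] fun x : ℝ => x ^ (ε - ∑ i, κ i) := by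
  have hV := h.sum_pos
  set V := ∑ i, κ i with hVdef
  obtain ⟨b, hb0, hbV, hbε⟩ : ∃ b, 0 < b ∧ b < V ∧ V - ε < b := by
    have hmin : 0 < min ε V := lt_min hε hV
    refine ⟨V - min ε V / 2, ?_, by linarith, ?_⟩
    · have := min_le_right ε V; linarith
    · have := min_le_left ε V; linarith
  obtain ⟨w, hw0, hw1, hw⟩ := h.exists_weight (c := 1 / b) (one_div_lt_one_div_of_lt hb0 hbV)
  have hw1' := sub_nonneg.2 hw1
  have hint := integrable_partialProducts_rpow hX h0 hind hrv hα hβ (s := Finset.univ)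
    (a := w * b) (b := (1 - w) * b) (by positivity) (by positivity) fun m _ => by
      have := (lt_div_iff₀ hb0).1 (hw m)
      linarith
  set Z := fun ω => (partialProducts X α β Finset.univ ω).1 ^ (w * b) *
    (partialProducts X α β Finset.univ ω).2 ^ ((1 - w) * b) with hZ
  have hZ0 : ∀ ω, 0 ≤ Z ω := fun ω =>
    mul_nonneg (Real.rpow_nonneg (partialProducts_nonneg h0 _ ω).1 _)
      (Real.rpow_nonneg (partialProducts_nonneg h0 _ ω).2 _)
  refine IsBigO.trans_isLittleO (g := fun x : ℝ => x ^ (-b)) ?_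
    (isLittleO_rpow_rpow_of_lt (by linarith))
  refine IsBigO.of_bound (∫ ω, Z ω ∂P) ?_
  filter_upwards [eventually_gt_atTop 0] with x hx
  rw [Real.norm_of_nonneg measureReal_nonneg, Real.norm_of_nonneg (by positivity),
    Real.rpow_neg hx.le, ← div_eq_mul_inv, le_div_iff₀ (by positivity), mul_comm]
  have hm := mul_meas_ge_le_integral_of_nonneg (ae_of_all _ hZ0) hint (x ^ b)
  refine le_trans (mul_le_mul_of_nonneg_left (measureReal_mono fun ω hω => ?_) (by positivity)) hm
  obtain ⟨h1, h2⟩ := hω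
  have p1 : 0 ≤ powerProduct X α ω := by linarith
  have p2 : 0 ≤ powerProduct X β ω := by linarith
  change x ^ b ≤ powerProduct X α ω ^ (w * b) * powerProduct X β ω ^ ((1 - w) * b)
  calc x ^ b = x ^ (w * b) * x ^ ((1 - w) * b) := by
        rw [← Real.rpow_add hx]; ring_nf
    _ ≤ _ := by gcongr

/-- The box `X i > 2 * x ^ κ i` lies inside the event. Its probability factors, and Potter's lower
bound costs only `x ^ (-δ * ∑ κ i)`, which is absorbed by `ε`. -/
lemma LPSolution.rpow_isLittleO_joint_tail (h : LPSolution α β κ)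
    (hind : iIndepFun X P) (hrv : ∀ i, RVTail fun x => P.real {ω | x < X i ω})
    (hα : ∀ i, 0 ≤ α i) (hβ : ∀ i, 0 ≤ β i) (hα_pos : ∃ i, 0 < α i) (hβ_pos : ∃ i, 0 < β i)
    {ε : ℝ} (hε : 0 < ε) :
    (fun x : ℝ => x ^ (-ε - ∑ i, κ i)) =o[atTop]
      fun x : ℝ => P.real {ω | x < powerProduct X α ω ∧ x < powerProduct X β ω} := by
  have hV := h.sum_pos
  have hκ0 := h.1.2.2
  obtain ⟨δ, hδ, hδ1, hδε⟩ : ∃ δ : ℝ, 0 < δ ∧ δ < 1 ∧ δ * ∑ i, κ i < ε := by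
    refine ⟨min (1 / 2) (ε / (2 * ∑ i, κ i)), by positivity,
      (min_le_left _ _).trans_lt (by norm_num), ?_⟩
    refine lt_of_le_of_lt (mul_le_mul_of_nonneg_right (min_le_right _ _) hV.le) ?_
    field_simp
    linarith
  choose c hc H using fun i => (hrv i).ge_rpow hδ hδ1
  set C := ∏ i, c i * 2 ^ (-1 - δ) with hC
  have hC0 : 0 < C := Finset.prod_pos fun i _ => mul_pos (hc i) (by positivity)
  refine IsLittleO.trans_isBigO (g := fun x : ℝ => x ^ ((-1 - δ) * ∑ i, κ i))
    (isLittleO_rpow_rpow_of_lt (by linarith)) (IsBigO.of_bound C⁻¹ ?_)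
  filter_upwards [eventually_ge_atTop 1] with x hx
  have hx0 : 0 < x := by linarith
  rw [Real.norm_of_nonneg measureReal_nonneg, Real.norm_of_nonneg (by positivity),
    ← div_eq_inv_mul, le_div_iff₀ hC0, mul_comm]
  calc C * x ^ ((-1 - δ) * ∑ i, κ i) = ∏ i, c i * (2 * x ^ κ i) ^ (-1 - δ) := by
        rw [hC, Finset.mul_sum, Real.rpow_sum_of_pos hx0, ← Finset.prod_mul_distrib]
        refine Finset.prod_congr rfl fun i _ => ?_
        rw [Real.mul_rpow two_pos.le (by positivity), ← Real.rpow_mul hx0.le, mul_comm (κ i)]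
        ring
    _ ≤ ∏ i, P.real {ω | 2 * x ^ κ i < X i ω} := by
        refine Finset.prod_le_prod (fun i _ => ?_) fun i _ => H i _ ?_
        · have := hc i
          positivity
        · have := Real.one_le_rpow hx (hκ0 i)
          linarith
    _ = P.real {ω | ∀ i, 2 * x ^ κ i < X i ω} := (measureReal_all_pos hind hrv _).1.symm
    _ ≤ P.real {ω | x < powerProduct X α ω ∧ x < powerProduct X β ω} :=
      measureReal_mono fun ω hω =>
        ⟨lt_powerProduct_of_forall_lt hα hα_pos h.1.1 hx hω,
          lt_powerProduct_of_forall_lt hβ hβ_pos h.1.2.1 hx hω⟩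

end

/-! ### The main theorem -/

theorem mainTheorem5 {Ω : Type*} [MeasurableSpace Ω] (P : Measure Ω) [IsProbabilityMeasure P]
    (n : ℕ) (X : Fin n → Ω → ℝ) (α β : Fin n → ℝ)
    (hX_meas : ∀ i, Measurable (X i))
    (hX_nonneg : ∀ i, ∀ᵐ ω ∂P, 0 ≤ X i ω)
    (hX_indep : iIndepFun X P)
    (hX_rv : ∀ i, IsRegularlyVaryingRV P (X i) (-1))
    (hα : ∀ i, 0 ≤ α i) (hβ : ∀ i, 0 ≤ β i)
    (hα_pos : ∃ i, 0 < α i) (hβ_pos : ∃ i, 0 < β i) :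
    -- the linear program has a solution
    (∃ κ : Fin n → ℝ, LPSolution α β κ) ∧
    -- consequences of uniqueness
    (∀ κ : Fin n → ℝ, LPUniqueSolution α β κ →
      (Finset.univ.filter (fun i => 0 < κ i)).card ≤ 2 ∧
      IsRegularlyVaryingRV P (fun ω => min (powerProduct X α ω) (powerProduct X β ω))
        (-∑ i, κ i) ∧
      -- (i) two positive components
      (∀ i j : Fin n, i ≠ j → 0 < κ i → 0 < κ j →
        α i * β j - α j * β i ≠ 0 ∧ (α i - α j) * (β j - β i) ≠ 0 ∧
        Integrable (fun ω => ∏ m ∈ Finset.univ \ {i, j},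
          X m ω ^ ((α m * (β j - β i) + β m * (α i - α j)) / (α i * β j - α j * β i))) P ∧
        ∀ s₀ s₁ : ℝ, 0 < s₀ → 0 < s₁ →
          Tendsto (fun x : ℝ =>
              P.real {ω | s₀ * x < powerProduct X α ω ∧ s₁ * x < powerProduct X β ω} /
                (P.real {ω | x ^ κ i < X i ω} * P.real {ω | x ^ κ j < X j ω}))
            atTop
            (𝓝 ((|α i * β j - α j * β i| / ((α i - α j) * (β j - β i)) *
                  ∫ ω, ∏ m ∈ Finset.univ \ {i, j},
                    X m ω ^ ((α m * (β j - β i) + β m * (α i - α j)) /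
                      (α i * β j - α j * β i)) ∂P) *
                s₀ ^ ((β i - β j) / (α i * β j - α j * β i)) *
                s₁ ^ ((α j - α i) / (α i * β j - α j * β i))))) ∧
      -- (ii) exactly one positive component
      (∀ i : Fin n, 0 < κ i → (∀ j, j ≠ i → κ j = 0) →
        0 < α i ∧ 0 < β i ∧
        ∀ s₀ s₁ : ℝ, 0 < s₀ → 0 < s₁ →
          (α i = β i →
            Integrable (fun ω => min (s₀⁻¹ * ∏ j ∈ Finset.univ.erase i, X j ω ^ α j)
              (s₁⁻¹ * ∏ j ∈ Finset.univ.erase i, X j ω ^ β j) ^ (1 / β i)) P ∧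
            Tendsto (fun x : ℝ =>
                P.real {ω | s₀ * x < powerProduct X α ω ∧ s₁ * x < powerProduct X β ω} /
                  P.real {ω | x ^ κ i < X i ω})
              atTop
              (𝓝 (∫ ω, min (s₀⁻¹ * ∏ j ∈ Finset.univ.erase i, X j ω ^ α j)
                (s₁⁻¹ * ∏ j ∈ Finset.univ.erase i, X j ω ^ β j) ^ (1 / β i) ∂P))) ∧
          (β i < α i →
            Integrable (fun ω => ∏ j ∈ Finset.univ.erase i,
              X j ω ^ (β j / β i) * Set.indicator {ω' | 0 < X j ω' ^ α j} 1 ω) P ∧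
            Tendsto (fun x : ℝ =>
                P.real {ω | s₀ * x < powerProduct X α ω ∧ s₁ * x < powerProduct X β ω} /
                  P.real {ω | x ^ κ i < X i ω})
              atTop
              (𝓝 ((∫ ω, ∏ j ∈ Finset.univ.erase i,
                X j ω ^ (β j / β i) * Set.indicator {ω' | 0 < X j ω' ^ α j} 1 ω ∂P) *
                  s₁ ^ (-(1 / β i))))) ∧
          (α i < β i →
            Integrable (fun ω => ∏ j ∈ Finset.univ.erase i,
              X j ω ^ (α j / α i) * Set.indicator {ω' | 0 < X j ω' ^ β j} 1 ω) P ∧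
            Tendsto (fun x : ℝ =>
                P.real {ω | s₀ * x < powerProduct X α ω ∧ s₁ * x < powerProduct X β ω} /
                  P.real {ω | x ^ κ i < X i ω})
              atTop
              (𝓝 ((∫ ω, ∏ j ∈ Finset.univ.erase i,
                X j ω ^ (α j / α i) * Set.indicator {ω' | 0 < X j ω' ^ β j} 1 ω ∂P) *
                  s₀ ^ (-(1 / α i))))))) ∧
    -- (iii) for every solution, unique or not
    (∀ κ : Fin n → ℝ, LPSolution α β κ → ∀ ε : ℝ, 0 < ε →
      (fun x : ℝ => P.real {ω | x < powerProduct X α ω ∧ x < powerProduct X β ω})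
        =o[atTop] (fun x : ℝ => x ^ (ε - ∑ i, κ i)) ∧
      (fun x : ℝ => x ^ (-ε - ∑ i, κ i))
        =o[atTop] (fun x : ℝ => P.real {ω | x < powerProduct X α ω ∧ x < powerProduct X β ω})) := by
  -- Truncation makes nonnegativity hold everywhere. Measurability and independence are preserved,
  -- and all probabilities and integrals in the claim depend only on almost sure equality classes.
  let X' : Fin n → Ω → ℝ := fun i ω => max (X i ω) 0
  have hX' : ∀ i, Measurable (X' i) := fun i => (hX_meas i).max measurable_const
  have h0 : ∀ i ω, 0 ≤ X' i ω := fun i ω => le_max_right _ _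
  have hind : iIndepFun X' P :=
    hX_indep.comp (fun _ x => max x 0) fun _ => measurable_id.max measurable_const
  have hae : ∀ᵐ ω ∂P, ∀ i, X' i ω = X i ω := by
    filter_upwards [ae_all_iff.2 hX_nonneg] with ω hω i
    exact max_eq_left (hω i)
  have htail : ∀ i x, P.real {ω | x < X' i ω} = P.real {ω | x < X i ω} := by
    refine fun i x => measureReal_congr ?_
    filter_upwards [hae] with ω hω
    exact congrArg (x < ·) (hω i)
  have hpp : ∀ᵐ ω ∂P, ∀ γ, powerProduct X' γ ω = powerProduct X γ ω := by
    filter_upwards [hae] with ω hω γ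
    simp only [powerProduct, hω]
  have hjoint : ∀ y z, P.real {ω | y < powerProduct X' α ω ∧ z < powerProduct X' β ω} =
      P.real {ω | y < powerProduct X α ω ∧ z < powerProduct X β ω} := by
    refine fun y z => measureReal_congr ?_
    filter_upwards [hpp] with ω hω
    exact congrArg₂ (fun s t => y < s ∧ z < t) (hω α) (hω β)
  have hrv : ∀ i, RVTail fun x => P.real {ω | x < X' i ω} := fun i => by
    simp only [htail]
    exact (hX_rv i).rvTail
  have hind_eq : ∀ (γ : Fin n → ℝ) (i : Fin n) (a : Fin n → ℝ),
      (fun ω => ∏ j ∈ Finset.univ.erase i,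
        X' j ω ^ a j * Set.indicator {ω' | 0 < X' j ω' ^ γ j} 1 ω) =ᵐ[P]
      fun ω => ∏ j ∈ Finset.univ.erase i,
        X j ω ^ a j * Set.indicator {ω' | 0 < X j ω' ^ γ j} 1 ω := by
    intro γ i a
    filter_upwards [hae] with ω hω
    simp only [Set.indicator_apply, Set.mem_ofPred_eq, hω]
  refine ⟨exists_lpSolution hα hβ hα_pos hβ_pos, fun κ h => ⟨h.card_pos_le_two, ?_, ?_, ?_⟩,
    fun κ h ε hε => ⟨?_, ?_⟩⟩
  · have key := h.isRegularlyVaryingRV_min hX' h0 hind hrv hα hβ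
    have e : ∀ x, P.real {ω | x < min (powerProduct X' α ω) (powerProduct X' β ω)} =
        P.real {ω | x < min (powerProduct X α ω) (powerProduct X β ω)} := fun x => by
      simpa only [lt_min_iff] using hjoint x x
    simpa only [IsRegularlyVaryingRV, e] using key
  · intro i j hij hi hj
    have hdet := h.det_ne_zero hij hi hj
    have hl := h.multiplier_left_pos hij hi hj
    have hm := h.multiplier_right_pos hij hi hj
    have hne : (α i - α j) * (β j - β i) ≠ 0 :=
      mul_ne_zero (fun e => by simp [e] at hm) (fun e => by simp [e] at hl)
    have heq : (fun ω => ∏ m ∈ Finset.univ \ {i, j},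
        X' m ω ^ ((α m * (β j - β i) + β m * (α i - α j)) / (α i * β j - α j * β i))) =ᵐ[P]
        fun ω => ∏ m ∈ Finset.univ \ {i, j},
          X m ω ^ ((α m * (β j - β i) + β m * (α i - α j)) / (α i * β j - α j * β i)) := by
      filter_upwards [hae] with ω hω
      simp only [hω]
    refine ⟨hdet, hne, ?_, fun s₀ s₁ hs₀ hs₁ => ?_⟩
    · exact (h.tendsto_pair hX' h0 hind hrv hα hβ hij hi hj one_pos one_pos).1.congr heq
    · have key := (h.tendsto_pair hX' h0 hind hrv hα hβ hij hi hj hs₀ hs₁).2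
      simp only [hjoint, htail] at key
      rwa [integral_congr_ae heq] at key
  · intro i hi hi0
    obtain ⟨ha1, hb1, -⟩ := h.exists_weight_single hi hi0
    have hk : 0 < 1 / κ i := by positivity
    refine ⟨by linarith, by linarith, fun s₀ s₁ hs₀ hs₁ => ⟨fun hab => ?_, fun hab => ?_,
      fun hab => ?_⟩⟩
    · have key := h.tendsto_single_of_eq hX' h0 hind hrv hα hβ hi hi0 hs₀ hs₁ hab
      simp only [hjoint, htail] at key
      have heq : (fun ω => min (s₀⁻¹ * ∏ j ∈ Finset.univ.erase i, X' j ω ^ α j)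
          (s₁⁻¹ * ∏ j ∈ Finset.univ.erase i, X' j ω ^ β j) ^ (1 / β i)) =ᵐ[P]
          fun ω => min (s₀⁻¹ * ∏ j ∈ Finset.univ.erase i, X j ω ^ α j)
          (s₁⁻¹ * ∏ j ∈ Finset.univ.erase i, X j ω ^ β j) ^ (1 / β i) := by
        filter_upwards [hae] with ω hω
        simp only [hω]
      rw [integral_congr_ae heq] at key
      exact ⟨key.1.congr heq, key.2⟩
    · have key := h.tendsto_single_of_lt hX' h0 hind hrv hα hβ hi hi0 hs₀ hs₁ hab
      simp only [hjoint, htail] at key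
      have heq := hind_eq α i fun j => β j / β i
      rw [integral_congr_ae heq] at key
      exact ⟨key.1.congr heq, key.2⟩
    · have key := h.tendsto_single_of_gt hX' h0 hind hrv hα hβ hi hi0 hs₀ hs₁ hab
      simp only [hjoint, htail] at key
      have heq := hind_eq β i fun j => α j / α i
      rw [integral_congr_ae heq] at key
      exact ⟨key.1.congr heq, key.2⟩
  · simpa only [hjoint] using h.isLittleO_joint_tail hX' h0 hind hrv hα hβ hε
  · simpa only [hjoint] using
      h.rpow_isLittleO_joint_tail hind hrv hα hβ hα_pos hβ_pos hε
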